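/- **Theorem (strong local nondeterminism of $U$).** Let $d\ge 1$, $\tfrac12<H<1$, $0<\alpha\le 2$, $0<\beta<d$ with $\beta>d-2\alpha H$, and put $$H_1=H-\frac{d-\beta}{2\alpha}>0,\qquad H_2=\alpha H_1 .$$ Let $X$ be a symmetric Lévy process in $\mathbb R^d$, $\mathbb E e^{i\langle\xi,X_t\rangle}=e^{-t\Psi(\xi)}$, with $c|\xi|^\alpha\le\Psi(\xi)\le C|\xi|^\alpha$ for all $\xi\in\mathbb{R}^d$, with transition density $p_t(x)=(2\pi)^{-d}\int e^{-i\langle x,\xi\rangle}e^{-t\Psi(\xi)}d\xi$ for $t>0$ and $p_t=0$ for $t\le 0$. Let $B$ be the fractional-colored Gaussian noise on $\mathbb R\times\mathbb R^d$ with Hurst index $H$ in time and spatial spectral measure $\mu$, i.e. the centered Gaussian process indexed by test functions with $$\mathbb E[B(\varphi)B(\psi)]=\frac{H(2H-1)}{(2\pi)^d}\int_{\mathbb R}\int_{\mathbb R}|u-v|^{2H-2}\int_{\mathbb R^d}\mathcal F\varphi(u,\cdot)(\xi)\,\overline{\mathcal F\psi(v,\cdot)(\xi)}\,\mu(d\xi)\,du\,dv,$$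 extended by $L^2$-isometry to kernels, where $c'|\xi|^{-\beta}d\xi\le\mu(d\xi)\le C'|\xi|^{-\beta}d\xi$; here $c,C,c',C'$ are positive constants. Define $\sigma(r)=r^{2H_2}$ if $H_2<1$, $\sigma(r)=r^2\max(1,|\log r|)$ if $H_2=1$, and $\sigma(r)=r^2$ if $H_2>1$ (with $\sigma(0)=0$). **(A)** Let $H_2<1$ and let $U$ be the field with stationary increments $$U(t,x)=\int_{\mathbb R}\int_{\mathbb R^d}\big(p_{(t-u)_+}(x-y)-p_{(-u)_+}(-y)\big)B(du,dy),\qquad t\ge0,\ x\in\mathbb R^d .$$ There are constants $K,K_1>0$ such that for all $n\ge 0$, $t>0$, $x\in\mathbb R^d$ and $(s^1,x^1),\dots,(s^n,x^n)\in[0,\infty)\times\mathbb R^d$, with $(s^0,x^0)=(0,0)$, almost surely $$K\min_{0\le k\le n}\big(|t-s^k|^{H_1}+|x-x^k|^{H_2}\big)^2\le \mathrm{Var}\big(U(t,x)\,|\,U(s^1,x^1),\dots,U(s^n,x^n)\big)\le K_1\min_{0\le k\le n}\big(|t-s^k|^{2H_1}+\sigma(|x-x^k|)\big),$$ and for all $s,t\ge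 0$ and $x,y\in\mathbb R^d$ $$\mathbb E\big[(U(t,x)-U(s,y))^2\big]\le K_1\big(|t-s|^{2H_1}+\sigma(|x-y|)\big).$$ **(B)** Let $H_2$ be arbitrary ($H_2<1$, $=1$ or $>1$) and let $$U(t,x)=\int_{\mathbb R}\int_{\mathbb R^d}\big(p_{(t-u)_+}(x-y)-p_{(-u)_+}(x-y)\big)B(du,dy),\qquad t\ge0,\ x\in\mathbb R^d .$$ Then the same lower bound holds with some $K>0$, for all $n\ge0$, $t>0$, $x$, $(s^k,x^k)\in[0,\infty)\times\mathbb{R}^d$, where now $(s^0,x^0)=(0,x)$. Moreover for every $T>0$ there is $K_1=K_1(T)>0$, which can be chosen independent of $T$ if $H_2<1$, such that the two upper bounds hold whenever all the times $s,t,s^1,\dots,s^n$ involved lie in $[0,T]$, again with $(s^0,x^0)=(0,x)$ and $t>0$ in the conditional-variance bound. -/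

import Mathlib

open MeasureTheory ProbabilityTheory Filter Topology
open scoped ENNReal NNReal

/-- The Euclidean space `ℝᵈ`. -/
abbrev Space (d : ℕ) : Type := EuclideanSpace ℝ (Fin d)

/-- Real test functions on `ℝ × ℝᵈ` (smooth, compactly supported). -/
abbrev SpaceTimeTest (d : ℕ) : Type :=
  TestFunction (⊤ : TopologicalSpace.Opens (ℝ × Space d)) ℝ ⊤

/-- A Lévy process in `ℝᵈ`: it starts at `0`, has independent and stationary increments,
and is stochastically continuous. -/
structure IsLevyProcess {d : ℕ} {Ω : Type*} [MeasurableSpace Ω] (P : Measure Ω)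
    (X : ℝ≥0 → Ω → Space d) : Prop where
  measurable : ∀ t, Measurable (X t)
  start : ∀ᵐ ω ∂P, X 0 ω = 0
  indep : HasIndepIncrements X P
  stationary : ∀ s t : ℝ≥0,
    IdentDistrib (fun ω => X (s + t) ω - X s ω) (X t) P P
  stochCont : ∀ t : ℝ≥0, TendstoInMeasure P X (𝓝 t) (X t)

/-- `Ψ` is the (real-valued) characteristic exponent of the symmetric Lévy process `X`:
`E exp(i⟨ξ, X_t⟩) = exp(-t Ψ(ξ))`. -/
structure IsSymmetricLevyWithExponent {d : ℕ} {Ω : Type*} [MeasurableSpace Ω] (P : Measure Ω)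
    (X : ℝ≥0 → Ω → Space d) (Ψ : Space d → ℝ) : Prop where
  levy : IsLevyProcess P X
  symm : ∀ t : ℝ≥0, IdentDistrib (X t) (fun ω => - X t ω) P P
  exponent : ∀ (t : ℝ≥0) (ξ : Space d),
    ∫ ω, Complex.exp (Complex.I * (inner ℝ ξ (X t ω) : ℝ)) ∂P
      = (Real.exp (-(t * Ψ ξ)) : ℂ)

/-- `Ψ(ξ) ≍ |ξ|^α` on `ℝᵈ`. -/
def ExponentComparable {d : ℕ} (Ψ : Space d → ℝ) (α : ℝ) : Prop :=
  ∃ c C : ℝ, 0 < c ∧ ∀ ξ, c * ‖ξ‖ ^ α ≤ Ψ ξ ∧ Ψ ξ ≤ C * ‖ξ‖ ^ α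

/-- `μ(dξ) ≍ |ξ|^{-β} dξ` on `ℝᵈ`. -/
def MeasureComparable {d : ℕ} (μ : Measure (Space d)) (β : ℝ) : Prop :=
  ∃ c C : ℝ≥0, 0 < c ∧
    c • volume.withDensity (fun ξ : Space d => ENNReal.ofReal (‖ξ‖ ^ (-β))) ≤ μ ∧
    μ ≤ C • volume.withDensity (fun ξ : Space d => ENNReal.ofReal (‖ξ‖ ^ (-β)))

/-- Fourier transform in space, `∫ exp(-i⟨ξ, y⟩) φ(y) dy`. -/
noncomputable def spaceFT {d : ℕ} (φ : Space d → ℝ) (ξ : Space d) : ℂ :=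
  ∫ y, Complex.exp (-Complex.I * (inner ℝ ξ y : ℝ)) * (φ y : ℂ)

/-- Fourier transform in time and space. -/
noncomputable def spaceTimeFT {d : ℕ} (g : ℝ → Space d → ℝ) (τ : ℝ) (ξ : Space d) : ℂ :=
  ∫ u : ℝ, Complex.exp (-Complex.I * (τ * u : ℝ)) * spaceFT (g u) ξ

/-- The fractional-colored noise with Hurst index `H` in time and spatial covariance
`f = ℱμ`, as a centered Gaussian process indexed by test functions, with
`E[B(φ)B(ψ)] = H(2H-1) ∫∫ |u-v|^{2H-2} ∫∫ φ(u,x) f(x-y) ψ(v,y) dx dy du dv`,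
where the double integral against `f` is understood, as usual for a spectral measure `μ`, as
`(2π)^{-d} ∫ ℱφ(u,·)(ξ) conj(ℱψ(v,·)(ξ)) μ(dξ)`. (The real part is automatic for the
symmetric `μ` of a real-valued `f`.) -/
structure IsFractionalColoredNoise {d : ℕ} (H : ℝ) (μ : Measure (Space d))
    {Ω : Type*} [MeasurableSpace Ω] (P : Measure Ω) (B : SpaceTimeTest d → Ω → ℝ) : Prop where
  gaussian : IsGaussianProcess B P
  centered : ∀ φ, ∫ ω, B φ ω ∂P = 0
  covariance : ∀ φ ψ : SpaceTimeTest d,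
    ∫ ω, B φ ω * B ψ ω ∂P
      = H * (2 * H - 1) * (2 * Real.pi) ^ (-(d : ℝ)) *
        ∫ u : ℝ, ∫ v : ℝ, |u - v| ^ (2 * H - 2) *
          (∫ ξ, spaceFT (fun y => φ (u, y)) ξ *
            (starRingEnd ℂ) (spaceFT (fun y => ψ (v, y)) ξ) ∂μ).re

/-- Squared distance between `φ` and `g` in the Hilbert space of the noise (up to a positive
constant factor), in Fourier form:
`∫∫ |τ|^{1-2H} |φ̂(τ,ξ) - ĝ(τ,ξ)|² dτ μ(dξ)`. -/
noncomputable def noiseDistSq {d : ℕ} (H : ℝ) (μ : Measure (Space d))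
    (φ g : ℝ → Space d → ℝ) : ℝ≥0∞ :=
  ∫⁻ ξ, (∫⁻ τ : ℝ, ENNReal.ofReal
    (|τ| ^ (1 - 2 * H) * ‖spaceTimeFT φ τ ξ - spaceTimeFT g τ ξ‖ ^ 2)) ∂μ

/-- `Z = ∫∫ g(u,y) B(du,dy)`: the integral of a deterministic kernel is the `L²(P)`-limit of
`B(φₙ)` along test functions `φₙ` that converge to `g` in the Hilbert space of the noise. -/
def IsNoiseIntegral {d : ℕ} (H : ℝ) (μ : Measure (Space d)) {Ω : Type*} [MeasurableSpace Ω]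
    (P : Measure Ω) (B : SpaceTimeTest d → Ω → ℝ) (g : ℝ → Space d → ℝ) (Z : Ω → ℝ) : Prop :=
  ∃ φ : ℕ → SpaceTimeTest d,
    Tendsto (fun n => noiseDistSq H μ (fun u y => φ n (u, y)) g) atTop (𝓝 0) ∧
    Tendsto (fun n => eLpNorm (fun ω => B (φ n) ω - Z ω) 2 P) atTop (𝓝 0)

/-- The transition density `p_s(z) = (2π)^{-d} ∫ exp(-i⟨z, ξ⟩) exp(-sΨ(ξ)) dξ` for `s > 0`,
and `0` for `s ≤ 0`. -/
noncomputable def transitionDensity {d : ℕ} (Ψ : Space d → ℝ) (s : ℝ) (z : Space d) : ℝ :=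
  if 0 < s then
    (2 * Real.pi) ^ (-(d : ℝ)) *
      (∫ ξ, Complex.exp (-Complex.I * (inner ℝ z ξ : ℝ)) * (Real.exp (-(s * Ψ ξ)) : ℂ)).re
  else 0

/-- The kernel `(u, y) ↦ p_{(t-u)₊}(x-y) - p_{(-u)₊}(b-y)`. -/
noncomputable def pinnedKernel {d : ℕ} (Ψ : Space d → ℝ) (b : Space d) (t : ℝ) (x : Space d)
    (u : ℝ) (y : Space d) : ℝ :=
  transitionDensity Ψ (max (t - u) 0) (x - y) - transitionDensity Ψ (max (-u) 0) (b - y)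

/-- `U(t,x) = ∫∫ (p_{(t-u)₊}(x-y) - p_{(-u)₊}(b(x)-y)) B(du,dy)` for all `t ≥ 0` and `x`. -/
def IsPinnedField {d : ℕ} (H : ℝ) (μ : Measure (Space d)) (Ψ : Space d → ℝ)
    {Ω : Type*} [MeasurableSpace Ω] (P : Measure Ω) (B : SpaceTimeTest d → Ω → ℝ)
    (b : Space d → Space d) (U : ℝ → Space d → Ω → ℝ) : Prop :=
  ∀ t : ℝ, 0 ≤ t → ∀ x : Space d,
    Measurable (U t x) ∧ IsNoiseIntegral H μ P B (pinnedKernel Ψ (b x) t x) (U t x)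

/-- `Var(U(t,x) | U(s¹,y¹), …, U(sⁿ,yⁿ))`; the points are indexed by `1, …, n` in
`Fin (n + 1)`, the index `0` being left for the reference point. -/
noncomputable def condVarAt {d n : ℕ} {Ω : Type*} [MeasurableSpace Ω] (P : Measure Ω)
    (U : ℝ → Space d → Ω → ℝ) (t : ℝ) (x : Space d)
    (s : Fin (n + 1) → ℝ) (y : Fin (n + 1) → Space d) : Ω → ℝ :=
  condVar (⨆ k : Fin n, MeasurableSpace.comap (U (s k.succ) (y k.succ)) inferInstance)
    (U t x) P

/-- `σ(r) = r^{2h}` if `h < 1`, `r² max(1, |log r|)` if `h = 1`, and `r²` if `h > 1`. -/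
noncomputable def spatialModulus (h r : ℝ) : ℝ :=
  if h < 1 then r ^ (2 * h)
  else if h = 1 then r ^ 2 * max 1 |Real.log r|
  else r ^ 2

/-! Everything is transported to frequency space. Integrals of deterministic kernels against `B` are
jointly centered Gaussian, and the second moment of a linear combination is a constant times the
integral of |τ|^{1-2H} |ĝ(τ,ξ)|² dτ μ(dξ), ĝ being the space-time Fourier transform of the combined
kernel. For the kernel of (t,x) with pin b it equals (e^{-i(τt+⟨ξ,x⟩)} - e^{-i⟨ξ,b⟩})/(Ψ(ξ) - iτ).
As Ψ ≍ |ξ|^α and μ ≍ |ξ|^{-β}dξ, second moments are comparable to the energy of a trigonometric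
polynomial N in L² of the weight w = |τ|^{1-2H} |ξ|^{-β}/(|ξ|^{2α}+τ²). For Gaussian vectors the
conditional variance is a.s. the constant min over a of E(U(t,x) - Σ a_k U(s^k,x^k))², so both
bounds concern such energies.

Lower bound (`exists_spectral_lower_bound`): duality. If every other point, pins included, is at
time distance at least ρ or space distance at least ρ^{1/α} from (t,x), test N against F =
e^{i(τt+⟨ξ,x⟩)} G₂(ξ) G₁(τ), where the inverse transforms of G₁ and G₂ are bumps equal to 1 at the
origin and vanishing beyond distance ρ and ρ^{1/α}. Then ∫NF = 1 for any coefficients, and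
Cauchy–Schwarz gives 1 ≤ energy(N) · ∫ w⁻¹|F|². Scaling makes the last integral at most a multiple
of ρ^{-2H₁}. No restriction on H₂ is needed. The pins only add frequencies: in (A) the pin is the
reference point itself; in (B) all pins lie at time 0, at time distance t from (t,x).

Upper bound: compare with a single conditioning point, or with 0 for the reference point, where U
vanishes almost surely. Time increments: integrating w over ξ first leaves |τ|^{-1-2H₁} min(4,
τ²h²), whose integral is a multiple of h^{2H₁}. Space increments: integrating over τ first leaves
|ξ|^{-d-2H₂} min(4, |ξ|²r²), giving r^{2H₂} when H₂ < 1. When H₂ ≥ 1 this diverges at low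
frequencies; the pinning in (B) supplies a factor |e^{-iτs}-1|² that lowers the singularity there to
|ξ|^{-β}, with a constant depending on T. High frequencies then yield r², or r² times a logarithm if
H₂ = 1. -/

/-! ### L² limits of Gaussian families -/

section L2Limits

variable {Ω : Type*} [MeasurableSpace Ω] {P : Measure Ω}

theorem tendsto_integral_mul_of_tendsto_eLpNorm {f g : ℕ → Ω → ℝ} {f' g' : Ω → ℝ}
    (hf : ∀ n, MemLp (f n) 2 P) (hg : ∀ n, MemLp (g n) 2 P)
    (hf' : MemLp f' 2 P) (hg' : MemLp g' 2 P)
    (hfl : Tendsto (fun n => eLpNorm (f n - f') 2 P) atTop (𝓝 0))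
    (hgl : Tendsto (fun n => eLpNorm (g n - g') 2 P) atTop (𝓝 0)) :
    Tendsto (fun n => ∫ ω, f n ω * g n ω ∂P) atTop (𝓝 (∫ ω, f' ω * g' ω ∂P)) := by
  have h1 := (Lp.tendsto_Lp_iff_tendsto_eLpNorm'' f hf f' hf').2 hfl
  have h2 := (Lp.tendsto_Lp_iff_tendsto_eLpNorm'' g hg g' hg').2 hgl
  have key : ∀ {u v : Ω → ℝ} (hu : MemLp u 2 P) (hv : MemLp v 2 P),
      inner ℝ (hu.toLp u) (hv.toLp v) = ∫ ω, u ω * v ω ∂P := by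
    intro u v hu hv
    rw [L2.inner_def]
    refine integral_congr_ae ?_
    filter_upwards [hu.coeFn_toLp, hv.coeFn_toLp] with ω h1 h2
    rw [h1, h2]; simp [mul_comm]
  have h3 := h1.inner h2 (𝕜 := ℝ)
  simpa only [key] using h3

theorem memLp_of_tendsto_eLpNorm {F : Type*} [NormedAddCommGroup F] {p : ℝ≥0∞}
    {f : ℕ → Ω → F} {f' : Ω → F}
    (hf : ∀ n, MemLp (f n) p P) (hf' : AEStronglyMeasurable f' P)
    (hfl : Tendsto (fun n => eLpNorm (f n - f') p P) atTop (𝓝 0)) : MemLp f' p P := by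
  obtain ⟨n, hn⟩ := (hfl.eventually (gt_mem_nhds (zero_lt_one (α := ℝ≥0∞)))).exists
  have h1 : MemLp (f n - f') p P := ⟨(hf n).1.sub hf', hn.trans ENNReal.one_lt_top⟩
  have := (hf n).sub h1
  simpa using this

theorem tendsto_eLpNorm_sum {F : Type*} [NormedAddCommGroup F] [NormedSpace ℝ F] {ι : Type*}
    [Fintype ι] {f : ℕ → ι → Ω → F} {f' : ι → Ω → F}
    (c : ι → ℝ) (hf : ∀ n i, AEStronglyMeasurable (f n i) P)
    (hf' : ∀ i, AEStronglyMeasurable (f' i) P)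
    (hfl : ∀ i, Tendsto (fun n => eLpNorm (f n i - f' i) 2 P) atTop (𝓝 0)) :
    Tendsto (fun n => eLpNorm ((fun ω => ∑ i, c i • f n i ω) - fun ω => ∑ i, c i • f' i ω) 2 P)
      atTop (𝓝 0) := by
  have h : Tendsto (fun n => ∑ i, ‖c i‖ₑ * eLpNorm (f n i - f' i) 2 P) atTop
      (𝓝 (∑ i, ‖c i‖ₑ * 0)) :=
    tendsto_finsetSum _ fun i _ => ENNReal.Tendsto.const_mul (hfl i) (Or.inr (by simp))
  simp only [mul_zero, Finset.sum_const_zero] at h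
  refine tendsto_of_tendsto_of_tendsto_of_le_of_le tendsto_const_nhds h (fun _ => bot_le)
    fun n => ?_
  have e : ((fun ω => ∑ i, c i • f n i ω) - fun ω => ∑ i, c i • f' i ω)
      = ∑ i, c i • (f n i - f' i) := by
    ext ω
    simp [Finset.sum_apply, smul_sub]
  rw [e]
  refine (eLpNorm_sum_le (fun i _ => ((hf n i).sub (hf' i)).const_smul _) (by norm_num)).trans ?_
  refine Finset.sum_le_sum fun i _ => ?_
  rw [eLpNorm_const_smul]

theorem norm_exp_ofReal_mul_I_sub_le (a b : ℝ) :
    ‖Complex.exp (a * Complex.I) - Complex.exp (b * Complex.I)‖ ≤ |a - b| := by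
  have h : Complex.exp (a * Complex.I) - Complex.exp (b * Complex.I)
      = Complex.exp (b * Complex.I) * (Complex.exp (Complex.I * ((a - b : ℝ) : ℂ)) - 1) := by
    rw [mul_sub, ← Complex.exp_add]; push_cast; ring_nf
  rw [h, norm_mul, Complex.norm_exp_ofReal_mul_I, one_mul]
  exact Real.norm_exp_I_mul_ofReal_sub_one_le

theorem tendsto_integral_exp_of_tendsto_eLpNorm [IsProbabilityMeasure P] {f : ℕ → Ω → ℝ}
    {f' : Ω → ℝ} (hf : ∀ n, MemLp (f n) 2 P) (hf' : MemLp f' 2 P)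
    (hfl : Tendsto (fun n => eLpNorm (f n - f') 2 P) atTop (𝓝 0)) :
    Tendsto (fun n => ∫ ω, Complex.exp (f n ω * Complex.I) ∂P) atTop
      (𝓝 (∫ ω, Complex.exp (f' ω * Complex.I) ∂P)) := by
  have hint : ∀ {g : Ω → ℝ}, MemLp g 2 P →
      Integrable (fun ω => Complex.exp (g ω * Complex.I)) P := by
    intro g hg
    refine Integrable.of_bound (C := 1) ?_ (ae_of_all _ fun ω => ?_)
    · have : Measurable fun r : ℝ => Complex.exp (r * Complex.I) := by fun_prop
      exact (this.comp_aemeasurable hg.1.aemeasurable).aestronglyMeasurable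
    · rw [Complex.norm_exp_ofReal_mul_I]
  have h1 : Tendsto (fun n => eLpNorm (f n - f') 1 P) atTop (𝓝 0) :=
    tendsto_of_tendsto_of_tendsto_of_le_of_le tendsto_const_nhds hfl (fun _ => bot_le)
      fun n => eLpNorm_le_eLpNorm_of_exponent_le (by norm_num) ((hf n).1.sub hf'.1)
  refine tendsto_integral_of_L1' _ (hint hf').1 (Eventually.of_forall fun n => hint (hf n)) ?_
  refine tendsto_of_tendsto_of_tendsto_of_le_of_le tendsto_const_nhds h1 (fun _ => bot_le)
    fun n => eLpNorm_mono_real (g := fun ω => ‖(f n - f') ω‖) (fun ω => ?_) |>.trans ?_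
  · simpa using norm_exp_ofReal_mul_I_sub_le (f n ω) (f' ω)
  · rw [eLpNorm_norm]

/-- `L²`-limits of Gaussian vectors are Gaussian. -/
theorem hasGaussianLaw_of_tendsto_eLpNorm [IsProbabilityMeasure P] {ι : Type*} [Fintype ι]
    {f : ℕ → ι → Ω → ℝ} {f' : ι → Ω → ℝ} (hf : ∀ n, HasGaussianLaw (fun ω i => f n i ω) P)
    (hf' : ∀ i, AEMeasurable (f' i) P)
    (hfl : ∀ i, Tendsto (fun n => eLpNorm (f n i - f' i) 2 P) atTop (𝓝 0)) :
    HasGaussianLaw (fun ω i => f' i ω) P := by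
  have hm : ∀ n i, MemLp (f n i) 2 P := fun n i => ((hf n).eval i).memLp_two
  have hm' : ∀ i, MemLp (f' i) 2 P := fun i =>
    memLp_of_tendsto_eLpNorm (fun n => hm n i) (hf' i).aestronglyMeasurable (hfl i)
  refine (hasGaussianLaw_iff_charFunDual_map_eq (aemeasurable_pi_lambda _ hf')).2 fun L => ?_
  classical
  set c : ι → ℝ := fun i => L (Pi.single i 1) with hc
  have hL : ∀ v : ι → ℝ, L v = ∑ i, c i * v i := by
    intro v
    conv_lhs => rw [← Finset.univ_sum_single v]
    rw [map_sum]
    refine Finset.sum_congr rfl fun i _ => ?_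
    have : (Pi.single i (v i) : ι → ℝ) = v i • Pi.single i 1 := by
      rw [← Pi.single_smul]; simp
    rw [this, map_smul, smul_eq_mul, mul_comm]
  set S : ℕ → Ω → ℝ := fun n ω => ∑ i, c i * f n i ω with hS
  set S' : Ω → ℝ := fun ω => ∑ i, c i * f' i ω with hS'
  have hSm : ∀ n, MemLp (S n) 2 P := fun n => by
    have := memLp_finsetSum Finset.univ fun i (_ : i ∈ Finset.univ) => (hm n i).const_mul (c i)
    exact this
  have hSm' : MemLp S' 2 P := by
    have := memLp_finsetSum Finset.univ fun i (_ : i ∈ Finset.univ) => (hm' i).const_mul (c i)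
    exact this
  have hlim : Tendsto (fun n => eLpNorm (S n - S') 2 P) atTop (𝓝 0) :=
    tendsto_eLpNorm_sum c (fun n i => (hm n i).1) (fun i => (hm' i).1) hfl
  have h1 := tendsto_integral_exp_of_tendsto_eLpNorm hSm hSm' hlim
  have hone : MemLp (fun _ : Ω => (1 : ℝ)) 2 P := memLp_const 1
  have h2 : Tendsto (fun n => ∫ ω, S n ω ∂P) atTop (𝓝 (∫ ω, S' ω ∂P)) := by
    have := tendsto_integral_mul_of_tendsto_eLpNorm hSm (fun _ => hone) hSm' hone hlim (by simp)
    simpa using this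
  have h3 : Tendsto (fun n => Var[S n; P]) atTop (𝓝 (Var[S'; P])) := by
    have := tendsto_integral_mul_of_tendsto_eLpNorm hSm hSm hSm' hSm' hlim hlim
    simp only [variance_eq_sub (hSm _), variance_eq_sub hSm']
    refine Tendsto.sub ?_ (h2.pow 2)
    simpa [pow_two] using this
  have hchar : ∀ g : ι → Ω → ℝ, (∀ i, AEMeasurable (g i) P) →
      charFunDual (P.map fun ω i => g i ω) L
        = ∫ ω, Complex.exp ((∑ i, c i * g i ω : ℝ) * Complex.I) ∂P := by
    intro g hg
    rw [charFunDual_apply, integral_map (aemeasurable_pi_lambda _ hg) (by fun_prop)]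
    simp only [hL]
  have hn : ∀ n, ∫ ω, Complex.exp (S n ω * Complex.I) ∂P
      = Complex.exp ((∫ ω, S n ω ∂P : ℝ) * Complex.I - Var[S n; P] / 2) := by
    intro n
    have := (hf n).charFunDual_map_eq_fun L
    rw [hchar _ fun i => (hm n i).1.aemeasurable] at this
    simp only [hL] at this
    exact this
  rw [hchar _ hf', Function.comp_def]
  simp only [hL]
  -- The characteristic functions converge, and so do the means and variances in exp(i·mean -
  -- variance/2), so the Gaussian formula survives in the limit.
  refine tendsto_nhds_unique h1 ?_
  simp only [hn]
  refine (Complex.continuous_exp.tendsto _).comp (Tendsto.sub (Tendsto.mul_const _ ?_) ?_)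
  · exact (Complex.continuous_ofReal.tendsto _).comp h2
  · exact ((Complex.continuous_ofReal.tendsto _).comp h3).div_const 2

end L2Limits

/-! ### Conditional variance of Gaussian vectors -/

section ConditionalVariance

variable {Ω : Type*} {mΩ : MeasurableSpace Ω} {P : Measure Ω}

/-- Orthogonal projection in L² onto the finite-dimensional span of the Y i. The coefficients need
not be unique, since the Y i may be linearly dependent. -/
theorem exists_linear_projection {ι : Type*} [Fintype ι] {X : Ω → ℝ} {Y : ι → Ω → ℝ}
    (hX : MemLp X 2 P) (hY : ∀ i, MemLp (Y i) 2 P) :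
    ∃ a : ι → ℝ, ∀ i, ∫ ω, (X ω - ∑ k, a k * Y k ω) * Y i ω ∂P = 0 := by
  let e : ι → Lp ℝ 2 P := fun i => (hY i).toLp (Y i)
  let K : Submodule ℝ (Lp ℝ 2 P) := Submodule.span ℝ (Set.range e)
  have : FiniteDimensional ℝ K := FiniteDimensional.span_of_finite ℝ (Set.finite_range e)
  obtain ⟨a, ha⟩ := (Submodule.mem_span_range_iff_exists_fun ℝ).1
    (K.starProjection_apply_mem (hX.toLp X))
  refine ⟨a, fun i => ?_⟩
  have h := (Submodule.mem_orthogonal' K _).1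
    (K.sub_starProjection_mem_orthogonal (hX.toLp X)) (e i)
    (Submodule.subset_span ⟨i, rfl⟩)
  rw [← ha, L2.inner_def] at h
  rw [← h]
  refine integral_congr_ae ?_
  have h2 : ∀ᵐ ω ∂P, ∀ k, (e k : Ω → ℝ) ω = Y k ω := ae_all_iff.2 fun k => (hY k).coeFn_toLp
  have h3 : (((hX.toLp X - ∑ k, a k • e k : Lp ℝ 2 P)) : Ω → ℝ)
      =ᵐ[P] fun ω => X ω - ∑ k, a k * Y k ω := by
    have hsum : (∑ k, a k • e k : Lp ℝ 2 P)
        = (memLp_finsetSum Finset.univ fun k (_ : k ∈ Finset.univ) =>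
            (hY k).const_mul (a k)).toLp := by
      rw [← sub_eq_zero]
      refine Lp.ext ?_
      filter_upwards [Lp.coeFn_sub (∑ k, a k • e k) (memLp_finsetSum Finset.univ
          fun k (_ : k ∈ Finset.univ) => (hY k).const_mul (a k)).toLp,
        (memLp_finsetSum Finset.univ fun k (_ : k ∈ Finset.univ) =>
            (hY k).const_mul (a k)).coeFn_toLp,
        Lp.coeFn_finsetSum Finset.univ (fun k => a k • e k), h2, Lp.coeFn_zero ℝ 2 P,
        ae_all_iff.2 fun k => Lp.coeFn_smul (a k) (e k)] with ω h4 h5 h6 h7 h8 h9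
      rw [h4, Pi.sub_apply, h5, h6, h8]
      simp only [Finset.sum_apply, h9, Pi.smul_apply, h7, smul_eq_mul, sub_self, Pi.zero_apply]
    rw [hsum]
    filter_upwards [Lp.coeFn_sub (hX.toLp X) (memLp_finsetSum Finset.univ
          fun k (_ : k ∈ Finset.univ) => (hY k).const_mul (a k)).toLp,
        (memLp_finsetSum Finset.univ fun k (_ : k ∈ Finset.univ) =>
            (hY k).const_mul (a k)).coeFn_toLp, hX.coeFn_toLp] with ω h4 h5 h6
    rw [h4, Pi.sub_apply, h5, h6]
  filter_upwards [h2, h3] with ω h4 h5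
  rw [h5, h4]; simp [mul_comm]

/-- For jointly Gaussian centered variables the conditional variance is a.s. the squared
`L²`-distance to the linear span of the conditioning variables. -/
theorem exists_condVar_eq_of_hasGaussianLaw [IsProbabilityMeasure P] {ι : Type*} [Fintype ι]
    {X : Ω → ℝ} {Y : ι → Ω → ℝ} (hX : Measurable X) (hY : ∀ i, Measurable (Y i))
    (hG : HasGaussianLaw (fun ω => (X ω, fun i => Y i ω)) P)
    (hX0 : ∫ ω, X ω ∂P = 0) (hY0 : ∀ i, ∫ ω, Y i ω ∂P = 0) :
    ∃ a : ι → ℝ,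
      condVar (⨆ i, MeasurableSpace.comap (Y i) inferInstance) X P
        =ᵐ[P] (fun _ => ∫ ω, (X ω - ∑ i, a i * Y i ω) ^ 2 ∂P) ∧
      ∀ b : ι → ℝ, ∫ ω, (X ω - ∑ i, a i * Y i ω) ^ 2 ∂P
        ≤ ∫ ω, (X ω - ∑ i, b i * Y i ω) ^ 2 ∂P := by
  have hXm : MemLp X 2 P := hG.fst.memLp_two
  have hYm : ∀ i, MemLp (Y i) 2 P := fun i => (hG.snd.eval i).memLp_two
  obtain ⟨a, ha⟩ := exists_linear_projection hXm hYm
  have hlin : ∀ b : ι → ℝ, MemLp (fun ω => ∑ i, b i * Y i ω) 2 P := fun b => by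
    have := memLp_finsetSum Finset.univ fun k (_ : k ∈ Finset.univ) => (hYm k).const_mul (b k)
    exact this
  set R : Ω → ℝ := fun ω => X ω - ∑ i, a i * Y i ω with hR
  have hRm : MemLp R 2 P := hXm.sub (hlin a)
  have hRmeas : Measurable R := by fun_prop
  have hR0 : ∫ ω, R ω ∂P = 0 := by
    rw [hR, integral_sub (hXm.integrable (by norm_num)) ((hlin a).integrable (by norm_num)), hX0,
      integral_finsetSum _ fun i _ => ((hYm i).integrable (by norm_num)).const_mul _]
    simp [integral_const_mul, hY0]
  set m : MeasurableSpace Ω := ⨆ i, MeasurableSpace.comap (Y i) inferInstance with hm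
  have hmle : m ≤ mΩ := iSup_le fun i => (hY i).comap_le
  have hYm' : ∀ i, Measurable[m] (Y i) := fun i =>
    (Measurable.of_comap_le (le_iSup (fun i => MeasurableSpace.comap (Y i) inferInstance) i))
  refine ⟨a, ?_, fun b => ?_⟩
  -- The residual is uncorrelated with every Y i, hence independent of them by joint Gaussianity.
  -- Its conditional second moment is therefore a constant.
  · have hind : IndepFun R (fun ω i => Y i ω) P := by
      have hRY : HasGaussianLaw
          (fun ω => ((fun _ : Unit => R ω), fun i => Y i ω)) P := by
        let L : (ℝ × (ι → ℝ)) →L[ℝ] ((Unit → ℝ) × (ι → ℝ)) :=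
          (ContinuousLinearMap.pi fun _ : Unit => ContinuousLinearMap.fst ℝ ℝ (ι → ℝ)
              - ∑ i, a i • ((ContinuousLinearMap.proj i).comp
                (ContinuousLinearMap.snd ℝ ℝ (ι → ℝ)))).prod
            (ContinuousLinearMap.snd ℝ ℝ (ι → ℝ))
        have := hG.map_fun L
        convert! this using 1
        ext ω i
        · simp [L, hR]
        · simp [L]
      have := HasGaussianLaw.indepFun_of_covariance_eval (X := fun _ : Unit => R) (Y := Y) hRY
        fun _ j => by
          rw [covariance_eq_sub hRm (hYm j), hR0]
          simpa using ha j
      exact this.comp (φ := fun v : Unit → ℝ => v ()) (measurable_pi_apply ()) measurable_id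
    have hcomap : MeasurableSpace.comap (fun ω i => Y i ω) MeasurableSpace.pi = m := by
      simp only [MeasurableSpace.pi, MeasurableSpace.comap_iSup, MeasurableSpace.comap_comp, hm]
      rfl
    have hindep : Indep (MeasurableSpace.comap R inferInstance) m P := by
      rw [← hcomap]; exact hind
    have hRs : StronglyMeasurable[MeasurableSpace.comap R inferInstance] R :=
      (comap_measurable R).stronglyMeasurable
    have c1 : P[R | m] =ᵐ[P] fun _ => 0 := by
      have := condExp_indep_eq hRmeas.comap_le hmle hRs hindep
      simpa [hR0] using this
    have c2 : P[fun ω => R ω ^ 2 | m] =ᵐ[P] fun _ => ∫ ω, R ω ^ 2 ∂P :=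
      condExp_indep_eq hRmeas.comap_le hmle (hRs.pow 2) hindep
    have c3 : P[fun ω => ∑ i, a i * Y i ω | m] = fun ω => ∑ i, a i * Y i ω := by
      refine condExp_of_stronglyMeasurable hmle ?_ ((hlin a).integrable (by norm_num))
      have : Measurable[m] fun ω => ∑ i, a i * Y i ω :=
        Finset.measurable_fun_sum _ fun i _ => (hYm' i).const_mul _
      exact this.stronglyMeasurable
    have c4 : P[X | m] =ᵐ[P] fun ω => ∑ i, a i * Y i ω := by
      have e : X = R + fun ω => ∑ i, a i * Y i ω := by ext ω; simp [hR]
      have h5 := condExp_add (hRm.integrable (by norm_num)) ((hlin a).integrable (by norm_num)) m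
        (μ := P)
      rw [← e] at h5
      filter_upwards [h5, c1] with ω h6 h7
      rw [h6, Pi.add_apply, h7, c3, zero_add]
    refine (condExp_congr_ae ?_).trans c2
    filter_upwards [c4] with ω h
    simp [h, hR]
  -- Pythagoras: the cross term vanishes because R is orthogonal to the span.
  · set D : Ω → ℝ := fun ω => ∑ i, (a i - b i) * Y i ω with hD
    have hDm : MemLp D 2 P := hlin fun i => a i - b i
    have e : ∀ ω, (X ω - ∑ i, b i * Y i ω) ^ 2 = R ω ^ 2 + (2 * (R ω * D ω) + D ω ^ 2) := by
      intro ω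
      have : X ω - ∑ i, b i * Y i ω = R ω + D ω := by
        simp only [hR, hD, sub_mul, Finset.sum_sub_distrib]; ring
      rw [this]; ring
    have hRDi : ∀ {Z : Ω → ℝ}, MemLp Z 2 P → Integrable (fun ω => R ω * Z ω) P :=
      fun hZ => hRm.integrable_mul hZ
    have hRD : ∫ ω, R ω * D ω ∂P = 0 := by
      have : ∀ ω, R ω * D ω = ∑ i, (a i - b i) * (R ω * Y i ω) := by
        intro ω; simp only [hD, Finset.mul_sum]; exact Finset.sum_congr rfl fun i _ => by ring
      simp only [this]
      rw [integral_finsetSum _ fun i _ => (hRDi (hYm i)).const_mul _]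
      exact Finset.sum_eq_zero fun i _ => by rw [integral_const_mul, ha i, mul_zero]
    simp only [e]
    have hi : Integrable (fun ω => 2 * (R ω * D ω) + D ω ^ 2) P :=
      ((hRDi hDm).const_mul 2).add hDm.integrable_sq
    rw [integral_add hRm.integrable_sq hi,
      integral_add ((hRDi hDm).const_mul 2) hDm.integrable_sq, integral_const_mul, hRD]
    have : 0 ≤ ∫ ω, D ω ^ 2 ∂P := integral_nonneg fun ω => sq_nonneg _
    linarith

end ConditionalVariance

/-! ### Radial power integrals -/

section Radial

variable {E : Type*} [NormedAddCommGroup E] [NormedSpace ℝ E] [FiniteDimensional ℝ E]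
  [MeasurableSpace E] [BorelSpace E] (ν : Measure E) [ν.IsAddHaarMeasure]

theorem lintegral_comp_smul_addHaar (f : E → ℝ≥0∞) {a : ℝ} (ha : a ≠ 0) :
    ∫⁻ x, f (a • x) ∂ν = ENNReal.ofReal |(a ^ Module.finrank ℝ E)⁻¹| * ∫⁻ x, f x ∂ν := by
  have h := lintegral_map_equiv (μ := ν) f (MeasurableEquiv.smul (Units.mk0 a ha))
  have e : (⇑(MeasurableEquiv.smul (Units.mk0 a ha)) : E → E) = (a • ·) := rfl
  rw [e, Measure.map_addHaar_smul ν ha, lintegral_smul_measure] at h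
  simpa using h.symm

theorem integrableOn_norm_rpow_ball (hd : 1 ≤ Module.finrank ℝ E) {p : ℝ}
    (hp : -(Module.finrank ℝ E : ℝ) < p) (r : ℝ) :
    IntegrableOn (fun x : E => ‖x‖ ^ p) (Metric.ball 0 r) ν := by
  refine integrableOn_ball_of_norm_le_rpow hd (C := 1) (α := -p) (by linarith) ?_ ?_
  · refine ae_of_all _ fun x => ?_
    rw [Real.norm_of_nonneg (by positivity), neg_neg, one_mul]
  · exact (by fun_prop : Measurable fun x : E => ‖x‖ ^ p).aestronglyMeasurable

theorem integrableOn_norm_rpow_compl_ball (hd : 1 ≤ Module.finrank ℝ E) {q : ℝ}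
    (hq : q < -(Module.finrank ℝ E : ℝ)) :
    IntegrableOn (fun x : E => ‖x‖ ^ q) (Metric.ball 0 1)ᶜ ν := by
  have : Nontrivial E := Module.nontrivial_of_finrank_pos (R := ℝ) hd
  rw [← integrable_indicator_iff measurableSet_ball.compl]
  have e : ((Metric.ball (0 : E) 1)ᶜ.indicator fun x : E => ‖x‖ ^ q)
      = fun x => (Set.Ici (1 : ℝ)).indicator (fun y => y ^ q) ‖x‖ := by
    ext x
    by_cases h : 1 ≤ ‖x‖ <;> simp [Set.indicator, h]
  rw [e, integrable_fun_norm_addHaar]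
  have h1 : IntegrableOn (fun y : ℝ => y ^ ((Module.finrank ℝ E : ℝ) - 1 + q)) (Set.Ici 1) := by
    rw [integrableOn_Ici_iff_integrableOn_Ioi]
    exact integrableOn_Ioi_rpow_of_lt (by linarith) one_pos
  rw [← integrable_indicator_iff measurableSet_Ici] at h1
  refine h1.integrableOn.congr_fun (fun y hy => ?_) measurableSet_Ioi
  by_cases h : 1 ≤ y
  · have : (0 : ℝ) < y := hy
    simp only [Set.indicator, Set.mem_Ici, h, if_true, smul_eq_mul]
    rw [Real.rpow_add this, ← Real.rpow_natCast, Nat.cast_sub hd, Nat.cast_one]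
  · simp [h]

/-- The common finiteness test: a power integrable at the origin controls the unit ball, a power
integrable at infinity controls its complement. The point 0 is exempt because `0 ^ p` has no useful
value for negative p. -/
theorem lintegral_lt_top_of_le_norm_rpow (hd : 1 ≤ Module.finrank ℝ E) {f : E → ℝ≥0∞}
    {p q C : ℝ} (hp : -(Module.finrank ℝ E : ℝ) < p) (hq : q < -(Module.finrank ℝ E : ℝ))
    (h0 : ∀ x, x ≠ 0 → ‖x‖ < 1 → f x ≤ ENNReal.ofReal (C * ‖x‖ ^ p))
    (h1 : ∀ x, 1 ≤ ‖x‖ → f x ≤ ENNReal.ofReal (C * ‖x‖ ^ q)) :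
    ∫⁻ x, f x ∂ν < ∞ := by
  have : Nontrivial E := Module.nontrivial_of_finrank_pos (R := ℝ) hd
  have key : ∀ {s : Set E} {r : ℝ}, IntegrableOn (fun x : E => ‖x‖ ^ r) s ν →
      ∫⁻ x in s, ENNReal.ofReal (C * ‖x‖ ^ r) ∂ν < ∞ := by
    intro s r h
    exact (hasFiniteIntegral_iff_norm _).1 (h.const_mul C).2 |>.trans_le' <|
      lintegral_mono fun x => ENNReal.ofReal_le_ofReal (Real.le_norm_self _)
  rw [← lintegral_add_compl f (measurableSet_ball (x := (0 : E)) (ε := 1))]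
  refine ENNReal.add_lt_top.2 ⟨?_, ?_⟩
  · refine (lintegral_mono_ae ?_).trans_lt (key (integrableOn_norm_rpow_ball ν hd hp 1))
    have hne : ∀ᵐ x ∂ν, x ≠ (0 : E) := by simp [ae_iff]
    filter_upwards [ae_restrict_mem measurableSet_ball, ae_restrict_of_ae hne] with x hx hx0
    exact h0 x hx0 (by simpa using hx)
  · refine (lintegral_mono_ae ?_).trans_lt (key (integrableOn_norm_rpow_compl_ball ν hd hq))
    filter_upwards [ae_restrict_mem measurableSet_ball.compl] with x hx
    exact h1 x (by simpa using hx)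

/-- The mass of the scale-invariant density `‖x‖^{-dim}` on the shell `1 ≤ ‖x‖ < R`. -/
theorem exists_lintegral_shell_le (hd : 1 ≤ Module.finrank ℝ E) :
    ∃ C : ℝ, 0 ≤ C ∧ ∀ R : ℝ, 1 ≤ R →
      ∫⁻ x, (if 1 ≤ ‖x‖ ∧ ‖x‖ < R then
        ENNReal.ofReal (‖x‖ ^ (-(Module.finrank ℝ E : ℝ))) else 0) ∂ν
        ≤ ENNReal.ofReal (C * Real.log R) := by
  have : Nontrivial E := Module.nontrivial_of_finrank_pos (R := ℝ) hd
  set n := Module.finrank ℝ E with hn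
  refine ⟨n * ν.real (Metric.ball 0 1), by positivity, fun R hR => ?_⟩
  set g : ℝ → ℝ := (Set.Ico (1 : ℝ) R).indicator fun y => y ^ (-(n : ℝ)) with hg
  have hgi : Set.EqOn (fun y : ℝ => y ^ (n - 1) • g y) ((Set.Ico (1 : ℝ) R).indicator fun y => y⁻¹)
      (Set.Ioi 0) := by
    intro y hy
    have hy0 : (0 : ℝ) < y := hy
    by_cases h : y ∈ Set.Ico 1 R
    · simp only [hg, Set.indicator_of_mem h, smul_eq_mul]
      rw [← Real.rpow_natCast, Nat.cast_sub hd, Nat.cast_one, ← Real.rpow_add hy0,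
        ← Real.rpow_neg_one]
      congr 1; ring
    · simp [hg, Set.indicator_of_notMem h]
  have hsub : Set.Ico 1 R ⊆ Set.Ioi (0 : ℝ) := fun y hy => lt_of_lt_of_le one_pos hy.1
  have hinv : IntegrableOn (fun y : ℝ => y⁻¹) (Set.Ico 1 R) := by
    refine (ContinuousOn.integrableOn_Icc (a := 1) (b := R) ?_).mono_set Set.Ico_subset_Icc_self
    exact continuousOn_inv₀.mono fun y hy => (lt_of_lt_of_le one_pos hy.1).ne'
  have hint : Integrable (fun x => g ‖x‖) ν := by
    rw [integrable_fun_norm_addHaar]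
    refine IntegrableOn.congr_fun ?_ hgi.symm measurableSet_Ioi
    exact ((integrable_indicator_iff measurableSet_Ico).2 hinv).integrableOn
  have hval : ∫ x, g ‖x‖ ∂ν = n * ν.real (Metric.ball 0 1) * Real.log R := by
    rw [integral_fun_norm_addHaar, setIntegral_congr_fun measurableSet_Ioi hgi,
      setIntegral_indicator measurableSet_Ico, Set.inter_eq_self_of_subset_right hsub,
      integral_Ico_eq_integral_Ioc, ← intervalIntegral.integral_of_le hR,
      integral_inv_of_pos one_pos (one_pos.trans_le hR), div_one]
    simp [mul_assoc, ← hn]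
  rw [← hval, ofReal_integral_eq_lintegral_ofReal hint]
  · refine lintegral_mono fun x => ?_
    by_cases h : 1 ≤ ‖x‖ ∧ ‖x‖ < R
    · rw [if_pos h]; simp [hg, h]
    · rw [if_neg h]; exact bot_le
  · exact ae_of_all _ fun x => Set.indicator_nonneg (fun y hy => by
      have : (0 : ℝ) < y := hsub hy
      positivity) _

end Radial

/-! ### Plancherel for the Riesz kernel in time -/

section RieszKernel

/-- On the square the kernel depends only on the difference of the variables, so it is dominated by
the integrand of a convolution of two integrable functions. -/
theorem integrable_abs_sub_rpow_mul_indicator {p : ℝ} (hp : -1 < p) (R : ℝ) :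
    Integrable (fun z : ℝ × ℝ => |z.1 - z.2| ^ p *
      ((Set.Icc (-R) R).indicator (fun _ => (1 : ℝ)) z.1 *
        (Set.Icc (-R) R).indicator (fun _ => (1 : ℝ)) z.2)) (volume.prod volume) := by
  -- The radius is large enough to contain every difference of two points of [-R, R].
  have h1 : Integrable ((Metric.ball (0 : ℝ) (2 * |R| + 1)).indicator fun w : ℝ => |w| ^ p) := by
    rw [integrable_indicator_iff measurableSet_ball]
    simpa using integrableOn_norm_rpow_ball (E := ℝ) volume (by simp) (p := p) (by simpa) _
  have h2 : Integrable ((Set.Icc (-R) R).indicator (fun _ => (1 : ℝ))) := by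
    rw [integrable_indicator_iff measurableSet_Icc]
    exact integrableOn_const (by simp)
  refine (h2.convolution_integrand (ContinuousLinearMap.mul ℝ ℝ) h1).mono' ?_
    (ae_of_all _ fun z => ?_)
  · have : Measurable fun z : ℝ × ℝ => |z.1 - z.2| ^ p *
      ((Set.Icc (-R) R).indicator (fun _ => (1 : ℝ)) z.1 *
        (Set.Icc (-R) R).indicator (fun _ => (1 : ℝ)) z.2) := by
      have hi : Measurable ((Set.Icc (-R) R).indicator (fun _ => (1 : ℝ))) :=
        measurable_const.indicator measurableSet_Icc
      have hs : Measurable fun z : ℝ × ℝ => |z.1 - z.2| ^ p :=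
        (continuous_abs.measurable.comp (measurable_fst.sub measurable_snd)).pow_const p
      exact hs.mul ((hi.comp measurable_fst).mul (hi.comp measurable_snd))
    exact this.aestronglyMeasurable
  · have hn : 0 ≤ |z.1 - z.2| ^ p := by positivity
    by_cases a : z.1 ∈ Set.Icc (-R) R
    · by_cases b : z.2 ∈ Set.Icc (-R) R
      · have hb : z.1 - z.2 ∈ Metric.ball (0 : ℝ) (2 * |R| + 1) := by
          rw [mem_ball_zero_iff, Real.norm_eq_abs, abs_lt]
          have := le_abs_self R
          constructor <;> linarith [a.1, a.2, b.1, b.2]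
        simp only [Set.indicator_of_mem a, Set.indicator_of_mem b, Set.indicator_of_mem hb,
          ContinuousLinearMap.mul_apply', mul_one, one_mul, Real.norm_of_nonneg hn, le_refl]
      · simp [Set.indicator_of_notMem b]
    · have h0 : 0 ≤ (Set.Icc (-R) R).indicator (fun _ => (1 : ℝ)) z.2 :=
        Set.indicator_nonneg (fun _ _ => zero_le_one) _
      have h3 : 0 ≤ (Metric.ball (0 : ℝ) (2 * |R| + 1)).indicator (fun w : ℝ => |w| ^ p)
          (z.1 - z.2) := Set.indicator_nonneg (fun _ _ => by positivity) _
      simp only [Set.indicator_of_notMem a, zero_mul, mul_zero, norm_zero,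
        ContinuousLinearMap.mul_apply']
      positivity

/-- A Bochner integral that does not converge is 0 by convention, whereas the Gamma formula gives a
positive value. -/
theorem integral_Ioi_rpow_neg_mul_exp_neg_mul {a r : ℝ} (ha : 0 < a) (hr : 0 < r) :
    IntegrableOn (fun x : ℝ => x ^ (a - 1) * Real.exp (-(r * x))) (Set.Ioi 0) := by
  by_contra h
  have h1 := Real.integral_rpow_mul_exp_neg_mul_Ioi ha hr
  rw [integral_undef h] at h1
  have : 0 < (1 / r) ^ a * Real.Gamma a := mul_pos (by positivity) (Real.Gamma_pos_of_pos ha)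
  linarith

/-- The substitution y = 1/x turns this into a Gamma integral with parameter H - 1/2. It is the
weight in τ left when the Gaussian mixture is integrated on the frequency side. -/
theorem lintegral_rpow_mul_exp_neg_div {H : ℝ} (hH : 1 / 2 < H) {τ : ℝ} (hτ : τ ≠ 0) :
    ∫⁻ x in Set.Ioi (0 : ℝ), ENNReal.ofReal (x ^ (-H - 1 / 2) * Real.exp (-(τ ^ 2 / (4 * x))))
      = ENNReal.ofReal (4 ^ (H - 1 / 2) * Real.Gamma (H - 1 / 2) * |τ| ^ (1 - 2 * H)) := by
  set g : ℝ → ℝ := fun y => y ^ (H - 1 / 2 - 1) * Real.exp (-(τ ^ 2 / 4 * y)) with hg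
  have hr : 0 < τ ^ 2 / 4 := by positivity
  have hgi : IntegrableOn g (Set.Ioi 0) :=
    integral_Ioi_rpow_neg_mul_exp_neg_mul (by linarith) hr
  have hE : Set.EqOn (fun x : ℝ => (|(-1 : ℝ)| * x ^ ((-1 : ℝ) - 1)) • g (x ^ (-1 : ℝ)))
      (fun x => x ^ (-H - 1 / 2) * Real.exp (-(τ ^ 2 / (4 * x)))) (Set.Ioi 0) := by
    intro x hx
    have hx0 : (0 : ℝ) < x := hx
    simp only [hg, smul_eq_mul, abs_neg, abs_one, one_mul]
    rw [← Real.rpow_mul hx0.le, ← mul_assoc, ← Real.rpow_add hx0, Real.rpow_neg_one]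
    congr 2
    · ring
    · field_simp
  have hi := (integrableOn_Ioi_comp_rpow_iff g (p := -1) (by norm_num)).2 hgi
  have hI := integral_comp_rpow_Ioi g (p := -1) (by norm_num)
  rw [setIntegral_congr_fun measurableSet_Ioi hE,
    Real.integral_rpow_mul_exp_neg_mul_Ioi (by linarith) hr] at hI
  rw [← ofReal_integral_eq_lintegral_ofReal (hi.congr_fun hE measurableSet_Ioi), hI]
  · congr 1
    have hτ' : 0 < |τ| := abs_pos.2 hτ
    have : (1 / (τ ^ 2 / 4)) = 4 * |τ| ^ (-2 : ℝ) := by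
      rw [Real.rpow_neg hτ'.le, ← sq_abs]
      norm_num [div_eq_mul_inv]
    rw [this, Real.mul_rpow (by norm_num) (by positivity), ← Real.rpow_mul hτ'.le]
    rw [show (-2 : ℝ) * (H - 1 / 2) = 1 - 2 * H by ring]
    ring
  · filter_upwards [ae_restrict_mem measurableSet_Ioi] with x hx
    have : (0 : ℝ) < x := hx
    positivity

/-- The Riesz kernel is a mixture of Gaussians. This reduces its Plancherel identity to the Gaussian
one and shows that the quadratic form is nonnegative. -/
theorem abs_rpow_eq_integral {H : ℝ} (hH : H < 1) {w : ℝ} (hw : w ≠ 0) :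
    |w| ^ (2 * H - 2) = (Real.Gamma (1 - H))⁻¹ *
      ∫ x in Set.Ioi (0 : ℝ), x ^ (-H) * Real.exp (-(w ^ 2 * x)) := by
  have hw' : 0 < |w| := abs_pos.2 hw
  have h := Real.integral_rpow_mul_exp_neg_mul_Ioi (a := 1 - H) (r := w ^ 2) (by linarith)
    (by positivity)
  rw [show 1 - H - 1 = -H by ring] at h
  rw [h]
  have hG : Real.Gamma (1 - H) ≠ 0 := (Real.Gamma_pos_of_pos (by linarith)).ne'
  have : 1 / w ^ 2 = |w| ^ (-2 : ℝ) := by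
    rw [Real.rpow_neg hw'.le, ← sq_abs]; norm_num
  rw [this, ← Real.rpow_mul hw'.le]
  field_simp
  congr 1; ring

theorem integral_exp_mul_gaussian {x : ℝ} (hx : 0 < x) (w : ℝ) :
    ∫ τ : ℝ, Complex.exp (-Complex.I * (τ * w : ℝ)) * (Real.exp (-(τ ^ 2 / (4 * x))) : ℂ)
      = ((4 * Real.pi * x) ^ (1 / 2 : ℝ) * Real.exp (-(w ^ 2 * x)) : ℝ) := by
  have hb : 0 < ((1 / (4 * x) : ℝ) : ℂ).re := by rw [Complex.ofReal_re]; positivity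
  have h := fourierIntegral_gaussian hb (-w)
  have e : ∀ τ : ℝ, Complex.exp (-Complex.I * (τ * w : ℝ)) * (Real.exp (-(τ ^ 2 / (4 * x))) : ℂ)
      = Complex.exp (Complex.I * (-w) * τ) * Complex.exp (-((1 / (4 * x) : ℝ) : ℂ) * τ ^ 2) := by
    intro τ
    push_cast
    congr 2 <;> ring
  simp only [e]
  rw [h]
  push_cast
  congr 1
  · rw [Complex.ofReal_cpow (by positivity)]
    push_cast
    congr 1
    field_simp
  · congr 1
    have : (x : ℂ) ≠ 0 := by exact_mod_cast hx.ne'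
    field_simp

/-- Fourier transform in time. -/
noncomputable def timeFT (f : ℝ → ℂ) (τ : ℝ) : ℂ :=
  ∫ u : ℝ, Complex.exp (-Complex.I * (τ * u : ℝ)) * f u

theorem norm_exp_neg_I_mul (r : ℝ) : ‖Complex.exp (-Complex.I * (r : ℂ))‖ = 1 := by
  have : -Complex.I * (r : ℂ) = ((-r : ℝ) : ℂ) * Complex.I := by push_cast; ring
  rw [this, Complex.norm_exp_ofReal_mul_I]

theorem measurable_timeFT {f : ℝ → ℂ} (hf : Measurable f) : Measurable (timeFT f) := by
  have : Measurable fun p : ℝ × ℝ => Complex.exp (-Complex.I * (p.1 * p.2 : ℝ)) * f p.2 := by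
    fun_prop
  exact this.stronglyMeasurable.integral_prod_right'.measurable

variable {f : ℝ → ℂ}

/-- The Gaussian in u - v is itself a Fourier integral of a Gaussian in τ. After Fubini the
exponential splits between u and v, and the double integral becomes a squared modulus. -/
theorem integral_gaussian_mul_conj (hf : Integrable f) {x : ℝ} (hx : 0 < x) :
    ∫ z : ℝ × ℝ, (Real.exp (-((z.1 - z.2) ^ 2 * x)) : ℂ) * (f z.1 * (starRingEnd ℂ) (f z.2))
      = (((4 * Real.pi * x) ^ (-(1 / 2) : ℝ) *
        ∫ τ : ℝ, Real.exp (-(τ ^ 2 / (4 * x))) * ‖timeFT f τ‖ ^ 2 : ℝ) : ℂ) := by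
  set A : ℝ := (4 * Real.pi * x) ^ (-(1 / 2) : ℝ) with hA
  have hA' : A * (4 * Real.pi * x) ^ (1 / 2 : ℝ) = 1 := by
    rw [hA, ← Real.rpow_add (by positivity)]; norm_num
  have hconj : Integrable fun u => (starRingEnd ℂ) (f u) :=
    (Complex.conjLIE.toContinuousLinearEquiv.integrable_comp_iff (φ := f)).2 hf
  have hff : Integrable (fun z : ℝ × ℝ => f z.1 * (starRingEnd ℂ) (f z.2))
      (volume.prod volume) := hf.mul_prod hconj
  have hgauss : Integrable fun τ : ℝ => (Real.exp (-(τ ^ 2 / (4 * x))) : ℂ) := by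
    have := (integrable_exp_neg_mul_sq (b := 1 / (4 * x)) (by positivity)).ofReal (𝕜 := ℂ)
    refine this.congr (ae_of_all _ fun τ => ?_)
    simp only [Complex.coe_algebraMap]
    congr 2; ring
  have hF : Integrable (Function.uncurry fun (z : ℝ × ℝ) (τ : ℝ) =>
      (Complex.exp (-Complex.I * (τ * (z.1 - z.2) : ℝ)) *
        (Real.exp (-(τ ^ 2 / (4 * x))) : ℂ)) * (f z.1 * (starRingEnd ℂ) (f z.2)))
      ((volume.prod volume).prod volume) := by
    refine (hff.mul_prod hgauss).mono ?_ (ae_of_all _ fun p => ?_)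
    · have h1 := hff.1.comp_fst (ν := (volume : Measure ℝ))
      have h2 : Continuous fun p : (ℝ × ℝ) × ℝ =>
          Complex.exp (-Complex.I * (p.2 * (p.1.1 - p.1.2) : ℝ)) *
            (Real.exp (-(p.2 ^ 2 / (4 * x))) : ℂ) := by fun_prop
      exact h2.aestronglyMeasurable.mul h1
    · simp only [Function.uncurry, norm_mul, norm_exp_neg_I_mul, one_mul]
      rw [mul_comm]
  calc ∫ z : ℝ × ℝ, (Real.exp (-((z.1 - z.2) ^ 2 * x)) : ℂ) * (f z.1 * (starRingEnd ℂ) (f z.2))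
      = ∫ z : ℝ × ℝ, (A : ℂ) * ∫ τ : ℝ, (Complex.exp (-Complex.I * (τ * (z.1 - z.2) : ℝ)) *
        (Real.exp (-(τ ^ 2 / (4 * x))) : ℂ)) * (f z.1 * (starRingEnd ℂ) (f z.2)) := by
        refine integral_congr_ae (ae_of_all _ fun z => ?_)
        simp only
        have h : (A : ℂ) * (((4 * Real.pi * x) ^ (1 / 2 : ℝ) *
            Real.exp (-((z.1 - z.2) ^ 2 * x)) : ℝ) : ℂ)
            = (Real.exp (-((z.1 - z.2) ^ 2 * x)) : ℂ) := by
          rw [← Complex.ofReal_mul, ← mul_assoc, hA', one_mul]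
        rw [integral_mul_const, integral_exp_mul_gaussian hx, ← mul_assoc (A : ℂ), h]
    _ = (A : ℂ) * ∫ τ : ℝ, ∫ z : ℝ × ℝ, (Complex.exp (-Complex.I * (τ * (z.1 - z.2) : ℝ)) *
        (Real.exp (-(τ ^ 2 / (4 * x))) : ℂ)) * (f z.1 * (starRingEnd ℂ) (f z.2)) := by
        rw [integral_const_mul]
        congr 1
        exact integral_integral_swap hF
    _ = (A : ℂ) * ∫ τ : ℝ, ((Real.exp (-(τ ^ 2 / (4 * x))) * ‖timeFT f τ‖ ^ 2 : ℝ) : ℂ) := by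
        congr 1
        refine integral_congr_ae (ae_of_all _ fun τ => ?_)
        have e : ∀ z : ℝ × ℝ, (Complex.exp (-Complex.I * (τ * (z.1 - z.2) : ℝ)) *
            (Real.exp (-(τ ^ 2 / (4 * x))) : ℂ)) * (f z.1 * (starRingEnd ℂ) (f z.2))
            = (Real.exp (-(τ ^ 2 / (4 * x))) : ℂ) *
              ((Complex.exp (-Complex.I * (τ * z.1 : ℝ)) * f z.1) *
                (starRingEnd ℂ) (Complex.exp (-Complex.I * (τ * z.2 : ℝ)) * f z.2)) := by
          intro z
          have : Complex.exp (-Complex.I * (τ * (z.1 - z.2) : ℝ))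
              = Complex.exp (-Complex.I * (τ * z.1 : ℝ)) *
                (starRingEnd ℂ) (Complex.exp (-Complex.I * (τ * z.2 : ℝ))) := by
            rw [← Complex.exp_conj, ← Complex.exp_add]
            congr 1
            simp only [map_mul, map_neg, Complex.conj_I, Complex.conj_ofReal]
            push_cast; ring
          rw [this, map_mul]; ring
        simp only [e]
        rw [integral_const_mul, Measure.volume_eq_prod,
          integral_prod_mul (fun u => Complex.exp (-Complex.I * (τ * u : ℝ)) * f u)
            (fun u => (starRingEnd ℂ) (Complex.exp (-Complex.I * (τ * u : ℝ)) * f u)),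
          integral_conj]
        have : (∫ u : ℝ, Complex.exp (-Complex.I * (τ * u : ℝ)) * f u) = timeFT f τ := rfl
        rw [this, Complex.mul_conj, Complex.normSq_eq_norm_sq]
        push_cast; ring
    _ = _ := by rw [integral_complex_ofReal]; push_cast; rfl

/-- The constant relating the Riesz kernel `|u|^{2H-2}` to its Fourier transform
`|τ|^{1-2H}`. -/
noncomputable def rieszConst (H : ℝ) : ℝ :=
  (Real.Gamma (1 - H))⁻¹ * ((4 * Real.pi) ^ (-(1 / 2) : ℝ) *
    (4 ^ (H - 1 / 2) * Real.Gamma (H - 1 / 2)))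

theorem rieszConst_pos {H : ℝ} (hH : 1 / 2 < H) (hH' : H < 1) : 0 < rieszConst H := by
  have h1 := Real.Gamma_pos_of_pos (show 0 < 1 - H by linarith)
  have h2 := Real.Gamma_pos_of_pos (show 0 < H - 1 / 2 by linarith)
  unfold rieszConst
  positivity

/-- Plancherel for the Riesz kernel `|u - v|^{2H-2}`. -/
theorem integral_riesz_mul_conj {H : ℝ} (hH : 1 / 2 < H) (hH' : H < 1) (hfm : Measurable f)
    {M R : ℝ} (hM : ∀ u, ‖f u‖ ≤ M * (Set.Icc (-R) R).indicator (fun _ => (1 : ℝ)) u) :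
    (∫⁻ τ : ℝ, ENNReal.ofReal (|τ| ^ (1 - 2 * H) * ‖timeFT f τ‖ ^ 2)) ≠ ∞ ∧
    ∫ z : ℝ × ℝ, ((|z.1 - z.2| ^ (2 * H - 2) : ℝ) : ℂ) * (f z.1 * (starRingEnd ℂ) (f z.2))
      = ((rieszConst H *
        (∫⁻ τ : ℝ, ENNReal.ofReal (|τ| ^ (1 - 2 * H) * ‖timeFT f τ‖ ^ 2)).toReal : ℝ) : ℂ) := by
  have hG := Real.Gamma_pos_of_pos (show 0 < 1 - H by linarith)
  have hG2 := Real.Gamma_pos_of_pos (show 0 < H - 1 / 2 by linarith)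
  set I : ℝ → ℝ := (Set.Icc (-R) R).indicator (fun _ => (1 : ℝ)) with hI
  have hII : Integrable I := by
    rw [hI, integrable_indicator_iff measurableSet_Icc]
    exact integrableOn_const (by simp)
  have hf : Integrable f := (hII.const_mul M).mono' hfm.aestronglyMeasurable (ae_of_all _ hM)
  have hff : Integrable (fun z : ℝ × ℝ =>
      |z.1 - z.2| ^ (2 * H - 2) * ‖f z.1 * (starRingEnd ℂ) (f z.2)‖) (volume.prod volume) := by
    refine ((integrable_abs_sub_rpow_mul_indicator (p := 2 * H - 2) (by linarith) R).const_mul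
      (M * M)).mono' ?_ (ae_of_all _ fun z => ?_)
    · have : Measurable fun z : ℝ × ℝ =>
          |z.1 - z.2| ^ (2 * H - 2) * ‖f z.1 * (starRingEnd ℂ) (f z.2)‖ := by
        have hs : Measurable fun z : ℝ × ℝ => |z.1 - z.2| ^ (2 * H - 2) :=
          (continuous_abs.measurable.comp (measurable_fst.sub measurable_snd)).pow_const _
        have hc : Measurable fun z : ℝ × ℝ => (starRingEnd ℂ) (f z.2) :=
          Complex.continuous_conj.measurable.comp (hfm.comp measurable_snd)
        exact hs.mul ((hfm.comp measurable_fst).mul hc).norm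
      exact this.aestronglyMeasurable
    · rw [Real.norm_of_nonneg (by positivity), norm_mul, RCLike.norm_conj]
      calc |z.1 - z.2| ^ (2 * H - 2) * (‖f z.1‖ * ‖f z.2‖)
          ≤ |z.1 - z.2| ^ (2 * H - 2) * ((M * I z.1) * (M * I z.2)) := by
            gcongr
            · exact (norm_nonneg _).trans (hM _)
            · exact hM _
            · exact hM _
        _ = _ := by ring
  -- The Gamma representation of the kernel needs u ≠ v; the diagonal is a null set.
  have hdiag : ∀ᵐ z : ℝ × ℝ ∂(volume.prod volume), z.1 - z.2 ≠ 0 := by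
    have hms : MeasurableSet {z : ℝ × ℝ | z.1 - z.2 ≠ 0} :=
      (measurableSet_eq_fun (measurable_fst.sub measurable_snd) measurable_const).compl
    refine (Measure.ae_prod_iff_ae_ae hms).2 (ae_of_all _ fun u => ?_)
    have : ∀ᵐ v : ℝ, v ≠ u := by simp [ae_iff]
    filter_upwards [this] with v hv h
    exact hv (sub_eq_zero.1 h).symm
  -- the subordinated kernel
  set Φ : ℝ × ℝ → ℝ → ℂ := fun z x => ((x ^ (-H) * Real.exp (-((z.1 - z.2) ^ 2 * x)) : ℝ) : ℂ) *
      (f z.1 * (starRingEnd ℂ) (f z.2)) with hΦ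
  have hΦm : Measurable (Function.uncurry Φ) := by
    have h1 : Measurable fun p : (ℝ × ℝ) × ℝ =>
        p.2 ^ (-H) * Real.exp (-((p.1.1 - p.1.2) ^ 2 * p.2)) := by fun_prop
    have hc : Measurable fun p : (ℝ × ℝ) × ℝ => (starRingEnd ℂ) (f p.1.2) :=
      Complex.continuous_conj.measurable.comp (hfm.comp (by fun_prop))
    have h2 : Measurable fun p : (ℝ × ℝ) × ℝ => f p.1.1 := hfm.comp (by fun_prop)
    exact (Complex.measurable_ofReal.comp h1).mul (h2.mul hc)
  have hreal : ∀ z : ℝ × ℝ, z.1 - z.2 ≠ 0 → IntegrableOn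
      (fun x : ℝ => x ^ (-H) * Real.exp (-((z.1 - z.2) ^ 2 * x))) (Set.Ioi 0) := by
    intro z hz
    have := integral_Ioi_rpow_neg_mul_exp_neg_mul (a := 1 - H) (r := (z.1 - z.2) ^ 2)
      (by linarith) (by positivity)
    rwa [show 1 - H - 1 = -H by ring] at this
  have hΦi : Integrable (Function.uncurry Φ)
      ((volume.prod volume).prod (volume.restrict (Set.Ioi (0 : ℝ)))) := by
    rw [integrable_prod_iff hΦm.aestronglyMeasurable]
    refine ⟨?_, ?_⟩
    · filter_upwards [hdiag] with z hz
      exact ((hreal z hz).ofReal (𝕜 := ℂ)).mul_const (f z.1 * (starRingEnd ℂ) (f z.2))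
    · refine (hff.const_mul (Real.Gamma (1 - H))).congr ?_
      filter_upwards [hdiag] with z hz
      simp only [Function.uncurry, hΦ, norm_mul (_ : ℂ) (f z.1 * _)]
      rw [integral_mul_const, abs_rpow_eq_integral hH' hz, ← mul_assoc, ← mul_assoc,
        mul_inv_cancel₀ hG.ne', one_mul]
      congr 1
      refine setIntegral_congr_fun measurableSet_Ioi fun x hx => ?_
      have : (0 : ℝ) < x := hx
      rw [Complex.norm_real, Real.norm_of_nonneg (by positivity)]
  set g : ℝ → ℝ := fun x => x ^ (-H) * ((4 * Real.pi * x) ^ (-(1 / 2) : ℝ) *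
        ∫ τ : ℝ, Real.exp (-(τ ^ 2 / (4 * x))) * ‖timeFT f τ‖ ^ 2) with hg
  have hinner : ∀ x ∈ Set.Ioi (0 : ℝ), ∫ z, Φ z x ∂(volume.prod volume) = (g x : ℂ) := by
    intro x hx
    have := integral_gaussian_mul_conj hf hx
    rw [hg, Complex.ofReal_mul, ← this, ← integral_const_mul]
    refine integral_congr_ae (ae_of_all _ fun z => ?_)
    simp only [hΦ]; push_cast; ring
  have hgi : IntegrableOn g (Set.Ioi 0) := by
    have h1 := hΦi.integral_prod_right
    have h2 : Integrable (fun x => (g x : ℂ)) (volume.restrict (Set.Ioi 0)) := by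
      refine h1.congr ?_
      filter_upwards [ae_restrict_mem measurableSet_Ioi] with x hx
      exact hinner x hx
    exact_mod_cast h2.re
  have hg0 : ∀ x ∈ Set.Ioi (0 : ℝ), 0 ≤ g x := by
    intro x hx
    have : (0 : ℝ) < x := hx
    have : 0 ≤ ∫ τ : ℝ, Real.exp (-(τ ^ 2 / (4 * x))) * ‖timeFT f τ‖ ^ 2 :=
      integral_nonneg fun τ => by positivity
    positivity
  have hbd : ∀ τ, ‖timeFT f τ‖ ≤ ∫ u, ‖f u‖ := fun τ => by
    refine (norm_integral_le_integral_norm _).trans (le_of_eq ?_)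
    simp only [norm_mul, norm_exp_neg_I_mul, one_mul]
  have hτm := measurable_timeFT hfm
  -- Tonelli
  have hlin : ENNReal.ofReal (∫ x in Set.Ioi (0 : ℝ), g x)
      = ENNReal.ofReal ((4 * Real.pi) ^ (-(1 / 2) : ℝ) *
          (4 ^ (H - 1 / 2) * Real.Gamma (H - 1 / 2))) *
        ∫⁻ τ : ℝ, ENNReal.ofReal (|τ| ^ (1 - 2 * H) * ‖timeFT f τ‖ ^ 2) := by
    rw [ofReal_integral_eq_lintegral_ofReal hgi
      ((ae_restrict_mem measurableSet_Ioi).mono fun x hx => hg0 x hx)]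
    have h1 : ∀ x ∈ Set.Ioi (0 : ℝ), ENNReal.ofReal (g x) = ∫⁻ τ : ℝ,
        ENNReal.ofReal ((4 * Real.pi) ^ (-(1 / 2) : ℝ) * ‖timeFT f τ‖ ^ 2) *
          ENNReal.ofReal (x ^ (-H - 1 / 2) * Real.exp (-(τ ^ 2 / (4 * x)))) := by
      intro x hx
      have hx0 : (0 : ℝ) < x := hx
      have hi : Integrable fun τ : ℝ => Real.exp (-(τ ^ 2 / (4 * x))) * ‖timeFT f τ‖ ^ 2 := by
        have hga : Integrable fun τ : ℝ => Real.exp (-(τ ^ 2 / (4 * x))) := by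
          have := integrable_exp_neg_mul_sq (b := 1 / (4 * x)) (by positivity)
          refine this.congr (ae_of_all _ fun τ => ?_)
          simp only; congr 1; ring
        refine hga.mul_bdd (c := (∫ u, ‖f u‖) ^ 2) (hτm.norm.pow_const 2).aestronglyMeasurable
          (ae_of_all _ fun τ => ?_)
        rw [Real.norm_of_nonneg (by positivity)]
        gcongr
        exact hbd τ
      have h2 : x ^ (-H) * (4 * Real.pi * x) ^ (-(1 / 2) : ℝ)
          = (4 * Real.pi) ^ (-(1 / 2) : ℝ) * x ^ (-H - 1 / 2) := by
        rw [Real.mul_rpow (by positivity) hx0.le, sub_eq_add_neg, Real.rpow_add hx0]; ring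
      simp only [hg]
      rw [← mul_assoc, h2, ← integral_const_mul, ofReal_integral_eq_lintegral_ofReal
        (hi.const_mul _) (ae_of_all _ fun τ => by positivity)]
      refine lintegral_congr fun τ => ?_
      rw [← ENNReal.ofReal_mul (by positivity)]
      congr 1; ring
    rw [setLIntegral_congr_fun measurableSet_Ioi h1, lintegral_lintegral_swap]
    · rw [← lintegral_const_mul]
      · have hne : ∀ᵐ τ : ℝ, τ ≠ 0 := by simp [ae_iff]
        refine lintegral_congr_ae ?_
        filter_upwards [hne] with τ hτ
        rw [lintegral_const_mul, lintegral_rpow_mul_exp_neg_div hH hτ,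
          ← ENNReal.ofReal_mul (by positivity), ← ENNReal.ofReal_mul (by positivity)]
        · congr 1; ring
        · fun_prop
      · fun_prop
    · fun_prop
  have hconst : 0 < (4 * Real.pi) ^ (-(1 / 2) : ℝ) *
          (4 ^ (H - 1 / 2) * Real.Gamma (H - 1 / 2)) := by positivity
  refine ⟨fun htop => ?_, ?_⟩
  -- Finiteness comes for free: the left side of `hlin` is a real number and the constant is
  -- nonzero.
  · rw [htop, ENNReal.mul_top (by simpa using hconst)] at hlin
    exact ENNReal.ofReal_ne_top hlin
  · have e1 : ∫ z : ℝ × ℝ, ((|z.1 - z.2| ^ (2 * H - 2) : ℝ) : ℂ) *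
        (f z.1 * (starRingEnd ℂ) (f z.2))
        = ∫ z : ℝ × ℝ, (((Real.Gamma (1 - H))⁻¹ : ℝ) : ℂ) * ∫ x in Set.Ioi (0 : ℝ), Φ z x := by
      refine integral_congr_ae ?_
      rw [Measure.volume_eq_prod]
      filter_upwards [hdiag] with z hz
      simp only [hΦ]
      rw [integral_mul_const, abs_rpow_eq_integral hH' hz, integral_complex_ofReal]
      push_cast; ring
    rw [e1, integral_const_mul, Measure.volume_eq_prod, integral_integral_swap hΦi,
      setIntegral_congr_fun measurableSet_Ioi hinner, integral_complex_ofReal,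
      ← Complex.ofReal_mul]
    congr 1
    have h3 := congrArg ENNReal.toReal hlin
    rw [ENNReal.toReal_ofReal (setIntegral_nonneg measurableSet_Ioi hg0), ENNReal.toReal_mul,
      ENNReal.toReal_ofReal hconst.le] at h3
    rw [h3, rieszConst]; ring

end RieszKernel

/-! ### Fourier decay of test functions -/

section TestFunctionDecay

open scoped FourierTransform in
theorem spaceFT_eq_fourier {d : ℕ} (φ : Space d → ℝ) (ξ : Space d) :
    spaceFT φ ξ = 𝓕 (fun y => (φ y : ℂ)) ((2 * Real.pi)⁻¹ • ξ) := by
  rw [Real.fourier_eq', spaceFT]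
  refine integral_congr_ae (ae_of_all _ fun y => ?_)
  simp only [smul_eq_mul, inner_smul_right, real_inner_comm]
  congr 2
  have : (Real.pi : ℂ) ≠ 0 := by exact_mod_cast Real.pi_ne_zero
  push_cast
  field_simp

theorem norm_iteratedFDeriv_slice_le {d : ℕ} {f : ℝ × Space d → ℂ} (hf : ContDiff ℝ (⊤ : ℕ∞) f) (j : ℕ)
    (u : ℝ) (y : Space d) :
    ‖iteratedFDeriv ℝ j (fun y => f (u, y)) y‖ ≤ ‖iteratedFDeriv ℝ j f (u, y)‖ := by
  have e : (fun y => f (u, y)) = (fun z => f ((u, (0 : Space d)) + z)) ∘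
      (ContinuousLinearMap.inr ℝ ℝ (Space d)) := by
    ext y; simp
  have hf' : ContDiff ℝ (⊤ : ℕ∞) fun z => f ((u, (0 : Space d)) + z) := by fun_prop
  rw [e, ContinuousLinearMap.iteratedFDeriv_comp_right _ hf' y (i := j) (by exact_mod_cast le_top),
    iteratedFDeriv_comp_add_left]
  refine (ContinuousMultilinearMap.norm_compContinuousLinearMap_le _ _).trans ?_
  have h1 : ‖ContinuousLinearMap.inr ℝ ℝ (Space d)‖ ≤ 1 :=
    ContinuousLinearMap.opNorm_le_bound _ zero_le_one fun x => by simp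
  have h2 : ∏ _i : Fin j, ‖ContinuousLinearMap.inr ℝ ℝ (Space d)‖ ≤ 1 :=
    Finset.prod_le_one (fun _ _ => norm_nonneg _) fun _ _ => h1
  simp only [ContinuousLinearMap.inr_apply, Prod.mk_add_mk, add_zero, zero_add]
  calc _ ≤ ‖iteratedFDeriv ℝ j f (u, y)‖ * 1 := by gcongr
    _ = _ := mul_one _

/-- N derivatives in space give decay of order N. The bound is uniform in u because the derivatives
are bounded with a common compact support, which also gives the cutoff in u. -/
theorem exists_pow_mul_norm_spaceFT_le {d : ℕ} (φ : SpaceTimeTest d) (N : ℕ) :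
    ∃ C R : ℝ, 0 ≤ C ∧ ∀ u ξ, ‖ξ‖ ^ N * ‖spaceFT (fun y => φ (u, y)) ξ‖
      ≤ C * (Set.Icc (-R) R).indicator (fun _ => (1 : ℝ)) u := by
  set f : ℝ × Space d → ℂ := fun z => (φ z : ℂ) with hf
  have hfs : ContDiff ℝ (⊤ : ℕ∞) f := Complex.ofRealCLM.contDiff.comp φ.contDiff
  have hfc : HasCompactSupport f := φ.hasCompactSupport.comp_left (g := ((↑) : ℝ → ℂ)) (by simp)
  obtain ⟨R, hR⟩ := hfc.isCompact.isBounded.subset_closedBall (0 : ℝ × Space d)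
  have hzero : ∀ j u y, (R < |u| ∨ R < ‖y‖) → iteratedFDeriv ℝ j f (u, y) = 0 := by
    intro j u y h
    refine image_eq_zero_of_notMem_tsupport fun hm => ?_
    have := hR (tsupport_iteratedFDeriv_subset j hm)
    rw [mem_closedBall_zero_iff, Prod.norm_def, max_le_iff, Real.norm_eq_abs] at this
    rcases h with h | h <;> linarith [this.1, this.2]
  have hbd : ∀ j : ℕ, ∃ M, ∀ z, ‖iteratedFDeriv ℝ j f z‖ ≤ M := fun j =>
    (hfs.continuous_iteratedFDeriv (m := j) (by exact_mod_cast le_top)).bounded_above_of_compact_support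
      (hfc.iteratedFDeriv j)
  choose M hM using hbd
  set V : ℝ := volume.real (Metric.closedBall (0 : Space d) R) with hV
  have hM0 : ∀ j, 0 ≤ M j := fun j => (norm_nonneg _).trans (hM j 0)
  have hslice : ∀ u, ContDiff ℝ (⊤ : ℕ∞) fun y => f (u, y) := fun u => by fun_prop
  have hind : Integrable ((Metric.closedBall (0 : Space d) R).indicator fun _ => (1 : ℝ)) := by
    rw [integrable_indicator_iff measurableSet_closedBall]
    exact integrableOn_const (measure_closedBall_lt_top.ne)
  have hle : ∀ j u y, ‖iteratedFDeriv ℝ j (fun y => f (u, y)) y‖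
      ≤ M j * (Metric.closedBall (0 : Space d) R).indicator (fun _ => (1 : ℝ)) y := by
    intro j u y
    refine (norm_iteratedFDeriv_slice_le hfs j u y).trans ?_
    by_cases hy : y ∈ Metric.closedBall (0 : Space d) R
    · simpa [Set.indicator_of_mem hy] using hM j (u, y)
    · have : R < ‖y‖ := by simpa using hy
      simp [hzero j u y (Or.inr this), Set.indicator_of_notMem hy]
  have hint : ∀ j u, Integrable fun y => ‖iteratedFDeriv ℝ j (fun y => f (u, y)) y‖ := by
    intro j u
    refine (hind.const_mul (M j)).mono' ?_ (ae_of_all _ fun y => ?_)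
    · exact (((hslice u).continuous_iteratedFDeriv (m := j)
        (by exact_mod_cast le_top)).norm).aestronglyMeasurable
    · rw [norm_norm]; exact hle j u y
  have hintle : ∀ j u, ∫ y, ‖iteratedFDeriv ℝ j (fun y => f (u, y)) y‖ ≤ M j * V := by
    intro j u
    refine (integral_mono (hint j u) (hind.const_mul (M j)) (hle j u)).trans (le_of_eq ?_)
    rw [integral_const_mul, integral_indicator measurableSet_closedBall]
    simp [hV]
  set S : ℝ := ∑ j ∈ Finset.range (N + 1), M j * V with hS
  have hS0 : 0 ≤ S := Finset.sum_nonneg fun j _ => mul_nonneg (hM0 j) measureReal_nonneg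
  refine ⟨(2 * Real.pi) ^ N * (2 ^ N * S), R, by positivity, fun u ξ => ?_⟩
  by_cases hu : u ∈ Set.Icc (-R) R
  · rw [Set.indicator_of_mem hu, mul_one, spaceFT_eq_fourier]
    have h := Real.pow_mul_norm_iteratedFDeriv_fourier_le (K := 0) (N := ⊤)
      (f := fun y => f (u, y)) (k := 0) (n := N) (hslice u)
      (fun k n hk _ => by
        have : k = 0 := by simpa using hk
        subst this
        simpa using hint n u) (by simp) le_top ((2 * Real.pi)⁻¹ • ξ)
    simp only [norm_iteratedFDeriv_zero, pow_zero, one_mul, Nat.cast_zero, mul_zero, zero_add,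
      Finset.range_one, Finset.singleton_product, Finset.sum_map, Function.Embedding.coeFn_mk,
      norm_smul, norm_inv, Real.norm_of_nonneg Real.two_pi_pos.le] at h
    have h2 : ∑ j ∈ Finset.range (N + 1), ∫ y, ‖iteratedFDeriv ℝ j (fun y => f (u, y)) y‖ ≤ S :=
      Finset.sum_le_sum fun j _ => hintle j u
    rw [mul_pow, inv_pow, mul_assoc, inv_mul_le_iff₀ (by positivity)] at h
    refine h.trans ?_
    gcongr
  · have hu' : R < |u| := by
      by_contra hc
      exact hu (abs_le.1 (not_lt.1 hc))
    have h0 : ∀ y, φ (u, y) = 0 := fun y => by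
      have h1 := hzero 0 u y (Or.inl hu')
      have h2 := norm_iteratedFDeriv_zero (𝕜 := ℝ) (f := f) (x := (u, y))
      rw [h1, norm_zero] at h2
      simpa [hf] using (norm_eq_zero.1 h2.symm)
    simp [spaceFT, h0, Set.indicator_of_notMem hu]

theorem measurable_spaceFT_slice {d : ℕ} {g : ℝ → Space d → ℝ}
    (hg : Measurable (Function.uncurry g)) :
    Measurable (Function.uncurry fun u ξ => spaceFT (g u) ξ) := by
  have hg' : Measurable fun q : (ℝ × Space d) × Space d => g q.1.1 q.2 :=
    hg.comp (by fun_prop : Measurable fun q : (ℝ × Space d) × Space d => (q.1.1, q.2))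
  have : Measurable fun q : (ℝ × Space d) × Space d =>
      Complex.exp (-Complex.I * (inner ℝ q.1.2 q.2 : ℝ)) * (g q.1.1 q.2 : ℂ) := by
    have h1 : Measurable fun q : (ℝ × Space d) × Space d => inner ℝ q.1.2 q.2 :=
      Continuous.measurable (by fun_prop)
    fun_prop
  exact this.stronglyMeasurable.integral_prod_right'.measurable

end TestFunctionDecay

/-! ### The covariance form on admissible kernels -/

section Admissible

variable {E : Type*} [MeasurableSpace E] (μ : Measure E)

/-- Kernels `F u ξ` that are compactly supported in `u` and square integrable in `ξ`. -/
def IsAdmissibleKernel (F : ℝ → E → ℂ) : Prop :=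
  Measurable (Function.uncurry F) ∧ ∃ (m : E → ℝ) (R : ℝ), (∀ ξ, 0 ≤ m ξ) ∧ Measurable m ∧
    Integrable (fun ξ => m ξ ^ 2) μ ∧
    ∀ u ξ, ‖F u ξ‖ ≤ m ξ * (Set.Icc (-R) R).indicator (fun _ => (1 : ℝ)) u

variable {μ} {F G : ℝ → E → ℂ}

theorem indicator_Icc_le_of_le {R S : ℝ} (h : R ≤ S) (u : ℝ) :
    (Set.Icc (-R) R).indicator (fun _ => (1 : ℝ)) u
      ≤ (Set.Icc (-S) S).indicator (fun _ => (1 : ℝ)) u :=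
  Set.indicator_le_indicator_of_subset (Set.Icc_subset_Icc (by linarith) h)
    (fun _ => zero_le_one) u

theorem IsAdmissibleKernel.const_mul (hF : IsAdmissibleKernel μ F) (a : ℂ) :
    IsAdmissibleKernel μ fun u ξ => a * F u ξ := by
  obtain ⟨hm, m, R, h0, hmm, hi, hb⟩ := hF
  refine ⟨hm.const_mul a, fun ξ => ‖a‖ * m ξ, R, fun ξ => by have := h0 ξ; positivity,
    hmm.const_mul _, ?_, fun u ξ => ?_⟩
  · simp only [mul_pow]; exact hi.const_mul _
  · rw [norm_mul, mul_assoc]; gcongr; exact hb u ξ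

theorem IsAdmissibleKernel.add (hF : IsAdmissibleKernel μ F) (hG : IsAdmissibleKernel μ G) :
    IsAdmissibleKernel μ fun u ξ => F u ξ + G u ξ := by
  obtain ⟨hm, m, R, h0, hmm, hi, hb⟩ := hF
  obtain ⟨hm', m', R', h0', hmm', hi', hb'⟩ := hG
  refine ⟨hm.add hm', fun ξ => m ξ + m' ξ, max R R', fun ξ => add_nonneg (h0 ξ) (h0' ξ),
    hmm.add hmm', ?_, fun u ξ => ?_⟩
  · refine ((hi.const_mul 2).add (hi'.const_mul 2)).mono'
      ((hmm.add hmm').pow_const 2).aestronglyMeasurable (ae_of_all _ fun ξ => ?_)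
    rw [Real.norm_of_nonneg (sq_nonneg _)]
    simp only [Pi.add_apply]
    nlinarith [sq_nonneg (m ξ - m' ξ)]
  · refine (norm_add_le _ _).trans ?_
    rw [add_mul]
    refine add_le_add ((hb u ξ).trans ?_) ((hb' u ξ).trans ?_)
    · exact mul_le_mul_of_nonneg_left (indicator_Icc_le_of_le (le_max_left _ _) u) (h0 ξ)
    · exact mul_le_mul_of_nonneg_left (indicator_Icc_le_of_le (le_max_right _ _) u) (h0' ξ)

theorem IsAdmissibleKernel.sum {ι : Type*} (s : Finset ι) {F : ι → ℝ → E → ℂ}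
    (hF : ∀ i, IsAdmissibleKernel μ (F i)) (a : ι → ℂ) :
    IsAdmissibleKernel μ fun u ξ => ∑ i ∈ s, a i * F i u ξ := by
  classical
  induction s using Finset.induction_on with
  | empty =>
    exact ⟨by simp [Function.uncurry_def], fun _ => 0, 0, by simp,
      measurable_const, by simp, by simp⟩
  | insert i s hi ih =>
    simp only [Finset.sum_insert hi]
    exact ((hF i).const_mul (a i)).add ih

/-- The integrand of the covariance form. -/
noncomputable def rieszIntegrand (H : ℝ) (F G : ℝ → E → ℂ) (p : (ℝ × ℝ) × E) : ℂ :=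
  ((|p.1.1 - p.1.2| ^ (2 * H - 2) : ℝ) : ℂ) * (F p.1.1 p.2 * (starRingEnd ℂ) (G p.1.2 p.2))

/-- The bound splits into a Riesz kernel on a square of times and a product of two functions in
L²(μ). This integrability justifies every interchange of integrals in the covariance. -/
theorem IsAdmissibleKernel.integrable_rieszIntegrand [SFinite μ] {H : ℝ} (hH : 1 / 2 < H)
    (hF : IsAdmissibleKernel μ F) (hG : IsAdmissibleKernel μ G) :
    Integrable (rieszIntegrand H F G) ((volume.prod volume).prod μ) := by
  obtain ⟨hm, m, R, h0, hmm, hi, hb⟩ := hF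
  obtain ⟨hm', m', R', h0', hmm', hi', hb'⟩ := hG
  have hmul : Integrable (fun ξ => m ξ * m' ξ) μ := by
    refine (hi.add hi').mono' (hmm.mul hmm').aestronglyMeasurable (ae_of_all _ fun ξ => ?_)
    rw [Real.norm_of_nonneg (mul_nonneg (h0 ξ) (h0' ξ))]
    simp only [Pi.add_apply]
    nlinarith [sq_nonneg (m ξ - m' ξ), sq_nonneg (m ξ), sq_nonneg (m' ξ)]
  refine ((integrable_abs_sub_rpow_mul_indicator (p := 2 * H - 2) (by linarith)
    (max R R')).mul_prod hmul).mono' ?_ (ae_of_all _ fun p => ?_)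
  · have h1 : Measurable fun p : (ℝ × ℝ) × E => F p.1.1 p.2 :=
      hm.comp (by fun_prop : Measurable fun p : (ℝ × ℝ) × E => (p.1.1, p.2))
    have h2 : Measurable fun p : (ℝ × ℝ) × E => G p.1.2 p.2 :=
      hm'.comp (by fun_prop : Measurable fun p : (ℝ × ℝ) × E => (p.1.2, p.2))
    have h3 : Measurable fun p : (ℝ × ℝ) × E => |p.1.1 - p.1.2| ^ (2 * H - 2) :=
      (continuous_abs.measurable.comp (by fun_prop :
        Measurable fun p : (ℝ × ℝ) × E => p.1.1 - p.1.2)).pow_const _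
    exact ((Complex.measurable_ofReal.comp h3).mul (h1.mul
      (Complex.continuous_conj.measurable.comp h2))).aestronglyMeasurable
  · rw [rieszIntegrand, norm_mul, norm_mul, RCLike.norm_conj, Complex.norm_real,
      Real.norm_of_nonneg (by positivity)]
    have e1 := (hb p.1.1 p.2).trans (mul_le_mul_of_nonneg_left
      (indicator_Icc_le_of_le (le_max_left R R') _) (h0 p.2))
    have e2 := (hb' p.1.2 p.2).trans (mul_le_mul_of_nonneg_left
      (indicator_Icc_le_of_le (le_max_right R R') _) (h0' p.2))
    calc _ ≤ |p.1.1 - p.1.2| ^ (2 * H - 2) * (_ * _) :=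
          mul_le_mul_of_nonneg_left (mul_le_mul e1 e2 (norm_nonneg _)
            ((norm_nonneg _).trans e1)) (by positivity)
      _ = _ := by ring

theorem IsAdmissibleKernel.integral_riesz [SFinite μ] {H : ℝ} (hH : 1 / 2 < H)
    (hF : IsAdmissibleKernel μ F) (hG : IsAdmissibleKernel μ G) :
    ∫ u : ℝ, ∫ v : ℝ, |u - v| ^ (2 * H - 2) * (∫ ξ, F u ξ * (starRingEnd ℂ) (G v ξ) ∂μ).re
      = (∫ p, rieszIntegrand H F G p ∂((volume.prod volume).prod μ)).re := by
  have hi := hF.integrable_rieszIntegrand hH hG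
  have e : ∀ z : ℝ × ℝ, |z.1 - z.2| ^ (2 * H - 2) *
      (∫ ξ, F z.1 ξ * (starRingEnd ℂ) (G z.2 ξ) ∂μ).re
      = (∫ ξ, rieszIntegrand H F G (z, ξ) ∂μ).re := by
    intro z
    simp only [rieszIntegrand]
    rw [integral_const_mul, Complex.re_ofReal_mul]
  have h1 : Integrable (fun z : ℝ × ℝ => (∫ ξ, rieszIntegrand H F G (z, ξ) ∂μ).re)
      (volume.prod volume) := hi.integral_prod_left.re
  rw [integral_prod _ hi]
  have h2 := integral_re hi.integral_prod_left
  simp only [RCLike.re_eq_complex_re] at h2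
  rw [← h2, integral_prod _ h1]
  simp only [← e]

/-- Integrate in time first: for each fixed ξ this is the one-dimensional Riesz–Plancherel identity,
and the result is then integrated against μ. -/
theorem IsAdmissibleKernel.integral_riesz_self [SFinite μ] {H : ℝ} (hH : 1 / 2 < H) (hH' : H < 1)
    (hF : IsAdmissibleKernel μ F) :
    (∫⁻ ξ, (∫⁻ τ : ℝ, ENNReal.ofReal
      (|τ| ^ (1 - 2 * H) * ‖timeFT (fun u => F u ξ) τ‖ ^ 2)) ∂μ)
        ≠ ∞ ∧
    (∫ p, rieszIntegrand H F F p ∂((volume.prod volume).prod μ)).re = rieszConst H *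
      (∫⁻ ξ, (∫⁻ τ : ℝ, ENNReal.ofReal
        (|τ| ^ (1 - 2 * H) * ‖timeFT (fun u => F u ξ) τ‖ ^ 2)) ∂μ).toReal := by
  have hi := hF.integrable_rieszIntegrand hH hF
  have hFm := hF.1
  obtain ⟨hm, m, R, h0, hmm, -, hb⟩ := hF
  have hslice : ∀ ξ, Measurable fun u => F u ξ := fun ξ => hm.comp measurable_prodMk_right
  have key := fun ξ => integral_riesz_mul_conj hH hH' (hslice ξ) (fun u => hb u ξ)
  set L : E → ℝ≥0∞ := fun ξ => ∫⁻ τ : ℝ, ENNReal.ofReal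
        (|τ| ^ (1 - 2 * H) * ‖timeFT (fun u => F u ξ) τ‖ ^ 2) with hL
  have hFT : Measurable fun p : E × ℝ => timeFT (fun u => F u p.1) p.2 := by
    have h1 : Measurable fun q : (E × ℝ) × ℝ => F q.2 q.1.1 :=
      hm.comp (by fun_prop : Measurable fun q : (E × ℝ) × ℝ => (q.2, q.1.1))
    have : Measurable fun q : (E × ℝ) × ℝ =>
        Complex.exp (-Complex.I * (q.1.2 * q.2 : ℝ)) * F q.2 q.1.1 := by fun_prop
    exact this.stronglyMeasurable.integral_prod_right'.measurable
  have hLm : Measurable L := by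
    refine Measurable.lintegral_prod_right' (f := fun p : E × ℝ => ENNReal.ofReal
        (|p.2| ^ (1 - 2 * H) * ‖timeFT (fun u => F u p.1) p.2‖ ^ 2)) ?_
    have : Measurable fun p : E × ℝ => |p.2| ^ (1 - 2 * H) :=
      (continuous_abs.measurable.comp measurable_snd).pow_const _
    fun_prop
  have hq : ∀ ξ, ∫ z, rieszIntegrand H F F (z, ξ) ∂(volume.prod volume)
      = ((rieszConst H * (L ξ).toReal : ℝ) : ℂ) := fun ξ => (key ξ).2
  have hLfin : ∀ ξ, L ξ ≠ ∞ := fun ξ => (key ξ).1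
  have hc := rieszConst_pos hH hH'
  have hLi : Integrable (fun ξ => (L ξ).toReal) μ := by
    have h1 := hi.integral_prod_right
    simp only [hq] at h1
    have h2 : Integrable (fun ξ => rieszConst H * (L ξ).toReal) μ := by exact_mod_cast h1.re
    have h3 := h2.const_mul (rieszConst H)⁻¹
    simpa [← mul_assoc, inv_mul_cancel₀ hc.ne'] using h3
  have hfin : ∫⁻ ξ, L ξ ∂μ ≠ ∞ := by
    have := hLi.lintegral_lt_top
    simp only [ENNReal.ofReal_toReal (hLfin _)] at this
    exact this.ne
  refine ⟨hfin, ?_⟩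
  rw [integral_prod_symm _ hi]
  simp only [hq]
  rw [integral_complex_ofReal, Complex.ofReal_re, integral_const_mul,
    integral_toReal hLm.aemeasurable (ae_of_all _ fun ξ => (hLfin ξ).lt_top)]

theorem integral_riesz_sum {ι : Type*} [Fintype ι] [SFinite μ] {H : ℝ} (hH : 1 / 2 < H)
    {F : ι → ℝ → E → ℂ} (hF : ∀ i, IsAdmissibleKernel μ (F i)) (a : ι → ℝ) :
    (∫ p, rieszIntegrand H (fun u ξ => ∑ i, (a i : ℂ) * F i u ξ)
        (fun u ξ => ∑ i, (a i : ℂ) * F i u ξ) p ∂((volume.prod volume).prod μ)).re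
      = ∑ i, ∑ j, a i * a j *
        (∫ p, rieszIntegrand H (F i) (F j) p ∂((volume.prod volume).prod μ)).re := by
  have e : ∀ p, rieszIntegrand H (fun u ξ => ∑ i, (a i : ℂ) * F i u ξ)
        (fun u ξ => ∑ i, (a i : ℂ) * F i u ξ) p
      = ∑ i, ∑ j, ((a i * a j : ℝ) : ℂ) * rieszIntegrand H (F i) (F j) p := by
    intro p
    simp only [rieszIntegrand, map_sum, map_mul, Complex.conj_ofReal]
    rw [Finset.sum_mul_sum, Finset.mul_sum]
    refine Finset.sum_congr rfl fun i _ => ?_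
    rw [Finset.mul_sum]
    refine Finset.sum_congr rfl fun j _ => ?_
    push_cast; ring
  simp only [e]
  rw [integral_finsetSum _ fun i _ => integrable_finsetSum _ fun j _ =>
    ((hF i).integrable_rieszIntegrand hH (hF j)).const_mul _, Complex.re_sum]
  refine Finset.sum_congr rfl fun i _ => ?_
  rw [integral_finsetSum _ fun j _ =>
    ((hF i).integrable_rieszIntegrand hH (hF j)).const_mul _, Complex.re_sum]
  refine Finset.sum_congr rfl fun j _ => ?_
  rw [integral_const_mul, Complex.re_ofReal_mul]

end Admissible

/-! ### The spectral measure and the frequency space -/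

section SpectralMeasure

variable {d : ℕ} {μ : Measure (Space d)} {β : ℝ}

theorem MeasureComparable.sigmaFinite (hμ : MeasureComparable μ β) : SigmaFinite μ := by
  obtain ⟨c, C, -, -, h⟩ := hμ
  have : SigmaFinite (C • volume.withDensity
      (fun ξ : Space d => ENNReal.ofReal (‖ξ‖ ^ (-β)))) := by
    have := SigmaFinite.withDensity_ofReal (μ := volume) fun ξ : Space d => ‖ξ‖ ^ (-β)
    infer_instance
  exact Measure.sigmaFinite_of_le _ h

theorem MeasureComparable.absolutelyContinuous (hμ : MeasureComparable μ β) : μ ≪ volume := by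
  obtain ⟨c, C, -, -, h⟩ := hμ
  refine (Measure.absolutelyContinuous_of_le h).trans ?_
  exact (Measure.smul_absolutelyContinuous (c := C)).trans (withDensity_absolutelyContinuous _ _)

theorem MeasureComparable.lintegral_le (hμ : MeasureComparable μ β) :
    ∃ C : ℝ≥0, ∀ f : Space d → ℝ≥0∞,
      ∫⁻ ξ, f ξ ∂μ ≤ C * ∫⁻ ξ, ENNReal.ofReal (‖ξ‖ ^ (-β)) * f ξ := by
  obtain ⟨c, C, -, -, h⟩ := hμ
  refine ⟨C, fun f => (lintegral_mono' h le_rfl).trans (le_of_eq ?_)⟩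
  rw [lintegral_smul_measure, ENNReal.smul_def, smul_eq_mul]
  congr 1
  exact lintegral_withDensity_eq_lintegral_mul_non_measurable _ (by fun_prop)
    (ae_of_all _ fun ξ => ENNReal.ofReal_lt_top) f

theorem MeasureComparable.le_lintegral (hμ : MeasureComparable μ β) :
    ∃ c : ℝ≥0, 0 < c ∧ ∀ f : Space d → ℝ≥0∞,
      c * ∫⁻ ξ, ENNReal.ofReal (‖ξ‖ ^ (-β)) * f ξ ≤ ∫⁻ ξ, f ξ ∂μ := by
  obtain ⟨c, C, hc, h, -⟩ := hμ
  refine ⟨c, hc, fun f => (le_of_eq ?_).trans (lintegral_mono' h le_rfl)⟩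
  rw [lintegral_smul_measure, ENNReal.smul_def, smul_eq_mul]
  congr 1
  exact (lintegral_withDensity_eq_lintegral_mul_non_measurable _ (by fun_prop)
    (ae_of_all _ fun ξ => ENNReal.ofReal_lt_top) f).symm

/-- Decay of orders 0 and d gives the envelope (C₀+C₁)/(1+|ξ|^d). Its square times |ξ|^{-β} is
integrable at 0 because β < d, and at infinity because -β - 2d < -d. -/
theorem isAdmissibleKernel_testFunction (hμ : MeasureComparable μ β) (hβ : 0 < β) (hβ' : β < d)
    (φ : SpaceTimeTest d) : IsAdmissibleKernel μ fun u ξ => spaceFT (fun y => φ (u, y)) ξ := by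
  have hd : 1 ≤ d := by
    have : (0 : ℝ) < d := hβ.trans hβ'
    exact_mod_cast this
  obtain ⟨C₀, R₀, hC₀, h₀⟩ := exists_pow_mul_norm_spaceFT_le φ 0
  obtain ⟨C₁, R₁, hC₁, h₁⟩ := exists_pow_mul_norm_spaceFT_le φ d
  have hmm : Measurable fun ξ : Space d => (C₀ + C₁) * (1 + ‖ξ‖ ^ d)⁻¹ := by fun_prop
  refine ⟨measurable_spaceFT_slice (g := fun u y => φ (u, y)) φ.continuous.measurable,
    fun ξ => (C₀ + C₁) * (1 + ‖ξ‖ ^ d)⁻¹, max R₀ R₁, fun ξ => by positivity, hmm, ?_,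
    fun u ξ => ?_⟩
  · refine ⟨(hmm.pow_const 2).aestronglyMeasurable, ?_⟩
    rw [hasFiniteIntegral_iff_norm]
    obtain ⟨C, hC⟩ := hμ.lintegral_le
    refine (hC _).trans_lt (ENNReal.mul_lt_top ENNReal.coe_lt_top ?_)
    refine lintegral_lt_top_of_le_norm_rpow volume (by simpa using hd) (p := -β)
      (q := -β - 2 * d) (C := (C₀ + C₁) ^ 2) (by simpa using hβ') ?_ (fun x hx0 hx => ?_)
      fun x hx => ?_
    · rw [finrank_euclideanSpace_fin]
      have : (0 : ℝ) < d := hβ.trans hβ'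
      linarith
    · rw [← ENNReal.ofReal_mul (by positivity), Real.norm_of_nonneg (by positivity), mul_comm]
      refine ENNReal.ofReal_le_ofReal (mul_le_mul_of_nonneg_right ?_ (by positivity))
      refine pow_le_pow_left₀ (by positivity) (mul_le_of_le_one_right (by positivity) ?_) 2
      exact inv_le_one_of_one_le₀ (by linarith [pow_nonneg (norm_nonneg x) d])
    · have hx' : 0 < ‖x‖ := one_pos.trans_le hx
      rw [← ENNReal.ofReal_mul (by positivity), Real.norm_of_nonneg (by positivity), sub_eq_add_neg,
        Real.rpow_add hx', ← mul_assoc, mul_comm (_ ^ 2) (‖x‖ ^ (-β)), mul_assoc]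
      refine ENNReal.ofReal_le_ofReal (mul_le_mul_of_nonneg_left ?_ (by positivity))
      rw [mul_pow]
      refine mul_le_mul_of_nonneg_left ?_ (by positivity)
      rw [Real.rpow_neg hx'.le, inv_pow, show (2 * (d : ℝ)) = ((d * 2 : ℕ) : ℝ) by push_cast; ring,
        Real.rpow_natCast, pow_mul]
      gcongr
      linarith
  · have e0 := (h₀ u ξ).trans (mul_le_mul_of_nonneg_left
      (indicator_Icc_le_of_le (le_max_left R₀ R₁) u) hC₀)
    have e1 := (h₁ u ξ).trans (mul_le_mul_of_nonneg_left
      (indicator_Icc_le_of_le (le_max_right R₀ R₁) u) hC₁)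
    rw [mul_right_comm, ← div_eq_mul_inv, le_div_iff₀ (by positivity)]
    rw [pow_zero, one_mul] at e0
    linarith

theorem measurable_spaceTimeFT {g : ℝ → Space d → ℝ} (hg : Measurable (Function.uncurry g)) :
    Measurable fun p : Space d × ℝ => spaceTimeFT g p.2 p.1 := by
  have h1 : Measurable fun q : (Space d × ℝ) × ℝ => spaceFT (g q.2) q.1.1 := by
    have e : (fun q : (Space d × ℝ) × ℝ => spaceFT (g q.2) q.1.1)
        = (Function.uncurry fun u ξ => spaceFT (g u) ξ) ∘ fun q => (q.2, q.1.1) := rfl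
    rw [e]
    exact (measurable_spaceFT_slice hg).comp (by fun_prop)
  have h2 : Measurable fun q : (Space d × ℝ) × ℝ =>
      Complex.exp (-Complex.I * (q.1.2 * q.2 : ℝ)) := Continuous.measurable (by fun_prop)
  unfold spaceTimeFT
  exact (h2.mul h1).stronglyMeasurable.integral_prod_right.measurable

/-- The measure `|τ|^{1-2H} dτ μ(dξ)` on the frequency space. -/
noncomputable def frequencyMeasure (H : ℝ) (μ : Measure (Space d)) : Measure (Space d × ℝ) :=
  (μ.prod volume).withDensity fun p => ENNReal.ofReal (|p.2| ^ (1 - 2 * H))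

theorem lintegral_frequencyMeasure [SFinite μ] (H : ℝ) {h : Space d × ℝ → ℂ} (hh : Measurable h) :
    ∫⁻ ξ, (∫⁻ τ : ℝ, ENNReal.ofReal (|τ| ^ (1 - 2 * H) * ‖h (ξ, τ)‖ ^ 2)) ∂μ
      = eLpNorm h 2 (frequencyMeasure H μ) ^ 2 := by
  have hw : Measurable fun p : Space d × ℝ => ENNReal.ofReal (|p.2| ^ (1 - 2 * H)) :=
    ((continuous_abs.measurable.comp measurable_snd).pow_const _).ennreal_ofReal
  rw [eLpNorm_eq_lintegral_rpow_enorm_toReal two_ne_zero ENNReal.ofNat_ne_top, frequencyMeasure,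
    lintegral_withDensity_eq_lintegral_mul _ hw (by fun_prop), lintegral_prod _ (by fun_prop)]
  rw [← ENNReal.rpow_natCast, ← ENNReal.rpow_mul]
  norm_num
  refine lintegral_congr fun ξ => lintegral_congr fun τ => ?_
  rw [ENNReal.ofReal_mul (by positivity), ENNReal.ofReal_pow (norm_nonneg _), ofReal_norm]

theorem noiseDistSq_eq [SFinite μ] (H : ℝ) {φ g : ℝ → Space d → ℝ}
    (hφ : Measurable (Function.uncurry φ)) (hg : Measurable (Function.uncurry g)) :
    noiseDistSq H μ φ g = eLpNorm ((fun p : Space d × ℝ => spaceTimeFT φ p.2 p.1) -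
      fun p : Space d × ℝ => spaceTimeFT g p.2 p.1) 2 (frequencyMeasure H μ) ^ 2 := by
  rw [← lintegral_frequencyMeasure H ((measurable_spaceTimeFT hφ).sub (measurable_spaceTimeFT hg))]
  rfl

end SpectralMeasure

/-! ### Gaussian isometry for deterministic kernels -/

section NoiseIntegral

variable {d : ℕ} {H β : ℝ} {μ : Measure (Space d)} {Ω : Type*} [MeasurableSpace Ω]
  {P : Measure Ω} {B : SpaceTimeTest d → Ω → ℝ}

/-- The constant in the spectral form of the covariance of the noise. -/
noncomputable def noiseConst (d : ℕ) (H : ℝ) : ℝ :=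
  H * (2 * H - 1) * (2 * Real.pi) ^ (-(d : ℝ)) * rieszConst H

theorem noiseConst_pos (d : ℕ) (hH : 1 / 2 < H) (hH' : H < 1) : 0 < noiseConst d H := by
  have := rieszConst_pos hH hH'
  have : 0 < 2 * H - 1 := by linarith
  have : 0 < H := by linarith
  unfold noiseConst
  positivity

theorem IsGaussianProcess.hasGaussianLaw_comp {S : Type*} (hB : IsGaussianProcess B P)
    [Fintype S] (φ : S → SpaceTimeTest d) : HasGaussianLaw (fun ω i => B (φ i) ω) P := by
  have h := (hB.comp_right φ).hasGaussianLaw Finset.univ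
  exact h.map_fun (ContinuousLinearMap.pi fun i : S =>
    ContinuousLinearMap.proj (R := ℝ) (φ := fun _ : (Finset.univ : Finset S) => ℝ)
      ⟨i, Finset.mem_univ i⟩)

theorem timeFT_sum {ι : Type*} [Fintype ι] {F : ι → ℝ → ℂ} (hF : ∀ i, Integrable (F i))
    (a : ι → ℝ) (τ : ℝ) :
    timeFT (fun u => ∑ i, (a i : ℂ) * F i u) τ = ∑ i, a i • timeFT (F i) τ := by
  unfold timeFT
  simp only [Finset.mul_sum]
  rw [integral_finsetSum]
  · refine Finset.sum_congr rfl fun i _ => ?_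
    rw [Complex.real_smul, ← integral_const_mul]
    refine integral_congr_ae (ae_of_all _ fun u => ?_)
    simp only; ring
  · intro i _
    refine ((hF i).const_mul (a i : ℂ)).bdd_mul (c := 1) (Continuous.aestronglyMeasurable
      (by fun_prop)) (ae_of_all _ fun u => ?_)
    rw [norm_exp_neg_I_mul]

/-- Expand the square, apply the covariance to each pair and reassemble by bilinearity. The combined
kernel is again admissible, so its quadratic form is a frequency-space norm. -/
theorem IsFractionalColoredNoise.integral_sum_sq [IsProbabilityMeasure P]
    (hB : IsFractionalColoredNoise H μ P B) (hH : 1 / 2 < H) (hH' : H < 1)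
    (hμ : MeasureComparable μ β) (hβ : 0 < β) (hβ' : β < d)
    {ι : Type*} [Fintype ι] (φ : ι → SpaceTimeTest d) (a : ι → ℝ) :
    MemLp (fun p : Space d × ℝ => ∑ i, a i • spaceTimeFT (fun u y => φ i (u, y)) p.2 p.1) 2
      (frequencyMeasure H μ) ∧
    ∫ ω, (∑ i, a i * B (φ i) ω) ^ 2 ∂P = noiseConst d H *
      (eLpNorm (fun p : Space d × ℝ => ∑ i, a i • spaceTimeFT (fun u y => φ i (u, y)) p.2 p.1) 2
        (frequencyMeasure H μ)).toReal ^ 2 := by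
  have := hμ.sigmaFinite
  have hm : ∀ φ, MemLp (B φ) 2 P := fun φ => (hB.gaussian.hasGaussianLaw_eval φ).memLp_two
  set F : ι → ℝ → Space d → ℂ := fun i u ξ => spaceFT (fun y => φ i (u, y)) ξ with hF
  have hadm : ∀ i, IsAdmissibleKernel μ (F i) := fun i =>
    isAdmissibleKernel_testFunction hμ hβ hβ' (φ i)
  have hsum := IsAdmissibleKernel.sum Finset.univ hadm fun i => (a i : ℂ)
  obtain ⟨hfin, hself⟩ := hsum.integral_riesz_self hH hH'
  have hFi : ∀ i ξ, Integrable fun u => F i u ξ := by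
    intro i ξ
    obtain ⟨hFm, m, R, h0, -, -, hb⟩ := hadm i
    have hI : Integrable ((Set.Icc (-R) R).indicator (fun _ => (1 : ℝ))) := by
      rw [integrable_indicator_iff measurableSet_Icc]
      exact integrableOn_const (by simp)
    exact (hI.const_mul (m ξ)).mono' (hFm.comp measurable_prodMk_right).aestronglyMeasurable
      (ae_of_all _ fun u => hb u ξ)
  have hFT : ∀ ξ τ, timeFT (fun u => ∑ i, (a i : ℂ) * F i u ξ) τ
      = ∑ i, a i • spaceTimeFT (fun u y => φ i (u, y)) τ ξ := fun ξ τ =>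
    timeFT_sum (fun i => hFi i ξ) a τ
  have hmeas : Measurable fun p : Space d × ℝ =>
      ∑ i, a i • spaceTimeFT (fun u y => φ i (u, y)) p.2 p.1 :=
    Finset.measurable_fun_sum _ fun i _ =>
      (measurable_spaceTimeFT (g := fun u y => φ i (u, y)) (φ i).continuous.measurable).const_smul (a i)
  simp only [hFT] at hfin hself
  rw [lintegral_frequencyMeasure H hmeas] at hfin hself
  refine ⟨⟨hmeas.aestronglyMeasurable, ?_⟩, ?_⟩
  · rw [lt_top_iff_ne_top]
    intro h
    rw [h] at hfin
    simp at hfin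
  · rw [ENNReal.toReal_pow] at hself
    rw [noiseConst, mul_assoc _ (rieszConst H), ← hself, integral_riesz_sum hH hadm a,
      Finset.mul_sum]
    have e : ∀ ω, (∑ i, a i * B (φ i) ω) ^ 2
        = ∑ i, ∑ j, a i * a j * (B (φ i) ω * B (φ j) ω) := by
      intro ω
      rw [pow_two, Finset.sum_mul_sum]
      exact Finset.sum_congr rfl fun i _ => Finset.sum_congr rfl fun j _ => by ring
    have hij : ∀ i j, Integrable (fun ω => a i * a j * (B (φ i) ω * B (φ j) ω)) P := fun i j =>
      ((hm (φ i)).integrable_mul (hm (φ j))).const_mul _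
    simp only [e]
    rw [integral_finsetSum _ fun i _ => integrable_finsetSum _ fun j _ => hij i j]
    refine Finset.sum_congr rfl fun i _ => ?_
    rw [integral_finsetSum _ fun j _ => hij i j, Finset.mul_sum]
    refine Finset.sum_congr rfl fun j _ => ?_
    rw [integral_const_mul, hB.covariance, ← (hadm i).integral_riesz hH (hadm j)]
    ring

/-- Isometry: integrals of deterministic kernels are jointly Gaussian, centered, and their
`L²(P)`-norms are computed in frequency space. -/
theorem IsFractionalColoredNoise.isometry [IsProbabilityMeasure P]
    (hB : IsFractionalColoredNoise H μ P B) (hH : 1 / 2 < H) (hH' : H < 1)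
    (hμ : MeasureComparable μ β) (hβ : 0 < β) (hβ' : β < d)
    {ι : Type*} [Fintype ι] {g : ι → ℝ → Space d → ℝ}
    (hg : ∀ i, Measurable (Function.uncurry (g i))) {Z : ι → Ω → ℝ} (hZ : ∀ i, Measurable (Z i))
    (hZg : ∀ i, IsNoiseIntegral H μ P B (g i) (Z i)) :
    HasGaussianLaw (fun ω i => Z i ω) P ∧ (∀ i, ∫ ω, Z i ω ∂P = 0) ∧ ∀ a : ι → ℝ,
      (∫⁻ ξ, (∫⁻ τ : ℝ, ENNReal.ofReal
        (|τ| ^ (1 - 2 * H) * ‖∑ i, a i • spaceTimeFT (g i) τ ξ‖ ^ 2)) ∂μ) ≠ ∞ ∧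
      ∫ ω, (∑ i, a i * Z i ω) ^ 2 ∂P = noiseConst d H *
        (∫⁻ ξ, (∫⁻ τ : ℝ, ENNReal.ofReal
          (|τ| ^ (1 - 2 * H) * ‖∑ i, a i • spaceTimeFT (g i) τ ξ‖ ^ 2)) ∂μ).toReal := by
  have := hμ.sigmaFinite
  choose φ hφ1 hφ2 using hZg
  have hm : ∀ φ, MemLp (B φ) 2 P := fun φ => (hB.gaussian.hasGaussianLaw_eval φ).memLp_two
  have hZm : ∀ i, MemLp (Z i) 2 P := fun i =>
    memLp_of_tendsto_eLpNorm (fun n => hm (φ i n)) (hZ i).aestronglyMeasurable (hφ2 i)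
  refine ⟨hasGaussianLaw_of_tendsto_eLpNorm (f := fun n i => B (φ i n))
    (fun n => IsGaussianProcess.hasGaussianLaw_comp hB.gaussian fun i => φ i n)
    (fun i => (hZ i).aemeasurable) hφ2, fun i => ?_, fun a => ?_⟩
  · have hone : MemLp (fun _ : Ω => (1 : ℝ)) 2 P := memLp_const 1
    have h := tendsto_integral_mul_of_tendsto_eLpNorm (fun n => hm (φ i n)) (fun _ => hone)
      (hZm i) hone (hφ2 i) (by simp)
    simp only [mul_one, hB.centered] at h
    exact (tendsto_nhds_unique h tendsto_const_nhds)
  · have hφm : ∀ i n, Measurable fun p : Space d × ℝ =>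
        spaceTimeFT (fun u y => φ i n (u, y)) p.2 p.1 := fun i n =>
      measurable_spaceTimeFT (g := fun u y => φ i n (u, y)) (φ i n).continuous.measurable
    have hgm : ∀ i, Measurable fun p : Space d × ℝ => spaceTimeFT (g i) p.2 p.1 := fun i =>
      measurable_spaceTimeFT (hg i)
    have hmeas : Measurable fun p : Space d × ℝ => ∑ i, a i • spaceTimeFT (g i) p.2 p.1 :=
      Finset.measurable_fun_sum _ fun i _ => (hgm i).const_smul (a i)
    have hlim : ∀ i, Tendsto (fun n => eLpNorm ((fun p : Space d × ℝ =>
        spaceTimeFT (fun u y => φ i n (u, y)) p.2 p.1) - fun p : Space d × ℝ =>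
        spaceTimeFT (g i) p.2 p.1) 2 (frequencyMeasure H μ)) atTop (𝓝 0) := by
      intro i
      have h := hφ1 i
      simp only [noiseDistSq_eq (μ := μ) H (φ := fun u y => φ i _ (u, y))
        (φ i _).continuous.measurable (hg i)] at h
      have h2 := (ENNReal.continuous_rpow_const (y := 1 / 2)).tendsto _ |>.comp h
      have e : ∀ x : ℝ≥0∞, (x ^ 2) ^ (1 / 2 : ℝ) = x := fun x => by
        rw [← ENNReal.rpow_natCast, ← ENNReal.rpow_mul]; norm_num
      simpa only [Function.comp_def, e, ENNReal.zero_rpow_of_pos (one_half_pos (α := ℝ))] using h2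
    have hsumlim := tendsto_eLpNorm_sum a
      (f := fun n i (p : Space d × ℝ) => spaceTimeFT (fun u y => φ i n (u, y)) p.2 p.1)
      (f' := fun i (p : Space d × ℝ) => spaceTimeFT (g i) p.2 p.1)
      (fun n i => (hφm i n).aestronglyMeasurable) (fun i => (hgm i).aestronglyMeasurable) hlim
    -- The identity holds along the approximating test functions. Their combinations converge both
    -- in L²(P) and in L² of frequency space, so it passes to the limit.
    have hkey := fun n => hB.integral_sum_sq hH hH' hμ hβ hβ' (fun i => φ i n) a
    have hmem : MemLp (fun p : Space d × ℝ => ∑ i, a i • spaceTimeFT (g i) p.2 p.1) 2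
        (frequencyMeasure H μ) :=
      memLp_of_tendsto_eLpNorm (fun n => (hkey n).1) hmeas.aestronglyMeasurable hsumlim
    rw [lintegral_frequencyMeasure H hmeas]
    refine ⟨by simpa using hmem.2.ne, ?_⟩
    have hnorm := ((Lp.tendsto_Lp_iff_tendsto_eLpNorm'' _ (fun n => (hkey n).1) _ hmem).2
      hsumlim).norm
    simp only [Lp.norm_toLp] at hnorm
    have hS : ∀ (Y : ι → Ω → ℝ), (∀ i, MemLp (Y i) 2 P) →
        MemLp (fun ω => ∑ i, a i * Y i ω) 2 P := fun Y hY => by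
      have := memLp_finsetSum Finset.univ fun i (_ : i ∈ Finset.univ) => (hY i).const_mul (a i)
      exact this
    have hZlim := tendsto_eLpNorm_sum a (f := fun n i => B (φ i n)) (f' := Z)
      (fun n i => (hm _).1) (fun i => (hZm i).1) hφ2
    have hL := tendsto_integral_mul_of_tendsto_eLpNorm
      (fun n => hS (fun i => B (φ i n)) fun i => hm _) (fun n => hS (fun i => B (φ i n)) fun i => hm _)
      (hS Z hZm) (hS Z hZm) hZlim hZlim
    simp only [← pow_two, (hkey _).2] at hL
    rw [ENNReal.toReal_pow]
    exact tendsto_nhds_unique hL ((hnorm.pow 2).const_mul _)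

end NoiseIntegral

/-! ### Integrability of the density of a probability law -/

section LevyInversion

variable {V : Type*} [NormedAddCommGroup V] [InnerProductSpace ℝ V] [MeasurableSpace V]
  [BorelSpace V] [FiniteDimensional ℝ V]

open scoped FourierTransform in
-- The transform is a positive Gaussian of total mass the value at the origin of the original one,
-- whatever the width c.
theorem lintegral_enorm_fourier_gaussian {c : ℝ} (hc : 0 < c) :
    ∫⁻ z : V, ‖𝓕 (fun v : V => Complex.exp (-((c⁻¹ : ℝ) : ℂ) * ‖v‖ ^ 2)) z‖ₑ = 1 := by
  have hb : 0 < ((c⁻¹ : ℝ) : ℂ).re := by rw [Complex.ofReal_re]; positivity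
  have hb' : 0 < Real.pi ^ 2 * c := by positivity
  have e : ∀ z : V, ‖𝓕 (fun v : V => Complex.exp (-((c⁻¹ : ℝ) : ℂ) * ‖v‖ ^ 2)) z‖ₑ
      = ENNReal.ofReal ((Real.pi * c) ^ (Module.finrank ℝ V / 2 : ℝ) *
        Real.exp (-(Real.pi ^ 2 * c) * ‖z‖ ^ 2)) := by
    intro z
    rw [fourier_gaussian_innerProductSpace hb, ← ofReal_norm, norm_mul]
    congr 2
    · have : (Real.pi : ℂ) / ((c⁻¹ : ℝ) : ℂ) = ((Real.pi * c : ℝ) : ℂ) := by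
        push_cast; rw [div_inv_eq_mul]
      rw [this, show ((Module.finrank ℝ V : ℂ) / 2) = ((Module.finrank ℝ V / 2 : ℝ) : ℂ) by
        push_cast; rfl, Complex.norm_cpow_eq_rpow_re_of_pos (by positivity), Complex.ofReal_re]
    · rw [Complex.norm_exp]
      congr 1
      have : -(Real.pi : ℂ) ^ 2 * (‖z‖ : ℂ) ^ 2 / ((c⁻¹ : ℝ) : ℂ)
          = ((-(Real.pi ^ 2 * c) * ‖z‖ ^ 2 : ℝ) : ℂ) := by
        push_cast; rw [div_inv_eq_mul]; ring
      rw [this, Complex.ofReal_re]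
  simp only [e]
  have hI := GaussianFourier.integral_rexp_neg_mul_sq_norm (V := V) hb'
  have hpos : 0 < (Real.pi / (Real.pi ^ 2 * c)) ^ (Module.finrank ℝ V / 2 : ℝ) := by positivity
  have hint : Integrable fun v : V => Real.exp (-(Real.pi ^ 2 * c) * ‖v‖ ^ 2) := by
    by_contra h
    rw [integral_undef h] at hI
    exact hpos.ne hI
  rw [← ofReal_integral_eq_lintegral_ofReal (hint.const_mul _) (ae_of_all _ fun z => by positivity),
    integral_const_mul, hI, ← Real.mul_rpow (by positivity) (by positivity)]
  have : Real.pi * c * (Real.pi / (Real.pi ^ 2 * c)) = 1 := by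
    have := Real.pi_pos
    field_simp
  rw [this, Real.one_rpow, ENNReal.ofReal_one]

open scoped FourierTransform in
/-- If the characteristic function of a probability measure is integrable, so is its Fourier
transform (a multiple of the density). -/
theorem integrable_fourier_charFun (ν : Measure V) [IsProbabilityMeasure ν]
    (hf : Integrable fun w : V => charFun ν ((2 * Real.pi) • w)) :
    Integrable (𝓕 fun w : V => charFun ν ((2 * Real.pi) • w)) := by
  set f : V → ℂ := fun w => charFun ν ((2 * Real.pi) • w) with hfdef
  have hcont : Continuous (𝓕 f) := VectorFourier.fourierIntegral_continuous
    Real.continuous_fourierChar (by exact continuous_inner) hf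
  refine ⟨hcont.aestronglyMeasurable, ?_⟩
  set G : ℝ → V → ℂ := fun c v => Complex.exp (-((c⁻¹ : ℝ) : ℂ) * ‖v‖ ^ 2) with hG
  -- The Fourier integral of f damped by a wide Gaussian. As c grows it tends to 𝓕 f pointwise; as a
  -- convolution of ν with a Gaussian density it has L¹ norm at most 1, and Fatou concludes.
  set p : ℝ → V → ℂ := fun c z => ∫ w, G c w • (Real.fourierChar (-inner ℝ w z) • f w) with hp
  have hfz : ∀ z, Integrable fun w => Real.fourierChar (-inner ℝ w z) • f w := fun z => by
    simpa using! (VectorFourier.fourierIntegral_convergent_iff Real.continuous_fourierChar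
      (L := innerₗ V) continuous_inner z).2 hf
  have hlim : ∀ z, Tendsto (fun n : ℕ => p (n + 1) z) atTop (𝓝 (𝓕 f z)) := by
    intro z
    have h := Real.tendsto_integral_cexp_sq_smul (hfz z)
    have h2 : Tendsto (fun n : ℕ => (n : ℝ) + 1) atTop atTop :=
      tendsto_atTop_add_const_right _ _ tendsto_natCast_atTop_atTop
    have h3 := h.comp h2
    rw [Real.fourier_eq]
    refine h3.congr fun n => ?_
    simp only [hp, hG, Function.comp_apply, Complex.ofReal_inv]
  have hGi : ∀ c, 0 < c → Integrable (G c) := fun c hc => by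
    have := GaussianFourier.integrable_cexp_neg_mul_sq_norm_add (V := V) (b := ((c⁻¹ : ℝ) : ℂ))
      (by rw [Complex.ofReal_re]; positivity) 0 0
    simpa [hG] using this
  have hpe : ∀ c, 0 < c → ∀ z, p c z = ∫ x, 𝓕 (G c) (z - x) ∂ν := by
    intro c hc z
    have hF : Integrable (Function.uncurry fun (w x : V) =>
        Complex.exp ((-2 * Real.pi * inner ℝ w (z - x) : ℝ) * Complex.I) * G c w)
        ((volume : Measure V).prod ν) := by
      refine ((hGi c hc).mul_prod (integrable_const (1 : ℂ))).mono ?_ (ae_of_all _ fun q => ?_)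
      · exact (Continuous.aestronglyMeasurable (by fun_prop))
      · simp only [Function.uncurry, norm_mul, Complex.norm_exp_ofReal_mul_I, one_mul,
          mul_one, le_refl]
    calc p c z = ∫ w, (∫ x, Complex.exp ((-2 * Real.pi * inner ℝ w (z - x) : ℝ) * Complex.I) *
          G c w ∂ν) := by
          refine integral_congr_ae (ae_of_all _ fun w => ?_)
          simp only [hfdef, charFun_apply, Circle.smul_def, Real.fourierChar_apply, smul_eq_mul]
          rw [← integral_const_mul, ← integral_const_mul]
          refine integral_congr_ae (ae_of_all _ fun x => ?_)
          simp only
          rw [mul_comm, ← Complex.exp_add]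
          congr 2
          rw [inner_sub_right, inner_smul_right, real_inner_comm w x]
          push_cast
          ring
      _ = ∫ x, (∫ w, Complex.exp ((-2 * Real.pi * inner ℝ w (z - x) : ℝ) * Complex.I) *
          G c w) ∂ν :=
          integral_integral_swap hF
      _ = _ := by
          refine integral_congr_ae (ae_of_all _ fun x => ?_)
          simp only [Real.fourier_eq', smul_eq_mul]
  have hFGm : ∀ c, 0 < c → Continuous (𝓕 (G c)) := fun c hc =>
    VectorFourier.fourierIntegral_continuous Real.continuous_fourierChar
      (by exact continuous_inner) (hGi c hc)
  have hple : ∀ c, 0 < c → ∫⁻ z, ‖p c z‖ₑ ≤ 1 := by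
    intro c hc
    calc ∫⁻ z, ‖p c z‖ₑ ≤ ∫⁻ z, ∫⁻ x, ‖𝓕 (G c) (z - x)‖ₑ ∂ν := by
          refine lintegral_mono fun z => ?_
          simp only
          rw [hpe c hc]
          exact enorm_integral_le_lintegral_enorm _
      _ = ∫⁻ x, (∫⁻ z, ‖𝓕 (G c) (z - x)‖ₑ) ∂ν := by
          refine lintegral_lintegral_swap ?_
          have := hFGm c hc
          exact (Continuous.measurable (by fun_prop)).aemeasurable
      _ = ∫⁻ x : V, 1 ∂ν := by
          refine lintegral_congr fun x => ?_
          rw [lintegral_sub_right_eq_self (fun z => ‖𝓕 (G c) z‖ₑ) x]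
          exact lintegral_enorm_fourier_gaussian hc
      _ = 1 := by simp
  have hpm : ∀ n : ℕ, Measurable fun z => ‖p (n + 1) z‖ₑ := fun n => by
    have : Continuous (fun z => p (n + 1) z) := by
      have e : (fun z => p (n + 1) z) = 𝓕 fun w => G (n + 1) w * f w := by
        ext z
        rw [Real.fourier_eq]
        refine integral_congr_ae (ae_of_all _ fun w => ?_)
        simp only [smul_eq_mul, Circle.smul_def]; ring
      rw [e]
      refine VectorFourier.fourierIntegral_continuous Real.continuous_fourierChar
        (by exact continuous_inner) ?_
      refine hf.bdd_mul (c := 1) (hGi (n + 1) (by positivity)).1 (ae_of_all _ fun w => ?_)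
      have : -(((n + 1 : ℝ)⁻¹ : ℝ) : ℂ) * ‖w‖ ^ 2 = ((-((n + 1 : ℝ)⁻¹ * ‖w‖ ^ 2) : ℝ) : ℂ) := by
        push_cast; ring
      simp only [hG]
      rw [this, Complex.norm_exp, Complex.ofReal_re]
      exact Real.exp_le_one_iff.2 (neg_nonpos.2 (by positivity))
    exact this.enorm.measurable
  rw [HasFiniteIntegral]
  calc ∫⁻ z, ‖𝓕 f z‖ₑ = ∫⁻ z, liminf (fun n : ℕ => ‖p (n + 1) z‖ₑ) atTop := by
        refine lintegral_congr fun z => ?_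
        exact (((continuous_enorm.tendsto _).comp (hlim z)).liminf_eq).symm
    _ ≤ liminf (fun n : ℕ => ∫⁻ z, ‖p (n + 1) z‖ₑ) atTop := lintegral_liminf_le hpm
    _ ≤ 1 := by
        refine liminf_le_of_le (by isBoundedDefault) fun b hb => ?_
        obtain ⟨n, hn⟩ := hb.exists
        exact hn.trans (hple (n + 1) (by positivity))
    _ < ∞ := ENNReal.one_lt_top

end LevyInversion

/-! ### Transition density and the Fourier transform of the kernel -/

section TransitionDensity

variable {d : ℕ} {α : ℝ} {Ω' : Type*} [MeasurableSpace Ω'] {P' : Measure Ω'}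
  [IsProbabilityMeasure P'] {X : ℝ≥0 → Ω' → Space d} {Ψ : Space d → ℝ}

omit [IsProbabilityMeasure P'] in
theorem IsSymmetricLevyWithExponent.charFun_eq (hX : IsSymmetricLevyWithExponent P' X Ψ)
    (s : ℝ≥0) (ξ : Space d) : charFun (P'.map (X s)) ξ = (Real.exp (-(s * Ψ ξ)) : ℂ) := by
  rw [charFun_apply, integral_map (hX.levy.measurable s).aemeasurable (by fun_prop),
    ← hX.exponent]
  refine integral_congr_ae (ae_of_all _ fun ω => ?_)
  simp only [real_inner_comm (X s ω) ξ, mul_comm]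

/-- The exponent is minus the logarithm of the real, positive and continuous characteristic function
of X₁. -/
theorem IsSymmetricLevyWithExponent.continuous_exponent
    (hX : IsSymmetricLevyWithExponent P' X Ψ) : Continuous Ψ := by
  have := Measure.isProbabilityMeasure_map (hX.levy.measurable 1).aemeasurable (μ := P')
  have h : Continuous fun ξ => Real.exp (-Ψ ξ) := by
    have h1 := Complex.continuous_re.comp (continuous_charFun (μ := P'.map (X 1)))
    refine h1.congr fun ξ => ?_
    rw [Function.comp_apply, hX.charFun_eq, Complex.ofReal_re]; simp
  have h2 := h.log fun ξ => (Real.exp_pos _).ne'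
  simp only [Real.log_exp] at h2
  exact (funext fun ξ => neg_neg (Ψ ξ) : (fun ξ => -(-Ψ ξ)) = Ψ) ▸ h2.neg

omit [IsProbabilityMeasure P'] in
theorem IsSymmetricLevyWithExponent.exponent_neg (hX : IsSymmetricLevyWithExponent P' X Ψ)
    (ξ : Space d) : Ψ (-ξ) = Ψ ξ := by
  have h := charFun_neg (μ := P'.map (X 1)) ξ
  rw [hX.charFun_eq, hX.charFun_eq, Complex.conj_ofReal, Complex.ofReal_inj, Real.exp_eq_exp] at h
  simpa using h

theorem integrable_exp_neg_exponent (hd : 1 ≤ d) (hα : 0 < α) (hc : Continuous Ψ)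
    (hΨ : ExponentComparable Ψ α) {s : ℝ} (hs : 0 < s) :
    Integrable fun ξ => Real.exp (-(s * Ψ ξ)) := by
  obtain ⟨c, C, hc0, hb⟩ := hΨ
  refine ⟨Continuous.aestronglyMeasurable (by fun_prop), ?_⟩
  rw [hasFiniteIntegral_iff_norm]
  -- With kα > d, the bound e^{-y} ≤ k!/y^k gives decay |ξ|^{-kα}, which is integrable at infinity.
  obtain ⟨k, hk⟩ := exists_nat_gt ((d : ℝ) / α)
  rw [div_lt_iff₀ hα] at hk
  set M : ℝ := k.factorial / (s * c) ^ k with hM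
  have hM0 : 0 ≤ M := by positivity
  have hd' : (0 : ℝ) < d := by exact_mod_cast hd
  refine lintegral_lt_top_of_le_norm_rpow volume (by simpa using hd) (p := 0)
    (q := -(k * α)) (C := 1 + M) (by simpa using hd') (by simpa using hk) (fun x _ _ => ?_)
    fun x hx => ?_
  · refine ENNReal.ofReal_le_ofReal ?_
    have h1 : 0 ≤ Ψ x := le_trans (by positivity) (hb x).1
    rw [Real.rpow_zero, mul_one, Real.norm_of_nonneg (Real.exp_pos _).le]
    have : Real.exp (-(s * Ψ x)) ≤ 1 := Real.exp_le_one_iff.2 (neg_nonpos.2 (by positivity))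
    linarith
  · refine ENNReal.ofReal_le_ofReal ?_
    have hx0 : 0 < ‖x‖ := one_pos.trans_le hx
    have hy : 0 < s * (c * ‖x‖ ^ α) := by positivity
    rw [Real.norm_of_nonneg (Real.exp_pos _).le]
    have h1 : Real.exp (-(s * Ψ x)) ≤ Real.exp (-(s * (c * ‖x‖ ^ α))) :=
      Real.exp_le_exp.2 (neg_le_neg (mul_le_mul_of_nonneg_left (hb x).1 hs.le))
    have h2 : Real.exp (-(s * (c * ‖x‖ ^ α))) ≤ M * ‖x‖ ^ (-(k * α)) := by
      have h3 := Real.pow_div_factorial_le_exp _ hy.le k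
      rw [Real.exp_neg, inv_le_comm₀ (Real.exp_pos _) (by positivity)]
      refine le_trans (le_of_eq ?_) h3
      have e : ‖x‖ ^ (k * α) = (‖x‖ ^ α) ^ k := by
        rw [mul_comm, Real.rpow_mul hx0.le, Real.rpow_natCast]
      rw [Real.rpow_neg hx0.le, e, hM]
      field_simp
      exact (mul_pow _ _ _).symm
    have h4 : 0 ≤ ‖x‖ ^ (-(k * α)) := by positivity
    nlinarith

variable (hX : IsSymmetricLevyWithExponent P' X Ψ) (hd : 1 ≤ d) (hα : 0 < α)
  (hΨ : ExponentComparable Ψ α)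
include hX

omit [IsProbabilityMeasure P'] in
open scoped FourierTransform in
theorem transitionDensity_eq_fourier {s : ℝ} (hs : 0 < s) (z : Space d) :
    (transitionDensity Ψ s z : ℂ)
      = 𝓕 (fun w : Space d => (Real.exp (-(s * Ψ ((2 * Real.pi) • w))) : ℂ)) z := by
  have hπ : (2 * Real.pi) ≠ 0 := Real.two_pi_pos.ne'
  set I : ℂ := ∫ ξ : Space d, Complex.exp (-Complex.I * (inner ℝ z ξ : ℝ)) *
    (Real.exp (-(s * Ψ ξ)) : ℂ) with hI
  -- The exponent is even, so ξ ↦ -ξ shows that the integral is real and that taking `.re` in the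
  -- definition loses nothing.
  have hreal : (I.re : ℂ) = I := by
    rw [← Complex.conj_eq_iff_re, hI, ← integral_conj, ← integral_neg_eq_self]
    refine integral_congr_ae (ae_of_all _ fun ξ => ?_)
    simp only [map_mul, Complex.conj_ofReal, ← Complex.exp_conj, hX.exponent_neg, inner_neg_right,
      map_neg, Complex.conj_I]
    push_cast
    ring_nf
  rw [transitionDensity, if_pos hs, Real.fourier_eq']
  have h := Measure.integral_comp_smul (volume : Measure (Space d)) (fun ξ : Space d =>
    Complex.exp (-Complex.I * (inner ℝ z ξ : ℝ)) * (Real.exp (-(s * Ψ ξ)) : ℂ)) (2 * Real.pi)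
  have e : (∫ v : Space d, Complex.exp ((-2 * Real.pi * inner ℝ v z : ℝ) * Complex.I) •
      (Real.exp (-(s * Ψ ((2 * Real.pi) • v))) : ℂ))
      = ∫ v : Space d, Complex.exp (-Complex.I * (inner ℝ z ((2 * Real.pi) • v) : ℝ)) *
        (Real.exp (-(s * Ψ ((2 * Real.pi) • v))) : ℂ) := by
    refine integral_congr_ae (ae_of_all _ fun v => ?_)
    simp only [smul_eq_mul, inner_smul_right, real_inner_comm v z]
    push_cast
    ring_nf
  rw [e, h, ← hI, Complex.ofReal_mul, hreal, Complex.real_smul, finrank_euclideanSpace_fin]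
  congr 2
  rw [abs_of_nonneg (by positivity), Real.rpow_neg Real.two_pi_pos.le, Real.rpow_natCast]

include hd hα hΨ

open scoped FourierTransform in
theorem integrable_transitionDensity {s : ℝ} (hs : 0 < s) :
    Integrable fun z => (transitionDensity Ψ s z : ℂ) := by
  have hm := (hX.levy.measurable ⟨s, hs.le⟩).aemeasurable (μ := P')
  have := Measure.isProbabilityMeasure_map hm
  have h := integrable_fourier_charFun (P'.map (X ⟨s, hs.le⟩))
  have e : (fun w : Space d => charFun (P'.map (X ⟨s, hs.le⟩)) ((2 * Real.pi) • w))
      = fun w => (Real.exp (-(s * Ψ ((2 * Real.pi) • w))) : ℂ) :=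
    funext fun w => hX.charFun_eq _ _
  rw [e] at h
  simp only [transitionDensity_eq_fourier hX hs]
  refine h ?_
  have h2 := (integrable_exp_neg_exponent hd hα hX.continuous_exponent hΨ hs).ofReal (𝕜 := ℂ)
  exact h2.comp_smul Real.two_pi_pos.ne'

open scoped FourierTransform in
-- Fourier inversion. It requires the density itself to be integrable, which is the purpose of the
-- L¹ argument for characteristic functions.
theorem spaceFT_transitionDensity {s : ℝ} (hs : 0 < s) (ξ : Space d) :
    spaceFT (transitionDensity Ψ s) ξ = (Real.exp (-(s * Ψ ξ)) : ℂ) := by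
  have hi := integrable_transitionDensity hX hd hα hΨ hs
  have hcont := hX.continuous_exponent
  simp only [transitionDensity_eq_fourier hX hs] at hi
  have h2 := (integrable_exp_neg_exponent hd hα hcont hΨ hs).ofReal (𝕜 := ℂ)
  have hinv := Continuous.fourierInv_fourier_eq
    (f := fun w : Space d => (Real.exp (-(s * Ψ ((2 * Real.pi) • w))) : ℂ)) (by fun_prop)
    (h2.comp_smul Real.two_pi_pos.ne') hi
  have h3 := congrFun hinv (-((2 * Real.pi)⁻¹ • ξ))
  rw [Real.fourierInv_eq_fourier_neg, neg_neg] at h3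
  rw [spaceFT_eq_fourier]
  simp only [transitionDensity_eq_fourier hX hs]
  refine h3.trans ?_
  rw [smul_neg, smul_smul, mul_inv_cancel₀ Real.two_pi_pos.ne', one_smul, hX.exponent_neg]

theorem integrable_exp_mul_transitionDensity (s : ℝ) (x ξ : Space d) :
    Integrable fun y => Complex.exp (-Complex.I * (inner ℝ ξ y : ℝ)) *
      (transitionDensity Ψ s (x - y) : ℂ) := by
  by_cases hs : 0 < s
  · have h := (integrable_transitionDensity hX hd hα hΨ hs).comp_sub_left x
    refine h.bdd_mul (c := 1) (Continuous.aestronglyMeasurable (by fun_prop))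
      (ae_of_all _ fun y => ?_)
    rw [norm_exp_neg_I_mul]
  · simp [transitionDensity, hs]

theorem spaceFT_transitionDensity_sub (s : ℝ) (x ξ : Space d) :
    spaceFT (fun y => transitionDensity Ψ s (x - y)) ξ
      = if 0 < s then Complex.exp (-Complex.I * (inner ℝ ξ x : ℝ)) *
        (Real.exp (-(s * Ψ ξ)) : ℂ) else 0 := by
  by_cases hs : 0 < s
  · rw [if_pos hs, ← hX.exponent_neg ξ, ← spaceFT_transitionDensity hX hd hα hΨ hs, spaceFT,
      spaceFT, ← integral_const_mul, ← integral_sub_left_eq_self _ volume x]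
    refine integral_congr_ae (ae_of_all _ fun y => ?_)
    simp only [sub_sub_cancel]
    rw [← mul_assoc, ← Complex.exp_add, inner_sub_right, inner_neg_left]
    congr 2
    push_cast; ring
  · simp [transitionDensity, hs, spaceFT]

theorem spaceFT_pinnedKernel (b : Space d) (t : ℝ) (x : Space d) (u : ℝ) (ξ : Space d) :
    spaceFT (pinnedKernel Ψ b t x u) ξ
      = Complex.exp (-Complex.I * (inner ℝ ξ x : ℝ)) *
          (Set.Iio t).indicator (fun u => (Real.exp (-((t - u) * Ψ ξ)) : ℂ)) u
        - Complex.exp (-Complex.I * (inner ℝ ξ b : ℝ)) *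
          (Set.Iio 0).indicator (fun u => (Real.exp (-((0 - u) * Ψ ξ)) : ℂ)) u := by
  have key : ∀ (t : ℝ) (x : Space d),
      (if 0 < max (t - u) 0 then Complex.exp (-Complex.I * (inner ℝ ξ x : ℝ)) *
        (Real.exp (-(max (t - u) 0 * Ψ ξ)) : ℂ) else 0)
      = Complex.exp (-Complex.I * (inner ℝ ξ x : ℝ)) *
          (Set.Iio t).indicator (fun u => (Real.exp (-((t - u) * Ψ ξ)) : ℂ)) u := by
    intro t x
    by_cases h : u < t
    · have h' : 0 < t - u := sub_pos.2 h
      rw [max_eq_left h'.le, if_pos h', Set.indicator_of_mem (by exact h)]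
    · have h' : t - u ≤ 0 := sub_nonpos.2 (not_lt.1 h)
      rw [max_eq_right h', if_neg (lt_irrefl _), Set.indicator_of_notMem (by exact h), mul_zero]
  rw [← key t x, ← key 0 b, ← spaceFT_transitionDensity_sub hX hd hα hΨ,
    ← spaceFT_transitionDensity_sub hX hd hα hΨ, spaceFT, spaceFT, spaceFT, ← integral_sub
      (integrable_exp_mul_transitionDensity hX hd hα hΨ _ x ξ)
      (integrable_exp_mul_transitionDensity hX hd hα hΨ _ b ξ)]
  refine integral_congr_ae (ae_of_all _ fun y => ?_)
  simp only [pinnedKernel, zero_sub]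
  push_cast
  ring

/-- In time, the integral of e^{-iτu} e^{-(t-u)Ψ(ξ)} over u < t is e^{-iτt}/(Ψ(ξ) - iτ). It
converges since Ψ(ξ) > 0, and this is where ξ ≠ 0 enters. -/
theorem spaceTimeFT_pinnedKernel (b : Space d) (t : ℝ) (x : Space d) (τ : ℝ) {ξ : Space d}
    (hξ : ξ ≠ 0) :
    spaceTimeFT (pinnedKernel Ψ b t x) τ ξ
      = (Complex.exp (-Complex.I * (τ * t + inner ℝ ξ x : ℝ)) -
          Complex.exp (-Complex.I * (inner ℝ ξ b : ℝ))) / (Ψ ξ - Complex.I * τ) := by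
  obtain ⟨c, C, hc0, hb⟩ := id hΨ
  have hΨ0 : 0 < Ψ ξ := lt_of_lt_of_le (by have := norm_pos_iff.2 hξ; positivity) (hb ξ).1
  set a : ℂ := Ψ ξ - Complex.I * τ with ha
  have hare : 0 < a.re := by simpa [ha] using hΨ0
  have ha0 : a ≠ 0 := fun h => by simp [h] at hare
  have e : ∀ (t u : ℝ), Complex.exp (-Complex.I * (τ * u : ℝ)) *
      (Set.Iio t).indicator (fun u => (Real.exp (-((t - u) * Ψ ξ)) : ℂ)) u
      = Complex.exp (-(t * Ψ ξ)) * (Set.Iio t).indicator (fun u : ℝ => Complex.exp (a * u)) u := by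
    intro t u
    by_cases h : u ∈ Set.Iio t
    · rw [Set.indicator_of_mem h, Set.indicator_of_mem h, Complex.ofReal_exp, ← Complex.exp_add,
        ← Complex.exp_add, ha]
      congr 1; push_cast; ring
    · rw [Set.indicator_of_notMem h, Set.indicator_of_notMem h, mul_zero, mul_zero]
  have hi : ∀ t : ℝ, Integrable fun u : ℝ => Complex.exp (-Complex.I * (τ * u : ℝ)) *
      (Set.Iio t).indicator (fun u => (Real.exp (-((t - u) * Ψ ξ)) : ℂ)) u := by
    intro t
    simp only [e]
    refine Integrable.const_mul ?_ _
    rw [integrable_indicator_iff measurableSet_Iio]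
    exact (integrableOn_exp_mul_complex_Iic hare t).mono_set Set.Iio_subset_Iic_self
  have hv : ∀ t : ℝ, ∫ u : ℝ, Complex.exp (-Complex.I * (τ * u : ℝ)) *
      (Set.Iio t).indicator (fun u => (Real.exp (-((t - u) * Ψ ξ)) : ℂ)) u
      = Complex.exp (-Complex.I * (τ * t : ℝ)) / a := by
    intro t
    simp only [e]
    rw [integral_const_mul, integral_indicator measurableSet_Iio, ← integral_Iic_eq_integral_Iio,
      integral_exp_mul_complex_Iic hare, ← mul_div_assoc, ← Complex.exp_add, ha]
    congr 2; push_cast; ring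
  have h := integral_sub ((hi t).const_mul (Complex.exp (-Complex.I * (inner ℝ ξ x : ℝ))))
    ((hi 0).const_mul (Complex.exp (-Complex.I * (inner ℝ ξ b : ℝ))))
  rw [integral_const_mul, integral_const_mul, hv, hv] at h
  rw [spaceTimeFT]
  simp only [spaceFT_pinnedKernel hX hd hα hΨ]
  have h' : (Complex.exp (-Complex.I * (τ * t + inner ℝ ξ x : ℝ)) -
      Complex.exp (-Complex.I * (inner ℝ ξ b : ℝ))) / a
      = Complex.exp (-Complex.I * (inner ℝ ξ x : ℝ)) *
        (Complex.exp (-Complex.I * (τ * t : ℝ)) / a) -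
        Complex.exp (-Complex.I * (inner ℝ ξ b : ℝ)) *
        (Complex.exp (-Complex.I * (τ * 0 : ℝ)) / a) := by
    rw [mul_div_assoc', mul_div_assoc', ← sub_div, ← Complex.exp_add, ← Complex.exp_add]
    congr 3
    · push_cast; ring
    · push_cast; ring
  rw [h', ← h]
  refine integral_congr_ae (ae_of_all _ fun u => ?_)
  simp only
  ring

omit hd hα hΨ in
theorem measurable_pinnedKernel (b : Space d) (t : ℝ) (x : Space d) :
    Measurable (Function.uncurry (pinnedKernel Ψ b t x)) := by
  have hΨm := hX.continuous_exponent.measurable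
  have hT : Measurable fun q : ℝ × Space d => transitionDensity Ψ q.1 q.2 := by
    unfold transitionDensity
    refine Measurable.ite (measurableSet_lt measurable_const measurable_fst) ?_ measurable_const
    have h1 : Measurable fun q : (ℝ × Space d) × Space d =>
        Complex.exp (-Complex.I * (inner ℝ q.1.2 q.2 : ℝ)) := Continuous.measurable (by fun_prop)
    have h2 : Measurable fun q : (ℝ × Space d) × Space d =>
        (Real.exp (-(q.1.1 * Ψ q.2)) : ℂ) := by fun_prop
    have h3 := (h1.mul h2).stronglyMeasurable.integral_prod_right' (ν := (volume :
      Measure (Space d)))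
    exact (Complex.measurable_re.comp h3.measurable).const_mul _
  have h1 : Measurable fun q : ℝ × Space d => (max (t - q.1) 0, x - q.2) := by fun_prop
  have h2 : Measurable fun q : ℝ × Space d => (max (-q.1) 0, b - q.2) := by fun_prop
  exact (hT.comp h1).sub (hT.comp h2)

end TransitionDensity

/-! ### Homogeneity of integrals -/

section Scaling

/-- The source of the power laws below: dilating the variable reduces an integral with a parameter
to a fixed one, and the exponent is read off from homogeneity. -/
theorem lintegral_eq_of_comp_smul {E : Type*} [NormedAddCommGroup E] [NormedSpace ℝ E]
    [FiniteDimensional ℝ E] [MeasurableSpace E] [BorelSpace E] (ν : Measure E)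
    [ν.IsAddHaarMeasure] [Nontrivial E] {f g : E → ℝ≥0∞} {a c : ℝ} (ha : 0 < a)
    (h : ∀ x, x ≠ 0 → f (a • x) = ENNReal.ofReal c * g x) :
    ∫⁻ x, f x ∂ν = ENNReal.ofReal (a ^ (Module.finrank ℝ E : ℝ) * c) * ∫⁻ x, g x ∂ν := by
  have h1 := lintegral_comp_smul_addHaar ν f ha.ne'
  have hne : ∀ᵐ x ∂ν, x ≠ (0 : E) := by simp [ae_iff]
  have h2 : ∫⁻ x, f (a • x) ∂ν = ENNReal.ofReal c * ∫⁻ x, g x ∂ν := by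
    rw [← lintegral_const_mul' _ _ ENNReal.ofReal_ne_top]
    refine lintegral_congr_ae ?_
    filter_upwards [hne] with x hx using h x hx
  rw [h2, abs_of_nonneg (by positivity)] at h1
  have ha' : 0 < a ^ (Module.finrank ℝ E : ℝ) := by positivity
  rw [ENNReal.ofReal_mul ha'.le, mul_assoc, h1, ← mul_assoc, ← ENNReal.ofReal_mul ha'.le,
    Real.rpow_natCast, mul_inv_cancel₀ (by positivity), ENNReal.ofReal_one, one_mul]

theorem lintegral_eq_of_comp_mul {f g : ℝ → ℝ≥0∞} {a c : ℝ} (ha : 0 < a)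
    (h : ∀ x, x ≠ 0 → f (a * x) = ENNReal.ofReal c * g x) :
    ∫⁻ x, f x = ENNReal.ofReal (a * c) * ∫⁻ x, g x := by
  have := lintegral_eq_of_comp_smul volume ha h
  simpa using this

end Scaling

/-! ### Integrals of the spectral weight -/

section UpperIntegrals

/-- The (squared) frequency weight of the field. -/
noncomputable def spectralWeight {d : ℕ} (H α β τ : ℝ) (ξ : Space d) : ℝ :=
  |τ| ^ (1 - 2 * H) * (‖ξ‖ ^ (-β) / (‖ξ‖ ^ (2 * α) + τ ^ 2))

variable {d : ℕ} {H α β : ℝ}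

theorem spectralWeight_nonneg (τ : ℝ) (ξ : Space d) : 0 ≤ spectralWeight H α β τ ξ := by
  unfold spectralWeight; positivity

theorem measurable_spectralWeight :
    Measurable fun p : Space d × ℝ => spectralWeight H α β p.2 p.1 := by
  unfold spectralWeight
  have h : Measurable fun p : Space d × ℝ => |p.2| ^ (1 - 2 * H) :=
    (continuous_abs.measurable.comp measurable_snd).pow_const _
  fun_prop

theorem nontrivial_space (hd : 1 ≤ d) : Nontrivial (Space d) :=
  Module.nontrivial_of_finrank_pos (R := ℝ) (by rw [finrank_euclideanSpace_fin]; omega)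

/-- Substitute ξ = |τ|^{1/α} η. The remaining integral converges at 0 because β < d and at infinity
because β + 2α > d. -/
theorem lintegral_space_resolvent (hd : 1 ≤ d) (hα : 0 < α) (hβ' : β < d)
    (hβ'' : d - 2 * α < β) :
    ∃ K : ℝ, 0 ≤ K ∧ ∀ τ : ℝ, τ ≠ 0 →
      ∫⁻ ξ : Space d, ENNReal.ofReal (‖ξ‖ ^ (-β) / (‖ξ‖ ^ (2 * α) + τ ^ 2))
        = ENNReal.ofReal (K * |τ| ^ ((d - β) / α - 2)) := by
  have := nontrivial_space hd
  set I : ℝ≥0∞ := ∫⁻ ξ : Space d, ENNReal.ofReal (‖ξ‖ ^ (-β) / (‖ξ‖ ^ (2 * α) + 1)) with hI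
  have hfin : I < ∞ := by
    refine lintegral_lt_top_of_le_norm_rpow volume (by simpa using hd) (p := -β)
      (q := -β - 2 * α) (C := 1) (by simpa using hβ') (by
        rw [finrank_euclideanSpace_fin]; linarith) (fun x _ _ => ?_) fun x hx => ?_
    · rw [one_mul]
      refine ENNReal.ofReal_le_ofReal (div_le_self (by positivity) ?_)
      linarith [show 0 ≤ ‖x‖ ^ (2 * α) by positivity]
    · have hx0 : 0 < ‖x‖ := one_pos.trans_le hx
      rw [one_mul, Real.rpow_sub hx0]
      refine ENNReal.ofReal_le_ofReal ?_
      gcongr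
      linarith
  refine ⟨I.toReal, ENNReal.toReal_nonneg, fun τ hτ => ?_⟩
  have hτ' : 0 < |τ| := abs_pos.2 hτ
  have h := lintegral_eq_of_comp_smul (volume : Measure (Space d))
    (f := fun ξ => ENNReal.ofReal (‖ξ‖ ^ (-β) / (‖ξ‖ ^ (2 * α) + τ ^ 2)))
    (g := fun ξ => ENNReal.ofReal (‖ξ‖ ^ (-β) / (‖ξ‖ ^ (2 * α) + 1)))
    (a := |τ| ^ (1 / α)) (c := |τ| ^ (-β / α - 2)) (by positivity) (fun x hx => ?_)
  · rw [h, ← hI, mul_comm, ENNReal.ofReal_mul ENNReal.toReal_nonneg,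
      ENNReal.ofReal_toReal hfin.ne, finrank_euclideanSpace_fin, ← Real.rpow_mul hτ'.le,
      ← Real.rpow_add hτ']
    congr 3
    field_simp
    ring
  · have hx' : 0 < ‖x‖ := norm_pos_iff.2 hx
    rw [← ENNReal.ofReal_mul (by positivity), norm_smul, Real.norm_of_nonneg (by positivity),
      Real.mul_rpow (by positivity) hx'.le, Real.mul_rpow (by positivity) hx'.le,
      ← Real.rpow_mul hτ'.le, ← Real.rpow_mul hτ'.le]
    congr 1
    rw [show 1 / α * -β = -β / α by ring, show 1 / α * (2 * α) = 2 by field_simp,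
      Real.rpow_sub hτ', Real.rpow_two, ← sq_abs τ]
    field_simp

theorem lintegral_time_resolvent (hH : 1 / 2 < H) (hH' : H < 1) :
    ∃ K : ℝ, 0 ≤ K ∧ ∀ a : ℝ, 0 < a →
      ∫⁻ τ : ℝ, ENNReal.ofReal (|τ| ^ (1 - 2 * H) / (a ^ 2 + τ ^ 2))
        = ENNReal.ofReal (K * a ^ (-(2 * H))) := by
  set I : ℝ≥0∞ := ∫⁻ τ : ℝ, ENNReal.ofReal (|τ| ^ (1 - 2 * H) / (1 + τ ^ 2)) with hI
  have hfin : I < ∞ := by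
    refine lintegral_lt_top_of_le_norm_rpow volume (by simp) (p := 1 - 2 * H)
      (q := -1 - 2 * H) (C := 1) (by simp; linarith) (by simp; linarith) (fun x _ _ => ?_)
      fun x hx => ?_
    · rw [one_mul]
      refine ENNReal.ofReal_le_ofReal (div_le_self (by positivity) ?_)
      nlinarith [sq_nonneg x]
    · have hx0 : 0 < ‖x‖ := one_pos.trans_le hx
      rw [one_mul, show -1 - 2 * H = (1 - 2 * H) - 2 by ring, Real.rpow_sub hx0, Real.rpow_two,
        Real.norm_eq_abs, sq_abs]
      have hx2 : 0 < x ^ 2 := by rw [← sq_abs]; positivity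
      refine ENNReal.ofReal_le_ofReal ?_
      gcongr
      linarith
  refine ⟨I.toReal, ENNReal.toReal_nonneg, fun a ha => ?_⟩
  have h := lintegral_eq_of_comp_mul
    (f := fun τ => ENNReal.ofReal (|τ| ^ (1 - 2 * H) / (a ^ 2 + τ ^ 2)))
    (g := fun τ => ENNReal.ofReal (|τ| ^ (1 - 2 * H) / (1 + τ ^ 2)))
    (a := a) (c := a ^ (-1 - 2 * H)) ha (fun x hx => ?_)
  · rw [h, ← hI, mul_comm, ENNReal.ofReal_mul ENNReal.toReal_nonneg,
      ENNReal.ofReal_toReal hfin.ne]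
    congr 2
    nth_rewrite 1 [← Real.rpow_one a]
    rw [← Real.rpow_add ha]
    congr 1; ring
  · rw [← ENNReal.ofReal_mul (by positivity), abs_mul, abs_of_pos ha,
      Real.mul_rpow ha.le (abs_nonneg x), show -1 - 2 * H = (1 - 2 * H) - 2 by ring,
      Real.rpow_sub ha (1 - 2 * H) 2, Real.rpow_two]
    congr 1
    field_simp

/-- Truncated homogeneous integrals: `∫ ‖x‖^{-dim-2h} min(4, ‖x‖² r²) dx = K r^{2h}`. -/
theorem lintegral_homogeneous_min {E : Type*} [NormedAddCommGroup E] [NormedSpace ℝ E]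
    [FiniteDimensional ℝ E] [MeasurableSpace E] [BorelSpace E] (ν : Measure E)
    [ν.IsAddHaarMeasure] (hd : 1 ≤ Module.finrank ℝ E) {h : ℝ} (h0 : 0 < h) (h1 : h < 1) :
    ∃ K : ℝ, 0 ≤ K ∧ ∀ r : ℝ, 0 ≤ r →
      ∫⁻ x, ENNReal.ofReal (‖x‖ ^ (-(Module.finrank ℝ E : ℝ) - 2 * h) *
        min 4 (‖x‖ ^ 2 * r ^ 2)) ∂ν = ENNReal.ofReal (K * r ^ (2 * h)) := by
  have : Nontrivial E := Module.nontrivial_of_finrank_pos (R := ℝ) hd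
  set n : ℝ := (Module.finrank ℝ E : ℝ) with hn
  set I : ℝ≥0∞ := ∫⁻ x, ENNReal.ofReal (‖x‖ ^ (-n - 2 * h) * min 4 (‖x‖ ^ 2)) ∂ν with hI
  have hfin : I < ∞ := by
    refine lintegral_lt_top_of_le_norm_rpow ν hd (p := -n - 2 * h + 2)
      (q := -n - 2 * h) (C := 4) (by linarith) (by linarith) (fun x hx0 _ => ?_) fun x hx => ?_
    · have hx' : 0 < ‖x‖ := norm_pos_iff.2 hx0
      refine ENNReal.ofReal_le_ofReal ?_
      rw [Real.rpow_add hx', Real.rpow_two]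
      calc _ ≤ ‖x‖ ^ (-n - 2 * h) * ‖x‖ ^ 2 := by gcongr; exact min_le_right _ _
        _ ≤ _ := by
          have : 0 ≤ ‖x‖ ^ (-n - 2 * h) * ‖x‖ ^ 2 := by positivity
          linarith
    · rw [mul_comm 4]
      refine ENNReal.ofReal_le_ofReal ?_
      gcongr
      exact min_le_left _ _
  refine ⟨I.toReal, ENNReal.toReal_nonneg, fun r hr => ?_⟩
  rcases hr.eq_or_lt with rfl | hr
  · rw [Real.zero_rpow (by positivity)]
    simp
  have h := lintegral_eq_of_comp_smul ν
    (f := fun x => ENNReal.ofReal (‖x‖ ^ (-n - 2 * h) * min 4 (‖x‖ ^ 2 * r ^ 2)))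
    (g := fun x => ENNReal.ofReal (‖x‖ ^ (-n - 2 * h) * min 4 (‖x‖ ^ 2)))
    (a := r⁻¹) (c := r ^ (n + 2 * h)) (by positivity) (fun x hx => ?_)
  · rw [h, ← hI, mul_comm, ENNReal.ofReal_mul ENNReal.toReal_nonneg,
      ENNReal.ofReal_toReal hfin.ne, Real.inv_rpow hr.le, ← Real.rpow_neg hr.le,
      ← Real.rpow_add hr]
    congr 3; ring
  · rw [← ENNReal.ofReal_mul (by positivity), norm_smul, norm_inv, Real.norm_of_nonneg hr.le,
      Real.mul_rpow (by positivity) (norm_nonneg _), Real.inv_rpow hr.le, ← Real.rpow_neg hr.le,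
      show -(-n - 2 * h) = n + 2 * h by ring, mul_assoc]
    congr 4
    field_simp

variable (hd : 1 ≤ d) (hH : 1 / 2 < H) (hH' : H < 1) (hα : 0 < α) (hβ' : β < d)
  (hβ'' : d - 2 * α * H < β)
include hd hH hH' hα hβ' hβ''

omit hH in
-- Integrate over ξ first. The exponent of |τ| becomes 1 - 2H + (d-β)/α - 2 = -1 - 2H₁, and 0 < H₁ <
-- 1 makes the truncated homogeneous integral converge.
theorem lintegral_spectralWeight_time :
    ∃ K : ℝ, 0 ≤ K ∧ ∀ h : ℝ, 0 ≤ h →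
      ∫⁻ ξ : Space d, ∫⁻ τ : ℝ, ENNReal.ofReal (spectralWeight H α β τ ξ *
        min 4 (τ ^ 2 * h ^ 2)) ≤ ENNReal.ofReal (K * h ^ (2 * (H - (d - β) / (2 * α)))) := by
  obtain ⟨K₁, hK₁, h₁⟩ := lintegral_space_resolvent hd hα hβ'
    (lt_of_le_of_lt (by nlinarith) hβ'')
  have hpos : 0 < H - (d - β) / (2 * α) := by
    rw [sub_pos, div_lt_iff₀ (by positivity)]; linarith
  have hlt : H - (d - β) / (2 * α) < 1 := by
    have : 0 < (d - β) / (2 * α) := by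
      have : 0 < (d : ℝ) - β := by linarith
      positivity
    linarith
  obtain ⟨K₂, hK₂, h₂⟩ := lintegral_homogeneous_min (volume : Measure ℝ) (by simp) hpos hlt
  refine ⟨K₁ * K₂, by positivity, fun h hh => le_of_eq ?_⟩
  have hm : Measurable fun p : Space d × ℝ =>
      ENNReal.ofReal (spectralWeight H α β p.2 p.1 * min 4 (p.2 ^ 2 * h ^ 2)) :=
    (measurable_spectralWeight.mul (by fun_prop)).ennreal_ofReal
  rw [lintegral_lintegral_swap hm.aemeasurable, mul_assoc, ENNReal.ofReal_mul hK₁, ← h₂ h hh,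
    ← lintegral_const_mul' _ _ ENNReal.ofReal_ne_top]
  have hne : ∀ᵐ τ : ℝ, τ ≠ 0 := by simp [ae_iff]
  refine lintegral_congr_ae ?_
  filter_upwards [hne] with τ hτ
  have hτ' : 0 < |τ| := abs_pos.2 hτ
  have e : ∀ ξ : Space d, ENNReal.ofReal (spectralWeight H α β τ ξ * min 4 (τ ^ 2 * h ^ 2))
      = ENNReal.ofReal (|τ| ^ (1 - 2 * H) * min 4 (τ ^ 2 * h ^ 2)) *
        ENNReal.ofReal (‖ξ‖ ^ (-β) / (‖ξ‖ ^ (2 * α) + τ ^ 2)) := by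
    intro ξ
    rw [← ENNReal.ofReal_mul (by positivity), spectralWeight]
    congr 1; ring
  simp only [e]
  rw [lintegral_const_mul' _ _ ENNReal.ofReal_ne_top, h₁ τ hτ, ← ENNReal.ofReal_mul (by positivity),
    ← ENNReal.ofReal_mul hK₁, Real.norm_eq_abs, sq_abs]
  congr 1
  have : |τ| ^ (-((Module.finrank ℝ ℝ : ℕ) : ℝ) - 2 * (H - (d - β) / (2 * α)))
      = |τ| ^ (1 - 2 * H) * |τ| ^ ((d - β) / α - 2) := by
    rw [← Real.rpow_add hτ']
    congr 1
    simp only [Module.finrank_self, Nat.cast_one]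
    field_simp
    ring
  rw [this]; ring

omit hd hα hβ' hβ'' in
theorem lintegral_spectralWeight_fiber :
    ∃ K : ℝ, 0 ≤ K ∧ ∀ ξ : Space d, ξ ≠ 0 →
      ∫⁻ τ : ℝ, ENNReal.ofReal (spectralWeight H α β τ ξ)
        = ENNReal.ofReal (K * ‖ξ‖ ^ (-β - 2 * (α * H))) := by
  obtain ⟨K₁, hK₁, h₁⟩ := lintegral_time_resolvent hH hH'
  refine ⟨K₁, hK₁, fun ξ hξ => ?_⟩
  have hξ' : 0 < ‖ξ‖ := norm_pos_iff.2 hξ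
  have e : ∀ τ : ℝ, ENNReal.ofReal (spectralWeight H α β τ ξ)
      = ENNReal.ofReal (‖ξ‖ ^ (-β)) *
        ENNReal.ofReal (|τ| ^ (1 - 2 * H) / ((‖ξ‖ ^ α) ^ 2 + τ ^ 2)) := by
    intro τ
    rw [← ENNReal.ofReal_mul (by positivity), spectralWeight, mul_comm 2 α, Real.rpow_mul hξ'.le,
      Real.rpow_two]
    congr 1; ring
  simp only [e]
  rw [lintegral_const_mul' _ _ ENNReal.ofReal_ne_top, h₁ _ (by positivity),
    ← ENNReal.ofReal_mul (by positivity), ← Real.rpow_mul hξ'.le]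
  congr 1
  rw [sub_eq_add_neg, Real.rpow_add hξ']
  rw [show α * -(2 * H) = -(2 * (α * H)) by ring]
  ring

omit hβ' in
-- Integrate over τ first. The fiber integral is a multiple of |ξ|^{-β-2αH} = |ξ|^{-d-2H₂};
-- convergence at low frequencies after truncation is what needs H₂ < 1.
theorem lintegral_spectralWeight_space (hlt : α * (H - (d - β) / (2 * α)) < 1) :
    ∃ K : ℝ, 0 ≤ K ∧ ∀ r : ℝ, 0 ≤ r →
      ∫⁻ ξ : Space d, ∫⁻ τ : ℝ, ENNReal.ofReal (spectralWeight H α β τ ξ *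
        min 4 (‖ξ‖ ^ 2 * r ^ 2))
        ≤ ENNReal.ofReal (K * r ^ (2 * (α * (H - (d - β) / (2 * α))))) := by
  have := nontrivial_space hd
  obtain ⟨K₁, hK₁, h₁⟩ := lintegral_spectralWeight_fiber (d := d) (α := α) (β := β) hH hH'
  have hpos : 0 < α * (H - (d - β) / (2 * α)) := by
    refine mul_pos hα ?_
    rw [sub_pos, div_lt_iff₀ (by positivity)]; linarith
  obtain ⟨K₂, hK₂, h₂⟩ := lintegral_homogeneous_min (volume : Measure (Space d))
    (by simpa using hd) hpos hlt
  refine ⟨K₁ * K₂, by positivity, fun r hr => le_of_eq ?_⟩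
  rw [mul_assoc, ENNReal.ofReal_mul hK₁, ← h₂ r hr,
    ← lintegral_const_mul' _ _ ENNReal.ofReal_ne_top]
  have hne : ∀ᵐ ξ : Space d, ξ ≠ 0 := by simp [ae_iff]
  refine lintegral_congr_ae ?_
  filter_upwards [hne] with ξ hξ
  have hξ' : 0 < ‖ξ‖ := norm_pos_iff.2 hξ
  simp only [ENNReal.ofReal_mul (spectralWeight_nonneg _ ξ)]
  rw [lintegral_mul_const' _ _ ENNReal.ofReal_ne_top, h₁ ξ hξ, ← ENNReal.ofReal_mul (by positivity),
    ← ENNReal.ofReal_mul hK₁, finrank_euclideanSpace_fin]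
  have : -(d : ℝ) - 2 * (α * (H - (d - β) / (2 * α))) = -β - 2 * (α * H) := by
    field_simp; ring
  rw [this, mul_assoc]

omit hd hα hβ' hβ'' in
-- Discarding |ξ|^{2α} from the denominator leaves |τ|^{-1-2H} min(4, τ²T²), integrable in τ and
-- free of ξ. This replaces the fiber bound at low frequencies, where |ξ|^{-β} is less singular.
theorem lintegral_spectralWeight_fiber_min (T : ℝ) :
    ∃ D : ℝ, 0 ≤ D ∧ ∀ ξ : Space d,
      ∫⁻ τ : ℝ, ENNReal.ofReal (spectralWeight H α β τ ξ * min 4 (τ ^ 2 * T ^ 2))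
        ≤ ENNReal.ofReal (D * ‖ξ‖ ^ (-β)) := by
  set I : ℝ≥0∞ := ∫⁻ τ : ℝ, ENNReal.ofReal
    (|τ| ^ (1 - 2 * H) / τ ^ 2 * min 4 (τ ^ 2 * T ^ 2)) with hI
  have hfin : I < ∞ := by
    refine lintegral_lt_top_of_le_norm_rpow volume (by simp) (p := 1 - 2 * H)
      (q := -1 - 2 * H) (C := 4 + T ^ 2) (by simp; linarith) (by simp; linarith)
      (fun x hx0 _ => ?_) fun x hx => ?_
    · refine ENNReal.ofReal_le_ofReal ?_
      have hx2 : 0 < x ^ 2 := by positivity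
      calc _ ≤ |x| ^ (1 - 2 * H) / x ^ 2 * (x ^ 2 * T ^ 2) := by gcongr; exact min_le_right _ _
        _ = T ^ 2 * |x| ^ (1 - 2 * H) := by field_simp
        _ ≤ _ := by
          rw [Real.norm_eq_abs]
          gcongr
          linarith
    · have hx0 : 0 < ‖x‖ := one_pos.trans_le hx
      refine ENNReal.ofReal_le_ofReal ?_
      rw [show -1 - 2 * H = (1 - 2 * H) - 2 by ring, Real.rpow_sub hx0, Real.rpow_two,
        Real.norm_eq_abs, sq_abs]
      calc _ ≤ |x| ^ (1 - 2 * H) / x ^ 2 * 4 := by gcongr; exact min_le_left _ _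
        _ ≤ |x| ^ (1 - 2 * H) / x ^ 2 * (4 + T ^ 2) := by gcongr; nlinarith [sq_nonneg T]
        _ = _ := mul_comm _ _
  refine ⟨I.toReal, ENNReal.toReal_nonneg, fun ξ => ?_⟩
  rw [mul_comm, ENNReal.ofReal_mul (by positivity), ENNReal.ofReal_toReal hfin.ne, hI,
    ← lintegral_const_mul' _ _ ENNReal.ofReal_ne_top]
  have hne : ∀ᵐ τ : ℝ, τ ≠ 0 := by simp [ae_iff]
  refine lintegral_mono_ae ?_
  filter_upwards [hne] with τ hτ
  rw [← ENNReal.ofReal_mul (by positivity), spectralWeight]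
  refine ENNReal.ofReal_le_ofReal ?_
  have hτ2 : 0 < τ ^ 2 := by positivity
  have hmin : 0 ≤ min 4 (τ ^ 2 * T ^ 2) := by positivity
  calc _ ≤ |τ| ^ (1 - 2 * H) * (‖ξ‖ ^ (-β) / τ ^ 2) * min 4 (τ ^ 2 * T ^ 2) := by
        gcongr
        linarith [show 0 ≤ ‖ξ‖ ^ (2 * α) by positivity]
    _ = _ := by ring

end UpperIntegrals

/-! ### Spatial modulus when H₂ ≥ 1 -/

section SmoothRegime

variable {d : ℕ} {H α β : ℝ}

/-- For r < 1, cut at |ξ| = 1/r. Below it the integrand is at most r²|ξ|^{-d}, whose shell mass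
gives r² log(1/r); above it the constant 4 gives a multiple of r². For r ≥ 1 the whole tail is
bounded by a constant. -/
theorem exists_lintegral_critical_tail_le (hd : 1 ≤ d) :
    ∃ K : ℝ, 0 ≤ K ∧ ∀ r : ℝ, 0 < r →
      ∫⁻ ξ : Space d, (if 1 ≤ ‖ξ‖ then
        ENNReal.ofReal (‖ξ‖ ^ (-(d : ℝ) - 2) * min 4 (‖ξ‖ ^ 2 * r ^ 2)) else 0)
        ≤ ENNReal.ofReal (K * (r ^ 2 * max 1 |Real.log r|)) := by
  have := nontrivial_space hd
  set T : ℝ≥0∞ := ∫⁻ ξ : Space d, (if 1 ≤ ‖ξ‖ then ENNReal.ofReal (‖ξ‖ ^ (-(d : ℝ) - 2)) else 0)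
    with hT
  have hTfin : T < ∞ := by
    refine lintegral_lt_top_of_le_norm_rpow volume (by simpa using hd) (p := 0)
      (q := -(d : ℝ) - 2) (C := 1)
      (by rw [finrank_euclideanSpace_fin]; have : (0 : ℝ) < d := by exact_mod_cast hd
          linarith)
      (by rw [finrank_euclideanSpace_fin]; linarith) (fun x _ hx => ?_) fun x hx => ?_
    · rw [if_neg (not_le.2 hx)]; exact bot_le
    · rw [if_pos hx, one_mul]
  obtain ⟨C, hC, hshell⟩ := exists_lintegral_shell_le (volume : Measure (Space d))
    (by simpa using hd)
  rw [finrank_euclideanSpace_fin] at hshell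
  refine ⟨4 * T.toReal + C, by positivity, fun r hr => ?_⟩
  have hmax : 1 ≤ max 1 |Real.log r| := le_max_left _ _
  rcases le_or_gt 1 r with h1 | h1
  · have hr2 : 1 ≤ r ^ 2 * max 1 |Real.log r| := one_le_mul_of_one_le_of_one_le
      (one_le_pow₀ h1) hmax
    calc _ ≤ ∫⁻ ξ : Space d, ENNReal.ofReal 4 *
          (if 1 ≤ ‖ξ‖ then ENNReal.ofReal (‖ξ‖ ^ (-(d : ℝ) - 2)) else 0) := by
          refine lintegral_mono fun ξ => ?_
          split_ifs with h
          · rw [← ENNReal.ofReal_mul (by norm_num), mul_comm 4]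
            refine ENNReal.ofReal_le_ofReal ?_
            gcongr
            exact min_le_left _ _
          · simp
      _ = ENNReal.ofReal (4 * T.toReal) := by
          rw [lintegral_const_mul' _ _ ENNReal.ofReal_ne_top, ENNReal.ofReal_mul (by norm_num),
            ENNReal.ofReal_toReal hTfin.ne]
      _ ≤ _ := by
          refine ENNReal.ofReal_le_ofReal ?_
          have : 0 ≤ 4 * T.toReal := by positivity
          nlinarith
  · have hR : 1 ≤ r⁻¹ := (one_le_inv₀ hr).2 h1.le
    have htail : ∫⁻ ξ : Space d, (if r⁻¹ ≤ ‖ξ‖ then ENNReal.ofReal (‖ξ‖ ^ (-(d : ℝ) - 2)) else 0)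
        = ENNReal.ofReal (r ^ 2) * T := by
      have h := lintegral_eq_of_comp_smul (volume : Measure (Space d))
        (f := fun ξ => if r⁻¹ ≤ ‖ξ‖ then ENNReal.ofReal (‖ξ‖ ^ (-(d : ℝ) - 2)) else 0)
        (g := fun ξ => if 1 ≤ ‖ξ‖ then ENNReal.ofReal (‖ξ‖ ^ (-(d : ℝ) - 2)) else 0)
        (a := r⁻¹) (c := r⁻¹ ^ (-(d : ℝ) - 2)) (by positivity) (fun x hx => ?_)
      · rw [h, ← hT, finrank_euclideanSpace_fin, ← Real.rpow_add (by positivity)]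
        congr 2
        rw [show (d : ℝ) + (-(d : ℝ) - 2) = -2 by ring, Real.inv_rpow hr.le,
          Real.rpow_neg hr.le, inv_inv, Real.rpow_two]
      · have e : r⁻¹ ≤ ‖r⁻¹ • x‖ ↔ 1 ≤ ‖x‖ := by
          rw [norm_smul, norm_inv, Real.norm_of_nonneg hr.le]
          exact le_mul_iff_one_le_right (by positivity)
        simp only [e]
        split_ifs with h
        · rw [← ENNReal.ofReal_mul (by positivity), norm_smul, norm_inv,
            Real.norm_of_nonneg hr.le, Real.mul_rpow (by positivity) (norm_nonneg _)]
        · simp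
    calc _ ≤ ∫⁻ ξ : Space d, (ENNReal.ofReal (r ^ 2) * (if 1 ≤ ‖ξ‖ ∧ ‖ξ‖ < r⁻¹ then
            ENNReal.ofReal (‖ξ‖ ^ (-(d : ℝ))) else 0) +
          ENNReal.ofReal 4 *
            (if r⁻¹ ≤ ‖ξ‖ then ENNReal.ofReal (‖ξ‖ ^ (-(d : ℝ) - 2)) else 0)) := by
          refine lintegral_mono fun ξ => ?_
          simp only
          by_cases h : 1 ≤ ‖ξ‖
          · have hξ : 0 < ‖ξ‖ := one_pos.trans_le h
            by_cases h' : ‖ξ‖ < r⁻¹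
            · rw [if_pos h, if_pos ⟨h, h'⟩, if_neg (not_le.2 h'), mul_zero, add_zero,
                ← ENNReal.ofReal_mul (by positivity), Real.rpow_sub hξ, Real.rpow_two]
              refine ENNReal.ofReal_le_ofReal ?_
              calc _ ≤ ‖ξ‖ ^ (-(d : ℝ)) / ‖ξ‖ ^ 2 * (‖ξ‖ ^ 2 * r ^ 2) := by
                    gcongr; exact min_le_right _ _
                _ = _ := by field_simp
            · rw [if_pos h, if_neg (fun hc => h' hc.2), if_pos (not_lt.1 h'), mul_zero, zero_add,
                ← ENNReal.ofReal_mul (by norm_num), mul_comm 4]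
              refine ENNReal.ofReal_le_ofReal ?_
              gcongr
              exact min_le_left _ _
          · rw [if_neg h]; exact bot_le
      _ = ENNReal.ofReal (r ^ 2) * (∫⁻ ξ : Space d, if 1 ≤ ‖ξ‖ ∧ ‖ξ‖ < r⁻¹ then
            ENNReal.ofReal (‖ξ‖ ^ (-(d : ℝ))) else 0) + ENNReal.ofReal 4 *
            (ENNReal.ofReal (r ^ 2) * T) := by
          rw [lintegral_add_left, lintegral_const_mul' _ _ ENNReal.ofReal_ne_top,
            lintegral_const_mul' _ _ ENNReal.ofReal_ne_top, htail]
          refine Measurable.const_mul (Measurable.ite ?_ (by fun_prop) measurable_const) _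
          exact (measurableSet_le measurable_const measurable_norm).inter
            (measurableSet_lt measurable_norm measurable_const)
      _ ≤ ENNReal.ofReal (r ^ 2) * ENNReal.ofReal (C * Real.log r⁻¹) + ENNReal.ofReal 4 *
            (ENNReal.ofReal (r ^ 2) * ENNReal.ofReal T.toReal) := by
          rw [ENNReal.ofReal_toReal hTfin.ne]
          gcongr
          exact hshell _ hR
      _ = ENNReal.ofReal (r ^ 2 * (C * Real.log r⁻¹) + 4 * (r ^ 2 * T.toReal)) := by
          have hlog : 0 ≤ Real.log r⁻¹ := Real.log_nonneg hR
          rw [← ENNReal.ofReal_mul (by positivity), ← ENNReal.ofReal_mul (by positivity),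
            ← ENNReal.ofReal_mul (by norm_num), ← ENNReal.ofReal_add (by positivity)
            (by positivity)]
      _ ≤ _ := by
          refine ENNReal.ofReal_le_ofReal ?_
          have hlog : Real.log r⁻¹ ≤ max 1 |Real.log r| := by
            rw [Real.log_inv]
            exact (neg_le_abs _).trans (le_max_right _ _)
          have ht : 0 ≤ T.toReal := ENNReal.toReal_nonneg
          have h3 : C * Real.log r⁻¹ ≤ C * max 1 |Real.log r| := by gcongr
          have h4 : 4 * T.toReal * 1 ≤ 4 * T.toReal * max 1 |Real.log r| := by gcongr
          have h5 : 0 ≤ r ^ 2 := sq_nonneg r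
          nlinarith

/-- Below |ξ| = 1, and for h > 1 also above it, the quadratic bound |ξ|²r² is integrable against the
density and gives r². Only the tail at h = 1 is critical. -/
theorem exists_lintegral_smooth_le (hd : 1 ≤ d) (hβ' : β < d) {h : ℝ} (hh : 1 ≤ h) :
    ∃ K : ℝ, 0 ≤ K ∧ ∀ r : ℝ, 0 ≤ r →
      ∫⁻ ξ : Space d, ENNReal.ofReal (min 4 (‖ξ‖ ^ 2 * r ^ 2) *
        (if ‖ξ‖ < 1 then ‖ξ‖ ^ (-β) else ‖ξ‖ ^ (-(d : ℝ) - 2 * h)))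
        ≤ ENNReal.ofReal (K * spatialModulus h r) := by
  have hβ2 : -((Module.finrank ℝ (Space d) : ℕ) : ℝ) < 2 - β := by
    rw [finrank_euclideanSpace_fin]; linarith
  have hnear : ∀ x : Space d, x ≠ 0 → ∀ r : ℝ,
      min 4 (‖x‖ ^ 2 * r ^ 2) * ‖x‖ ^ (-β) ≤ r ^ 2 * ‖x‖ ^ (2 - β) := by
    intro x hx r
    have hx' : 0 < ‖x‖ := norm_pos_iff.2 hx
    calc _ ≤ (‖x‖ ^ 2 * r ^ 2) * ‖x‖ ^ (-β) := by gcongr; exact min_le_right _ _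
      _ = _ := by rw [sub_eq_add_neg, Real.rpow_add hx', Real.rpow_two]; ring
  have := nontrivial_space hd
  have hne : ∀ᵐ ξ : Space d, ξ ≠ 0 := by simp [ae_iff]
  rcases hh.eq_or_lt with rfl | hh
  · set I : ℝ≥0∞ := ∫⁻ ξ : Space d, (if ‖ξ‖ < 1 then ENNReal.ofReal (‖ξ‖ ^ (2 - β)) else 0) with hI
    have hIfin : I < ∞ := by
      refine lintegral_lt_top_of_le_norm_rpow volume (by simpa using hd) (p := 2 - β)
        (q := -(d : ℝ) - 2) (C := 1) hβ2
        (by rw [finrank_euclideanSpace_fin]; linarith) (fun x _ hx => ?_) fun x hx => ?_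
      · rw [if_pos hx, one_mul]
      · rw [if_neg (not_lt.2 hx)]; exact bot_le
    obtain ⟨C, hC, htail⟩ := exists_lintegral_critical_tail_le hd
    refine ⟨I.toReal + C, by positivity, fun r hr => ?_⟩
    rcases hr.eq_or_lt with rfl | hr
    · simp
    have hmax : 1 ≤ max 1 |Real.log r| := le_max_left _ _
    calc _ ≤ ∫⁻ ξ : Space d, (ENNReal.ofReal (r ^ 2) *
            (if ‖ξ‖ < 1 then ENNReal.ofReal (‖ξ‖ ^ (2 - β)) else 0) +
          if 1 ≤ ‖ξ‖ then
            ENNReal.ofReal (‖ξ‖ ^ (-(d : ℝ) - 2) * min 4 (‖ξ‖ ^ 2 * r ^ 2)) else 0) := by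
          refine lintegral_mono_ae ?_
          filter_upwards [hne] with ξ hξ
          by_cases h : ‖ξ‖ < 1
          · rw [if_pos h, if_pos h, if_neg (not_le.2 h), add_zero,
              ← ENNReal.ofReal_mul (by positivity)]
            exact ENNReal.ofReal_le_ofReal (hnear ξ hξ r)
          · rw [if_neg h, if_neg h, if_pos (not_lt.1 h), mul_zero, zero_add, mul_one, mul_comm]
      _ = ENNReal.ofReal (r ^ 2) * ENNReal.ofReal I.toReal + _ := by
          rw [ENNReal.ofReal_toReal hIfin.ne, lintegral_add_left,
            lintegral_const_mul' _ _ ENNReal.ofReal_ne_top]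
          exact Measurable.const_mul (Measurable.ite (measurableSet_lt measurable_norm
            measurable_const) (by fun_prop) measurable_const) _
      _ ≤ ENNReal.ofReal (r ^ 2) * ENNReal.ofReal I.toReal +
          ENNReal.ofReal (C * (r ^ 2 * max 1 |Real.log r|)) := by
          gcongr
          exact htail r hr
      _ ≤ _ := by
          rw [← ENNReal.ofReal_mul (by positivity), ← ENNReal.ofReal_add (by positivity)
            (by positivity)]
          refine ENNReal.ofReal_le_ofReal ?_
          rw [spatialModulus, if_neg (lt_irrefl _), if_pos rfl, add_mul]
          have : r ^ 2 * I.toReal * 1 ≤ r ^ 2 * I.toReal * max 1 |Real.log r| := by gcongr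
          nlinarith
  · set A : Space d → ℝ := fun ξ =>
      if ‖ξ‖ < 1 then ‖ξ‖ ^ (2 - β) else ‖ξ‖ ^ (2 - (d : ℝ) - 2 * h) with hA
    set I : ℝ≥0∞ := ∫⁻ ξ : Space d, ENNReal.ofReal (A ξ) with hI
    have hIfin : I < ∞ := by
      refine lintegral_lt_top_of_le_norm_rpow volume (by simpa using hd) (p := 2 - β)
        (q := 2 - (d : ℝ) - 2 * h) (C := 1) hβ2
        (by rw [finrank_euclideanSpace_fin]; linarith) (fun x _ hx => ?_) fun x hx => ?_
      · simp only [hA]; rw [if_pos hx, one_mul]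
      · simp only [hA]; rw [if_neg (not_lt.2 hx), one_mul]
    refine ⟨I.toReal, ENNReal.toReal_nonneg, fun r hr => ?_⟩
    rw [spatialModulus, if_neg (not_lt.2 hh.le), if_neg hh.ne', mul_comm I.toReal,
      ENNReal.ofReal_mul (by positivity), ENNReal.ofReal_toReal hIfin.ne, hI,
      ← lintegral_const_mul' _ _ ENNReal.ofReal_ne_top]
    refine lintegral_mono_ae ?_
    filter_upwards [hne] with ξ hξ
    have hξ' : 0 < ‖ξ‖ := norm_pos_iff.2 hξ
    rw [← ENNReal.ofReal_mul (by positivity)]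
    refine ENNReal.ofReal_le_ofReal ?_
    simp only [hA]
    split_ifs with h1
    · exact hnear ξ hξ r
    · calc _ ≤ (‖ξ‖ ^ 2 * r ^ 2) * ‖ξ‖ ^ (-(d : ℝ) - 2 * h) := by gcongr; exact min_le_right _ _
        _ = _ := by
          rw [show 2 - (d : ℝ) - 2 * h = 2 + (-(d : ℝ) - 2 * h) by ring, Real.rpow_add hξ',
            Real.rpow_two]
          ring

/-- The factor in τ from pinning tames |ξ| < 1. For |ξ| ≥ 1 it is bounded by 4 and the ordinary
fiber integral |ξ|^{-d-2H₂} takes over. -/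
theorem lintegral_spectralWeight_space_of_one_le (hd : 1 ≤ d) (hH : 1 / 2 < H) (hH' : H < 1)
    (hα : 0 < α) (hβ' : β < d) (hge : 1 ≤ α * (H - (d - β) / (2 * α))) (T : ℝ) :
    ∃ K : ℝ, 0 ≤ K ∧ ∀ r : ℝ, 0 ≤ r →
      ∫⁻ ξ : Space d, ∫⁻ τ : ℝ, ENNReal.ofReal (spectralWeight H α β τ ξ *
        (min 4 (‖ξ‖ ^ 2 * r ^ 2) * min 4 (τ ^ 2 * T ^ 2)))
        ≤ ENNReal.ofReal (K * spatialModulus (α * (H - (d - β) / (2 * α))) r) := by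
  have := nontrivial_space hd
  obtain ⟨K₁, hK₁, h₁⟩ := lintegral_spectralWeight_fiber (d := d) (α := α) (β := β) hH hH'
  obtain ⟨D, hD, h₂⟩ := lintegral_spectralWeight_fiber_min (d := d) (α := α) (β := β) hH hH' T
  obtain ⟨K₃, hK₃, h₃⟩ := exists_lintegral_smooth_le hd hβ' hge
  refine ⟨(D + 4 * K₁) * K₃, by positivity, fun r hr => ?_⟩
  rw [mul_assoc, ENNReal.ofReal_mul (by positivity)]
  refine le_trans ?_ (mul_le_mul_right (h₃ r hr) _)
  rw [← lintegral_const_mul' _ _ ENNReal.ofReal_ne_top]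
  have hne : ∀ᵐ ξ : Space d, ξ ≠ 0 := by simp [ae_iff]
  refine lintegral_mono_ae ?_
  filter_upwards [hne] with ξ hξ
  have hξ' : 0 < ‖ξ‖ := norm_pos_iff.2 hξ
  have hm : 0 ≤ min 4 (‖ξ‖ ^ 2 * r ^ 2) := by positivity
  have e : ∀ τ : ℝ, ENNReal.ofReal (spectralWeight H α β τ ξ *
        (min 4 (‖ξ‖ ^ 2 * r ^ 2) * min 4 (τ ^ 2 * T ^ 2)))
      = ENNReal.ofReal (min 4 (‖ξ‖ ^ 2 * r ^ 2)) *
        ENNReal.ofReal (spectralWeight H α β τ ξ * min 4 (τ ^ 2 * T ^ 2)) := by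
    intro τ
    rw [← ENNReal.ofReal_mul hm]
    congr 1; ring
  simp only [e]
  rw [lintegral_const_mul' _ _ ENNReal.ofReal_ne_top, ENNReal.ofReal_mul hm, mul_left_comm]
  refine mul_le_mul_right ?_ _
  rw [← ENNReal.ofReal_mul (by positivity)]
  split_ifs with h
  · refine (h₂ ξ).trans (ENNReal.ofReal_le_ofReal ?_)
    gcongr
    linarith
  · calc _ ≤ ∫⁻ τ : ℝ, ENNReal.ofReal 4 * ENNReal.ofReal (spectralWeight H α β τ ξ) := by
          refine lintegral_mono fun τ => ?_
          rw [← ENNReal.ofReal_mul (by norm_num), mul_comm 4]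
          refine ENNReal.ofReal_le_ofReal ?_
          exact mul_le_mul_of_nonneg_left (min_le_left _ _) (spectralWeight_nonneg _ _)
      _ = ENNReal.ofReal (4 * K₁ * ‖ξ‖ ^ (-β - 2 * (α * H))) := by
          rw [lintegral_const_mul' _ _ ENNReal.ofReal_ne_top, h₁ ξ hξ,
            ← ENNReal.ofReal_mul (by norm_num), mul_assoc]
      _ ≤ _ := by
          refine ENNReal.ofReal_le_ofReal ?_
          rw [show -(d : ℝ) - 2 * (α * (H - (d - β) / (2 * α))) = -β - 2 * (α * H) by
            field_simp; ring]
          gcongr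
          linarith

end SmoothRegime

/-! ### Test densities localized in physical space -/

section FourierBump

variable (E : Type*) [NormedAddCommGroup E] [InnerProductSpace ℝ E] [FiniteDimensional ℝ E]
  [MeasurableSpace E] [BorelSpace E]

open scoped FourierTransform in
/-- At each scale `a` there is a density whose Fourier transform is `1` at the origin and vanishes
outside the ball of radius `a`, with the natural scaling of its weighted `L²` norms. -/
theorem exists_fourier_bump (hd : 1 ≤ Module.finrank ℝ E) :
    ∃ A : ℝ → ℝ, (∀ p, 0 ≤ A p) ∧ ∀ a : ℝ, 0 < a → ∃ G : E → ℂ, Continuous G ∧ Integrable G ∧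
      ∫ ξ, G ξ = 1 ∧
      (∀ x : E, a ≤ ‖x‖ → ∫ ξ, Complex.exp (Complex.I * (inner ℝ ξ x : ℝ)) * G ξ = 0) ∧
      ∀ p : ℝ, 0 ≤ p → ∫⁻ ξ, ENNReal.ofReal (‖ξ‖ ^ p * ‖G ξ‖ ^ 2)
        ≤ ENNReal.ofReal (a ^ ((Module.finrank ℝ E : ℝ) - p) * A p) := by
  have hnt : Nontrivial E := Module.nontrivial_of_finrank_pos (R := ℝ) (by omega)
  set D : ℝ := (Module.finrank ℝ E : ℝ) with hD
  -- A bump equal to 1 at the origin and vanishing outside the unit ball. Its Schwartz transform g,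
  -- rescaled, is the required density.
  let b : ContDiffBump (0 : E) := ⟨1 / 2, 1, by norm_num, by norm_num⟩
  have hbs : HasCompactSupport fun x => (b x : ℂ) :=
    b.hasCompactSupport.comp_left (g := ((↑) : ℝ → ℂ)) Complex.ofReal_zero
  have hbd : ContDiff ℝ (⊤ : ℕ∞) fun x => (b x : ℂ) :=
    Complex.ofRealCLM.contDiff.comp b.contDiff
  set f : SchwartzMap E ℂ := hbs.toSchwartzMap hbd with hf
  have hfb : ∀ x, f x = (b x : ℂ) := fun x => rfl
  set g : SchwartzMap E ℂ := 𝓕 f with hg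
  have hinv : ∀ x : E, ∫ η, Complex.exp (Complex.I * (2 * Real.pi * inner ℝ η x : ℝ)) * g η
      = b x := by
    intro x
    have h : 𝓕⁻ g = f := by rw [hg]; simp
    have h2 := congrArg (fun F : SchwartzMap E ℂ => F x) h
    simp only [SchwartzMap.fourierInv_coe, hfb] at h2
    rw [← h2, Real.fourierInv_eq']
    refine integral_congr_ae (ae_of_all _ fun η => ?_)
    simp only [smul_eq_mul]
    congr 2
    push_cast; ring
  have hgfin : ∀ p : ℝ, 0 ≤ p → ∫⁻ ξ, ENNReal.ofReal (‖ξ‖ ^ p * ‖g ξ‖ ^ 2) < ∞ := by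
    intro p hp
    obtain ⟨k, hk⟩ := exists_nat_gt (p + D)
    obtain ⟨C₀, -, hC₀⟩ := g.decay 0 0
    obtain ⟨C₁, -, hC₁⟩ := g.decay k 0
    simp only [pow_zero, one_mul, norm_iteratedFDeriv_zero] at hC₀ hC₁
    have hk0 : (0 : ℝ) ≤ D := Nat.cast_nonneg _
    have hD1 : (1 : ℝ) ≤ D := by rw [hD]; exact_mod_cast hd
    refine lintegral_lt_top_of_le_norm_rpow volume hd (p := 0) (q := p - 2 * k)
      (C := C₀ ^ 2 + C₁ ^ 2) (by linarith) (by linarith) (fun x hx hx1 => ?_) fun x hx => ?_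
    · refine ENNReal.ofReal_le_ofReal ?_
      rw [Real.rpow_zero, mul_one]
      have h1 : ‖x‖ ^ p ≤ 1 := Real.rpow_le_one (norm_nonneg _) hx1.le hp
      have h2 : ‖g x‖ ^ 2 ≤ C₀ ^ 2 := by gcongr; exact hC₀ x
      nlinarith [sq_nonneg C₁, sq_nonneg ‖g x‖]
    · refine ENNReal.ofReal_le_ofReal ?_
      have hx0 : 0 < ‖x‖ := one_pos.trans_le hx
      have h2 : (‖x‖ ^ k * ‖g x‖) ^ 2 ≤ C₁ ^ 2 := by gcongr; exact hC₁ x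
      have h3 : ‖x‖ ^ p = ‖x‖ ^ (p - 2 * k) * (‖x‖ ^ k) ^ 2 := by
        rw [← pow_mul, ← Real.rpow_natCast, ← Real.rpow_add hx0]
        congr 1; push_cast; ring
      calc _ = ‖x‖ ^ (p - 2 * k) * (‖x‖ ^ k * ‖g x‖) ^ 2 := by rw [h3]; ring
        _ ≤ ‖x‖ ^ (p - 2 * k) * (C₀ ^ 2 + C₁ ^ 2) := by
          gcongr; linarith [sq_nonneg C₀]
        _ = _ := mul_comm _ _
  refine ⟨fun p => (2 * Real.pi) ^ (p - D) *
      (∫⁻ ξ, ENNReal.ofReal (‖ξ‖ ^ p * ‖g ξ‖ ^ 2)).toReal, fun p => by positivity,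
    fun a ha => ?_⟩
  -- The factor 2π converts between the two Fourier conventions, so that c^D g(cξ) has inverse
  -- transform b(x/a) in angular frequency.
  set c : ℝ := a / (2 * Real.pi) with hc
  have hc0 : 0 < c := by positivity
  have hint : ∀ x : E,
      ∫ ξ, Complex.exp (Complex.I * (inner ℝ ξ x : ℝ)) * (((c ^ D : ℝ) : ℂ) * g (c • ξ))
        = b (a⁻¹ • x) := by
    intro x
    have h := Measure.integral_comp_smul (volume : Measure E)
      (fun η => Complex.exp (Complex.I * (2 * Real.pi * inner ℝ η (a⁻¹ • x) : ℝ)) * g η) c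
    rw [hinv, abs_of_nonneg (by positivity)] at h
    have e : ∀ ξ : E, Complex.exp (Complex.I * (inner ℝ ξ x : ℝ)) * (((c ^ D : ℝ) : ℂ) * g (c • ξ))
        = ((c ^ D : ℝ) : ℂ) * (Complex.exp (Complex.I *
          (2 * Real.pi * inner ℝ (c • ξ) (a⁻¹ • x) : ℝ)) * g (c • ξ)) := by
      intro ξ
      have : 2 * Real.pi * inner ℝ (c • ξ) (a⁻¹ • x) = (inner ℝ ξ x : ℝ) := by
        rw [real_inner_smul_left, real_inner_smul_right, hc]
        field_simp
      rw [this]; ring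
    simp only [e]
    rw [integral_const_mul, h, hD, Real.rpow_natCast, Complex.real_smul, ← mul_assoc,
      ← Complex.ofReal_mul, mul_inv_cancel₀ (by positivity), Complex.ofReal_one, one_mul]
  refine ⟨fun ξ => ((c ^ D : ℝ) : ℂ) * g (c • ξ), ?_, ?_, ?_, fun x hx => ?_, fun p hp => ?_⟩
  · exact continuous_const.mul (g.continuous.comp (continuous_const_smul c))
  · exact (g.integrable.comp_smul hc0.ne').const_mul _
  · have h := hint 0
    simp only [inner_zero_right, Complex.ofReal_zero, mul_zero, Complex.exp_zero, one_mul,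
      smul_zero] at h
    rw [h, b.one_of_mem_closedBall (by simp [b]), Complex.ofReal_one]
  · rw [hint, b.zero_of_le_dist, Complex.ofReal_zero]
    change 1 ≤ _
    rw [dist_zero_right, norm_smul, norm_inv, Real.norm_of_nonneg ha.le]
    field_simp
    exact hx
  · have h := lintegral_eq_of_comp_smul (volume : Measure E)
      (f := fun ξ => ENNReal.ofReal (‖ξ‖ ^ p * ‖((c ^ D : ℝ) : ℂ) * g (c • ξ)‖ ^ 2))
      (g := fun ξ => ENNReal.ofReal (‖ξ‖ ^ p * ‖g ξ‖ ^ 2)) (a := c⁻¹)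
      (c := c⁻¹ ^ p * (c ^ D) ^ 2) (by positivity) fun x _ => by
        rw [smul_smul, mul_inv_cancel₀ hc0.ne', one_smul, norm_smul, norm_inv,
          Real.norm_of_nonneg hc0.le, Real.mul_rpow (by positivity) (norm_nonneg _), norm_mul,
          Complex.norm_real, Real.norm_of_nonneg (by positivity : (0 : ℝ) ≤ c ^ D),
          ← ENNReal.ofReal_mul (by positivity)]
        congr 1; ring
    rw [h, ← ENNReal.ofReal_toReal (hgfin p hp).ne, ← ENNReal.ofReal_mul (by positivity)]
    refine ENNReal.ofReal_le_ofReal (le_of_eq ?_)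
    have hcD : c⁻¹ ^ D * (c⁻¹ ^ p * (c ^ D) ^ 2) = c ^ (D - p) := by
      rw [Real.inv_rpow hc0.le, Real.inv_rpow hc0.le, Real.rpow_sub hc0]
      field_simp
    simp only
    rw [← hD, hcD, ← mul_assoc, hc,
      Real.div_rpow ha.le (by positivity), show p - D = -(D - p) by ring,
      Real.rpow_neg (by positivity), div_eq_mul_inv]

end FourierBump

/-! ### Lower bound by duality -/

section LowerBound

variable {d : ℕ} {H α β : ℝ}

/-- Cauchy–Schwarz with a weight. -/
theorem sq_enorm_integral_mul_le {X : Type*} [MeasurableSpace X] {ν : Measure X} {F N : X → ℂ}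
    {w v : X → ℝ} (hF : Measurable F) (hN : Measurable N) (hw : Measurable w)
    (hwpos : ∀ᵐ x ∂ν, 0 < w x) (hv : ∀ᵐ x ∂ν, (w x)⁻¹ = v x) :
    ‖∫ x, N x * F x ∂ν‖ₑ ^ 2 ≤ (∫⁻ x, ENNReal.ofReal (w x * ‖N x‖ ^ 2) ∂ν) *
      ∫⁻ x, ENNReal.ofReal (v x * ‖F x‖ ^ 2) ∂ν := by
  have h1 : ‖∫ x, N x * F x ∂ν‖ₑ ≤ ∫⁻ x, ENNReal.ofReal (√(w x) * ‖N x‖) *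
      ENNReal.ofReal (√(w x)⁻¹ * ‖F x‖) ∂ν := by
    refine (enorm_integral_le_lintegral_enorm _).trans (le_of_eq (lintegral_congr_ae ?_))
    filter_upwards [hwpos] with x hx
    rw [← ENNReal.ofReal_mul (by positivity), ← ofReal_norm, norm_mul]
    congr 1
    have : √(w x) * √(w x)⁻¹ = 1 := by
      rw [← Real.sqrt_mul hx.le, mul_inv_cancel₀ hx.ne', Real.sqrt_one]
    linear_combination (-‖N x‖ * ‖F x‖) * this
  have h2 := ENNReal.lintegral_mul_le_Lp_mul_Lq ν Real.HolderConjugate.two_two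
    (f := fun x => ENNReal.ofReal (√(w x) * ‖N x‖))
    (g := fun x => ENNReal.ofReal (√(w x)⁻¹ * ‖F x‖)) (by fun_prop) (by fun_prop)
  have hsq : ∀ {f : X → ℝ} {h : X → ℝ}, (∀ᵐ x ∂ν, 0 ≤ f x ∧ f x ^ 2 = h x) →
      (∫⁻ x, ENNReal.ofReal (f x) ^ (2 : ℝ) ∂ν) = ∫⁻ x, ENNReal.ofReal (h x) ∂ν := by
    intro f h hfh
    refine lintegral_congr_ae ?_
    filter_upwards [hfh] with x hx
    rw [ENNReal.rpow_two, ← ENNReal.ofReal_pow hx.1, hx.2]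
  rw [hsq (h := fun x => w x * ‖N x‖ ^ 2), hsq (h := fun x => v x * ‖F x‖ ^ 2)] at h2
  · calc _ ≤ (_ : ℝ≥0∞) ^ 2 := pow_le_pow_left' (h1.trans h2) 2
      _ = _ := by
        rw [mul_pow, ← ENNReal.rpow_two, ← ENNReal.rpow_two, ← ENNReal.rpow_mul,
          ← ENNReal.rpow_mul]
        norm_num
  · filter_upwards [hwpos, hv] with x hx hx'
    refine ⟨by positivity, ?_⟩
    rw [mul_pow, Real.sq_sqrt (by positivity), hx']
  · filter_upwards [hwpos] with x hx
    refine ⟨by positivity, ?_⟩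
    rw [mul_pow, Real.sq_sqrt hx.le]

/-- The oscillating factor of the space-time point `(t, x)`. -/
noncomputable def spaceTimeChar (t : ℝ) (x : Space d) (τ : ℝ) (ξ : Space d) : ℂ :=
  Complex.exp (-Complex.I * (τ * t + inner ℝ ξ x : ℝ))

theorem norm_spaceTimeChar (t : ℝ) (x : Space d) (τ : ℝ) (ξ : Space d) :
    ‖spaceTimeChar t x τ ξ‖ = 1 := norm_exp_neg_I_mul _

theorem continuous_spaceTimeChar (t : ℝ) (x : Space d) :
    Continuous fun p : Space d × ℝ => spaceTimeChar t x p.2 p.1 := by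
  unfold spaceTimeChar; fun_prop

theorem integral_spaceTimeChar_mul (t s : ℝ) (x y : Space d) (G₁ : ℝ → ℂ) (G₂ : Space d → ℂ) :
    ∫ p : Space d × ℝ, spaceTimeChar s y p.2 p.1 *
        (Complex.exp (Complex.I * (p.2 * t + inner ℝ p.1 x : ℝ)) * (G₂ p.1 * G₁ p.2))
        ∂(volume.prod volume)
      = (∫ ξ, Complex.exp (Complex.I * (inner ℝ ξ (x - y) : ℝ)) * G₂ ξ) *
        ∫ τ, Complex.exp (Complex.I * (inner ℝ τ (t - s) : ℝ)) * G₁ τ := by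
  rw [← integral_prod_mul]
  refine integral_congr_ae (ae_of_all _ fun p => ?_)
  simp only [spaceTimeChar, real_inner_eq_re_inner]
  have : Complex.exp (-Complex.I * (p.2 * s + inner ℝ p.1 y : ℝ)) *
      Complex.exp (Complex.I * (p.2 * t + inner ℝ p.1 x : ℝ))
      = Complex.exp (Complex.I * (inner ℝ p.1 (x - y) : ℝ)) *
        Complex.exp (Complex.I * (inner ℝ p.2 (t - s) : ℝ)) := by
    rw [← Complex.exp_add, ← Complex.exp_add, inner_sub_right]
    congr 1
    have : inner ℝ p.2 (t - s) = p.2 * (t - s) := by simp [mul_comm]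
    rw [this]
    push_cast; ring
  simp only [inner_sub_right] at this ⊢
  linear_combination (G₂ p.1 * G₁ p.2) * this

/-- The dual function sees only the box |time| < ρ, |space| < ρ^{1/α} around (t,x): it pairs to 1
with the character of (t,x) and to 0 with all others. Hence the bound depends neither on the number
of points nor on the coefficients. -/
theorem exists_spectral_lower_bound (hd : 1 ≤ d) (hH : 1 / 2 < H) (hα : 0 < α) (hβ : 0 < β) :
    ∃ c : ℝ, 0 < c ∧ ∀ (ι : Type) [Fintype ι] (a : ι → ℝ) (s : ι → ℝ) (y : ι → Space d)
      (t : ℝ) (x : Space d) (ρ : ℝ), 0 < ρ →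
      (∀ i, ρ ≤ |t - s i| ∨ ρ ≤ ‖x - y i‖ ^ α) →
      ENNReal.ofReal (c * ρ ^ (2 * (H - (d - β) / (2 * α)))) ≤
        ∫⁻ ξ : Space d, ∫⁻ τ : ℝ, ENNReal.ofReal (spectralWeight H α β τ ξ *
          ‖spaceTimeChar t x τ ξ - ∑ i, a i • spaceTimeChar (s i) (y i) τ ξ‖ ^ 2) := by
  obtain ⟨A₁, hA₁, h₁⟩ := exists_fourier_bump ℝ (by simp)
  obtain ⟨A₂, hA₂, h₂⟩ := exists_fourier_bump (Space d) (by simpa using hd)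
  have := nontrivial_space hd
  -- The two products bound the two terms of the reciprocal weight; the 1 only ensures M > 0.
  set M : ℝ := A₂ (β + 2 * α) * A₁ (2 * H - 1) + A₂ β * A₁ (2 * H + 1) + 1 with hM
  have hM1 : 0 < M := by
    have := mul_nonneg (hA₂ (β + 2 * α)) (hA₁ (2 * H - 1))
    have := mul_nonneg (hA₂ β) (hA₁ (2 * H + 1))
    positivity
  refine ⟨M⁻¹, by positivity, fun ι _ a s y t x ρ hρ hsep => ?_⟩
  set h := H - (d - β) / (2 * α) with hh
  have hρα : 0 < ρ ^ α⁻¹ := by positivity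
  obtain ⟨G₁, hc₁, hi₁, hu₁, hz₁, hl₁⟩ := h₁ ρ hρ
  obtain ⟨G₂, hc₂, hi₂, hu₂, hz₂, hl₂⟩ := h₂ (ρ ^ α⁻¹) hρα
  set F : Space d × ℝ → ℂ := fun p =>
    Complex.exp (Complex.I * (p.2 * t + inner ℝ p.1 x : ℝ)) * (G₂ p.1 * G₁ p.2) with hF
  have hFc : Continuous F := by simp only [hF]; fun_prop
  have hFn : ∀ p, ‖F p‖ = ‖G₂ p.1‖ * ‖G₁ p.2‖ := by
    intro p
    simp only [hF, norm_mul, Complex.norm_exp]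
    simp
  have hFi : Integrable F (volume.prod volume) := by
    refine (hi₂.mul_prod hi₁).mono hFc.aestronglyMeasurable (ae_of_all _ fun p => ?_)
    rw [hFn, norm_mul]
  set N : Space d × ℝ → ℂ := fun p =>
    spaceTimeChar t x p.2 p.1 - ∑ i, a i • spaceTimeChar (s i) (y i) p.2 p.1 with hN
  have hNc : Continuous N := by
    refine (continuous_spaceTimeChar t x).sub (continuous_finsetSum _ fun i _ => ?_)
    exact (continuous_spaceTimeChar (s i) (y i)).const_smul (a i)
  have hci : ∀ s y, Integrable (fun p : Space d × ℝ => spaceTimeChar s y p.2 p.1 * F p)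
      (volume.prod volume) := by
    intro s y
    refine hFi.mono ((continuous_spaceTimeChar s y).mul hFc).aestronglyMeasurable
      (ae_of_all _ fun p => ?_)
    rw [norm_mul, norm_spaceTimeChar, one_mul]
  have hone : ∫ p, N p * F p ∂(volume.prod volume) = 1 := by
    have e : ∀ p, N p * F p = spaceTimeChar t x p.2 p.1 * F p -
        ∑ i, (a i : ℂ) * (spaceTimeChar (s i) (y i) p.2 p.1 * F p) := by
      intro p
      simp only [hN, sub_mul, Finset.sum_mul, Complex.real_smul, mul_assoc]
    simp only [e]
    rw [integral_sub (hci t x) (integrable_finsetSum _ fun i _ => (hci _ _).const_mul _),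
      integral_finsetSum _ fun i _ => (hci _ _).const_mul _]
    have h0 : ∀ i, ∫ p, (a i : ℂ) * (spaceTimeChar (s i) (y i) p.2 p.1 * F p)
        ∂(volume.prod volume) = 0 := by
      intro i
      rw [integral_const_mul, integral_spaceTimeChar_mul]
      rcases hsep i with h | h
      · rw [hz₁ _ (by rwa [Real.norm_eq_abs]), mul_zero, mul_zero]
      · have h' : ρ ^ α⁻¹ ≤ ‖x - y i‖ := by
          rw [← Real.rpow_rpow_inv (norm_nonneg (x - y i)) hα.ne']
          gcongr
        rw [hz₂ _ h', zero_mul, mul_zero]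
    rw [Finset.sum_eq_zero fun i _ => h0 i, sub_zero, integral_spaceTimeChar_mul]
    simp [hu₁, hu₂]
  have hne : ∀ᵐ p : Space d × ℝ ∂(volume.prod volume), p.1 ≠ 0 ∧ p.2 ≠ 0 := by
    have h1 : ∀ᵐ ξ : Space d, ξ ≠ 0 := by simp [ae_iff]
    have h2 : ∀ᵐ τ : ℝ, τ ≠ 0 := by simp [ae_iff]
    exact (Measure.quasiMeasurePreserving_fst.ae h1).and (Measure.quasiMeasurePreserving_snd.ae h2)
  -- The function v is the reciprocal of the weight, |τ|^{2H-1}|ξ|^β(|ξ|^{2α}+τ²), expanded into two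
  -- products so that its integral against |F|² factors.
  have hcs := sq_enorm_integral_mul_le (ν := (volume : Measure (Space d)).prod (volume : Measure ℝ))
    (F := F) (N := N) (w := fun p => spectralWeight H α β p.2 p.1)
    (v := fun p => ‖p.1‖ ^ (β + 2 * α) * |p.2| ^ (2 * H - 1) + ‖p.1‖ ^ β * |p.2| ^ (2 * H + 1))
    hFc.measurable hNc.measurable measurable_spectralWeight
    (by
      filter_upwards [hne] with p hp
      have hp1 : 0 < ‖p.1‖ := norm_pos_iff.2 hp.1
      have hp2 : 0 < |p.2| := abs_pos.2 hp.2
      unfold spectralWeight; positivity)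
    (by
      filter_upwards [hne] with p hp
      have hp1 : 0 < ‖p.1‖ := norm_pos_iff.2 hp.1
      have hp2 : 0 < |p.2| := abs_pos.2 hp.2
      rw [spectralWeight, show 1 - 2 * H = -(2 * H - 1) by ring, Real.rpow_neg hp2.le,
        Real.rpow_neg hp1.le, Real.rpow_add hp1, show 2 * H + 1 = 2 * H - 1 + 2 by ring,
        Real.rpow_add hp2, Real.rpow_two, sq_abs]
      have : 0 < ‖p.1‖ ^ (2 * α) + p.2 ^ 2 := by positivity
      field_simp)
  rw [hone, enorm_one, one_pow] at hcs
  have hJ : ∫⁻ p, ENNReal.ofReal (spectralWeight H α β p.2 p.1 * ‖N p‖ ^ 2) ∂(volume.prod volume)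
      = ∫⁻ ξ : Space d, ∫⁻ τ : ℝ, ENNReal.ofReal (spectralWeight H α β τ ξ *
          ‖spaceTimeChar t x τ ξ - ∑ i, a i • spaceTimeChar (s i) (y i) τ ξ‖ ^ 2) := by
    exact lintegral_prod (fun p : Space d × ℝ => ENNReal.ofReal
      (spectralWeight H α β p.2 p.1 * ‖N p‖ ^ 2)) (measurable_spectralWeight.mul
      (hNc.norm.pow 2).measurable).ennreal_ofReal.aemeasurable
  rw [hJ] at hcs
  -- The spatial factor scales as ρ^{(d-p)/α} and the temporal one as ρ^{1-q}. Both pairs (β+2α,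
  -- 2H-1) and (β, 2H+1) give the total exponent -2h.
  have hterm : ∀ p q : ℝ, 0 ≤ p → 0 ≤ q →
      (d - p) / α + 1 - q = -(2 * h) →
      ∫⁻ z : Space d × ℝ, ENNReal.ofReal (‖z.1‖ ^ p * ‖G₂ z.1‖ ^ 2) *
        ENNReal.ofReal (‖z.2‖ ^ q * ‖G₁ z.2‖ ^ 2) ∂(volume.prod volume)
      ≤ ENNReal.ofReal (ρ ^ (-(2 * h)) * (A₂ p * A₁ q)) := by
    intro p q hp hq hpq
    rw [lintegral_prod_mul (f := fun ξ : Space d => ENNReal.ofReal (‖ξ‖ ^ p * ‖G₂ ξ‖ ^ 2))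
      (g := fun τ : ℝ => ENNReal.ofReal (‖τ‖ ^ q * ‖G₁ τ‖ ^ 2)) (by fun_prop) (by fun_prop)]
    refine (mul_le_mul' (hl₂ p hp) (hl₁ q hq)).trans (le_of_eq ?_)
    have hA := hA₂ p
    rw [← ENNReal.ofReal_mul (by positivity), finrank_euclideanSpace_fin, Module.finrank_self,
      ← Real.rpow_mul hρ.le, ← hpq]
    congr 1
    rw [show (d - p) / α + 1 - q = α⁻¹ * (d - p) + ((1 : ℕ) - q) by push_cast; ring,
      Real.rpow_add hρ]
    ring
  have hV : ∫⁻ p, ENNReal.ofReal ((‖p.1‖ ^ (β + 2 * α) * |p.2| ^ (2 * H - 1) +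
      ‖p.1‖ ^ β * |p.2| ^ (2 * H + 1)) * ‖F p‖ ^ 2)
        ∂((volume : Measure (Space d)).prod (volume : Measure ℝ))
      ≤ ENNReal.ofReal (ρ ^ (-(2 * h)) * M) := by
    have e : ∀ p : Space d × ℝ, ENNReal.ofReal ((‖p.1‖ ^ (β + 2 * α) * |p.2| ^ (2 * H - 1) +
        ‖p.1‖ ^ β * |p.2| ^ (2 * H + 1)) * ‖F p‖ ^ 2)
        = ENNReal.ofReal (‖p.1‖ ^ (β + 2 * α) * ‖G₂ p.1‖ ^ 2) *
            ENNReal.ofReal (‖p.2‖ ^ (2 * H - 1) * ‖G₁ p.2‖ ^ 2) +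
          ENNReal.ofReal (‖p.1‖ ^ β * ‖G₂ p.1‖ ^ 2) *
            ENNReal.ofReal (‖p.2‖ ^ (2 * H + 1) * ‖G₁ p.2‖ ^ 2) := by
      intro p
      rw [hFn, ← ENNReal.ofReal_mul (by positivity), ← ENNReal.ofReal_mul (by positivity),
        ← ENNReal.ofReal_add (by positivity) (by positivity), Real.norm_eq_abs]
      congr 1; ring
    simp only [e]
    have hB₁ := mul_nonneg (hA₂ (β + 2 * α)) (hA₁ (2 * H - 1))
    have hB₂ := mul_nonneg (hA₂ β) (hA₁ (2 * H + 1))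
    rw [lintegral_add_left (by fun_prop)]
    refine (add_le_add (hterm (β + 2 * α) (2 * H - 1) (by positivity) (by linarith) ?_)
      (hterm β (2 * H + 1) hβ.le (by linarith) ?_)).trans ?_
    · rw [hh]; field_simp; ring
    · rw [hh]; field_simp; ring
    · rw [← ENNReal.ofReal_add (by positivity) (by positivity)]
      refine ENNReal.ofReal_le_ofReal ?_
      rw [← mul_add, hM]
      exact mul_le_mul_of_nonneg_left (by linarith) (by positivity)
  have hV0 : 0 < ρ ^ (-(2 * h)) * M := by positivity
  have h1 := hcs.trans (mul_le_mul_right hV _)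
  have h2 : ENNReal.ofReal (M⁻¹ * ρ ^ (2 * h)) = (ENNReal.ofReal (ρ ^ (-(2 * h)) * M))⁻¹ := by
    rw [← ENNReal.ofReal_inv_of_pos hV0, mul_inv, Real.rpow_neg hρ.le, inv_inv, mul_comm]
  rw [h2]
  rw [mul_comm] at h1
  exact (ENNReal.inv_le_iff_le_mul (fun _ => (ENNReal.ofReal_pos.2 hV0).ne')
    (fun hc => absurd hc ENNReal.ofReal_ne_top)).2 h1

end LowerBound

/-! ### Comparison with the model weight -/

section SpectralEnergy

variable {d : ℕ} {H α β : ℝ}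

/-- The energy of the numerator `N` of a space-time Fourier transform. -/
noncomputable def spectralEnergy (H α β : ℝ) (N : ℝ → Space d → ℂ) : ℝ≥0∞ :=
  ∫⁻ ξ : Space d, ∫⁻ τ : ℝ, ENNReal.ofReal (spectralWeight H α β τ ξ * ‖N τ ξ‖ ^ 2)

theorem norm_sub_I_mul_sq (a τ : ℝ) : ‖(a : ℂ) - Complex.I * τ‖ ^ 2 = a ^ 2 + τ ^ 2 := by
  rw [← Complex.normSq_eq_norm_sq, Complex.normSq_apply]
  simp; ring

theorem ExponentComparable.exists_resolvent_bounds {Ψ : Space d → ℝ}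
    (hΨ : ExponentComparable Ψ α) :
    ∃ m M : ℝ, 0 < m ∧ 0 < M ∧ ∀ ξ : Space d, ξ ≠ 0 → ∀ τ : ℝ,
      m * (‖ξ‖ ^ (2 * α) + τ ^ 2)⁻¹ ≤ (‖(Ψ ξ : ℂ) - Complex.I * τ‖ ^ 2)⁻¹ ∧
      (‖(Ψ ξ : ℂ) - Complex.I * τ‖ ^ 2)⁻¹ ≤ M * (‖ξ‖ ^ (2 * α) + τ ^ 2)⁻¹ := by
  obtain ⟨c, C, hc, hb⟩ := hΨ
  -- From Ψ² + τ² ≤ (C²+1)(|ξ|^{2α}+τ²) and |ξ|^{2α} + τ² ≤ (c⁻²+1)(Ψ²+τ²).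
  refine ⟨(C ^ 2 + 1)⁻¹, (c ^ 2)⁻¹ + 1, by positivity, by positivity, fun ξ hξ τ => ?_⟩
  have hξ' : 0 < ‖ξ‖ := norm_pos_iff.2 hξ
  obtain ⟨h1, h2⟩ := hb ξ
  have hr : 0 < ‖ξ‖ ^ α := by positivity
  have hΨ0 : 0 < Ψ ξ := lt_of_lt_of_le (by positivity) h1
  have e : ‖ξ‖ ^ (2 * α) = (‖ξ‖ ^ α) ^ 2 := by
    rw [← Real.rpow_natCast, ← Real.rpow_mul hξ'.le, mul_comm]; norm_num
  rw [norm_sub_I_mul_sq, e]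
  set r := ‖ξ‖ ^ α
  have h3 : (c * r) ^ 2 ≤ Ψ ξ ^ 2 := by gcongr
  have h4 : Ψ ξ ^ 2 ≤ (C * r) ^ 2 := by gcongr
  constructor
  · rw [← mul_inv]
    refine inv_anti₀ (by positivity) ?_
    nlinarith [sq_nonneg τ, sq_nonneg r, mul_nonneg (sq_nonneg C) (sq_nonneg τ)]
  · rw [inv_eq_one_div, ← div_eq_mul_inv, div_le_div_iff₀ (by positivity) (by positivity)]
    have h5 : (c ^ 2)⁻¹ * (c * r) ^ 2 = r ^ 2 := by field_simp
    have h6 : (c ^ 2)⁻¹ * (c * r) ^ 2 ≤ (c ^ 2)⁻¹ * Ψ ξ ^ 2 := by gcongr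
    have h7 : 0 ≤ (c ^ 2)⁻¹ * τ ^ 2 := by positivity
    nlinarith [sq_nonneg (Ψ ξ)]

/-- Pointwise comparison of the resolvent and of the spectral density. The constants do not depend
on N, so minimization over coefficients commutes with the comparison. -/
theorem exists_spectralEnergy_bounds {μ : Measure (Space d)} {Ψ : Space d → ℝ} (hd : 1 ≤ d)
    (hΨ : ExponentComparable Ψ α) (hμ : MeasureComparable μ β) (H : ℝ) :
    ∃ c C : ℝ, 0 < c ∧ 0 < C ∧ ∀ N : ℝ → Space d → ℂ,
      ENNReal.ofReal c * spectralEnergy H α β N ≤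
        ∫⁻ ξ, (∫⁻ τ : ℝ, ENNReal.ofReal
          (|τ| ^ (1 - 2 * H) * ‖N τ ξ / (Ψ ξ - Complex.I * τ)‖ ^ 2)) ∂μ ∧
      ∫⁻ ξ, (∫⁻ τ : ℝ, ENNReal.ofReal
          (|τ| ^ (1 - 2 * H) * ‖N τ ξ / (Ψ ξ - Complex.I * τ)‖ ^ 2)) ∂μ ≤
        ENNReal.ofReal C * spectralEnergy H α β N := by
  obtain ⟨m, M, hm, hM, hb⟩ := hΨ.exists_resolvent_bounds
  obtain ⟨C, hC⟩ := hμ.lintegral_le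
  obtain ⟨c, hc0, hc⟩ := hμ.le_lintegral
  have := nontrivial_space hd
  have hne : ∀ᵐ ξ : Space d, ξ ≠ 0 := by simp [ae_iff]
  have e : ∀ (N : ℝ → Space d → ℂ) (k τ : ℝ) (ξ : Space d), k * (|τ| ^ (1 - 2 * H) *
      (‖ξ‖ ^ (-β) / (‖ξ‖ ^ (2 * α) + τ ^ 2)) * ‖N τ ξ‖ ^ 2)
      = ‖ξ‖ ^ (-β) * (|τ| ^ (1 - 2 * H) * (‖N τ ξ‖ ^ 2 *
        (k * (‖ξ‖ ^ (2 * α) + τ ^ 2)⁻¹))) := by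
    intro N k τ ξ
    rw [div_eq_mul_inv]; ring
  have e' : ∀ (N : ℝ → Space d → ℂ) (τ : ℝ) (ξ : Space d),
      ‖N τ ξ / (Ψ ξ - Complex.I * τ)‖ ^ 2
        = ‖N τ ξ‖ ^ 2 * (‖(Ψ ξ : ℂ) - Complex.I * τ‖ ^ 2)⁻¹ := by
    intro N τ ξ
    rw [norm_div, div_pow, div_eq_mul_inv]
  refine ⟨c * m, (C + 1) * M, by positivity, by positivity, fun N => ⟨?_, ?_⟩⟩
  · refine le_trans (le_trans (le_of_eq ?_) (mul_le_mul_right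
      (b := ENNReal.ofReal m * spectralEnergy H α β N) ?_ (c : ℝ≥0∞))) (hc _)
    · rw [ENNReal.ofReal_mul (by positivity), ENNReal.ofReal_coe_nnreal, mul_assoc]
    · rw [spectralEnergy, ← lintegral_const_mul' _ _ ENNReal.ofReal_ne_top]
      refine lintegral_mono_ae ?_
      filter_upwards [hne] with ξ hξ
      rw [← lintegral_const_mul' _ _ ENNReal.ofReal_ne_top,
        ← lintegral_const_mul' _ _ ENNReal.ofReal_ne_top]
      refine lintegral_mono fun τ => ?_
      simp only
      rw [← ENNReal.ofReal_mul hm.le, ← ENNReal.ofReal_mul (by positivity), spectralWeight, e, e']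
      refine ENNReal.ofReal_le_ofReal ?_
      gcongr
      exact (hb ξ hξ τ).1
  · refine le_trans (hC _) (le_trans (mul_le_mul_right
      (c := ENNReal.ofReal M * spectralEnergy H α β N) ?_ (C : ℝ≥0∞)) ?_)
    · rw [spectralEnergy, ← lintegral_const_mul' _ _ ENNReal.ofReal_ne_top]
      refine lintegral_mono_ae ?_
      filter_upwards [hne] with ξ hξ
      rw [← lintegral_const_mul' _ _ ENNReal.ofReal_ne_top,
        ← lintegral_const_mul' _ _ ENNReal.ofReal_ne_top]
      refine lintegral_mono fun τ => ?_
      simp only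
      rw [← ENNReal.ofReal_mul hM.le, ← ENNReal.ofReal_mul (by positivity), spectralWeight, e, e']
      refine ENNReal.ofReal_le_ofReal ?_
      gcongr
      exact (hb ξ hξ τ).2
    · rw [← mul_assoc, ENNReal.ofReal_mul (by positivity), ← ENNReal.ofReal_coe_nnreal]
      gcongr
      linarith

/-- The numerator of the space-time Fourier transform of `pinnedKernel Ψ b t x`. -/
noncomputable def pinnedChar (b : Space d) (t : ℝ) (x : Space d) (τ : ℝ) (ξ : Space d) : ℂ :=
  spaceTimeChar t x τ ξ - spaceTimeChar 0 b τ ξ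

theorem pinnedChar_self (x : Space d) : pinnedChar x 0 x = 0 := by
  funext τ ξ; simp [pinnedChar]

end SpectralEnergy

/-! ### Second moments of the field as energies -/

section PinnedField

variable {d : ℕ} {H α β : ℝ} {Ω' : Type*} [MeasurableSpace Ω'] {P' : Measure Ω'}
  [IsProbabilityMeasure P'] {X : ℝ≥0 → Ω' → Space d} {Ψ : Space d → ℝ}
  {μ : Measure (Space d)} {Ω : Type*} [MeasurableSpace Ω] {P : Measure Ω}
  [IsProbabilityMeasure P] {B : SpaceTimeTest d → Ω → ℝ}

theorem exists_pinnedField_variance_bounds (hd : 1 ≤ d) (hH : 1 / 2 < H) (hH' : H < 1)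
    (hα : 0 < α) (hβ : 0 < β) (hβ' : β < d)
    (hX : IsSymmetricLevyWithExponent P' X Ψ) (hΨ : ExponentComparable Ψ α)
    (hμ : MeasureComparable μ β) (hB : IsFractionalColoredNoise H μ P B) :
    ∃ c C : ℝ, 0 < c ∧ 0 < C ∧ ∀ (b : Space d → Space d) (U : ℝ → Space d → Ω → ℝ),
      IsPinnedField H μ Ψ P B b U → ∀ (n : ℕ) (t : ℝ) (x : Space d) (s : Fin n → ℝ)
        (y : Fin n → Space d), 0 ≤ t → (∀ k, 0 ≤ s k) →
      HasGaussianLaw (fun ω => (U t x ω, fun k => U (s k) (y k) ω)) P ∧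
      (∫ ω, U t x ω ∂P = 0 ∧ ∀ k, ∫ ω, U (s k) (y k) ω ∂P = 0) ∧
      ∀ a : Fin n → ℝ,
        ENNReal.ofReal c * spectralEnergy H α β (fun τ ξ => pinnedChar (b x) t x τ ξ -
            ∑ k, a k • pinnedChar (b (y k)) (s k) (y k) τ ξ)
          ≤ ENNReal.ofReal (∫ ω, (U t x ω - ∑ k, a k * U (s k) (y k) ω) ^ 2 ∂P) ∧
        ENNReal.ofReal (∫ ω, (U t x ω - ∑ k, a k * U (s k) (y k) ω) ^ 2 ∂P)
          ≤ ENNReal.ofReal C * spectralEnergy H α β (fun τ ξ => pinnedChar (b x) t x τ ξ -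
            ∑ k, a k • pinnedChar (b (y k)) (s k) (y k) τ ξ) := by
  obtain ⟨c, C, hc, hC, hE⟩ := exists_spectralEnergy_bounds hd hΨ hμ H
  have hκ := noiseConst_pos d hH hH'
  refine ⟨noiseConst d H * c, noiseConst d H * C, by positivity, by positivity,
    fun b U hU n t x s y ht hs => ?_⟩
  -- The index `none` carries the target point (t,x) and `some k` the conditioning points, so one
  -- application of the isometry covers them jointly. The coefficients will be 1 and -a k.
  set t' : Option (Fin n) → ℝ := fun o => o.elim t s with ht'
  set x' : Option (Fin n) → Space d := fun o => o.elim x y with hx'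
  have ht0 : ∀ o, 0 ≤ t' o := fun o => by cases o <;> simp [ht', ht, hs]
  obtain ⟨hG, h0, hI⟩ := hB.isometry hH hH' hμ hβ hβ'
    (g := fun o => pinnedKernel Ψ (b (x' o)) (t' o) (x' o))
    (Z := fun o => U (t' o) (x' o)) (fun o => measurable_pinnedKernel hX _ _ _)
    (fun o => (hU _ (ht0 o) _).1) (fun o => (hU _ (ht0 o) _).2)
  refine ⟨?_, ⟨h0 none, fun k => h0 (some k)⟩, fun a => ?_⟩
  · exact hG.map_fun ((ContinuousLinearMap.proj (R := ℝ) (φ := fun _ : Option (Fin n) => ℝ)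
      none).prod (ContinuousLinearMap.pi fun k : Fin n =>
        ContinuousLinearMap.proj (R := ℝ) (φ := fun _ : Option (Fin n) => ℝ) (some k)))
  · obtain ⟨hfin, hv⟩ := hI fun o => o.elim 1 fun k => -a k
    set N : ℝ → Space d → ℂ := fun τ ξ => pinnedChar (b x) t x τ ξ -
            ∑ k, a k • pinnedChar (b (y k)) (s k) (y k) τ ξ with hN
    have hL : ∫⁻ ξ, (∫⁻ τ : ℝ, ENNReal.ofReal (|τ| ^ (1 - 2 * H) *
          ‖∑ o : Option (Fin n), (o.elim 1 fun k => -a k : ℝ) •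
            spaceTimeFT (pinnedKernel Ψ (b (x' o)) (t' o) (x' o)) τ ξ‖ ^ 2)) ∂μ
        = ∫⁻ ξ, (∫⁻ τ : ℝ, ENNReal.ofReal
          (|τ| ^ (1 - 2 * H) * ‖N τ ξ / (Ψ ξ - Complex.I * τ)‖ ^ 2)) ∂μ := by
      have := nontrivial_space hd
      have hne : ∀ᵐ ξ : Space d, ξ ≠ 0 := by simp [ae_iff]
      refine lintegral_congr_ae ?_
      filter_upwards [hμ.absolutelyContinuous.ae_le hne] with ξ hξ
      have e : ∀ (b x : Space d) (t τ : ℝ), spaceTimeFT (pinnedKernel Ψ b t x) τ ξ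
          = pinnedChar b t x τ ξ / (Ψ ξ - Complex.I * τ) := by
        intro b x t τ
        rw [spaceTimeFT_pinnedKernel hX hd hα hΨ b t x τ hξ, pinnedChar, spaceTimeChar,
          spaceTimeChar, mul_zero, zero_add]
      refine lintegral_congr fun τ => ?_
      rw [Fintype.sum_option]
      simp only [e, ht', hx', Option.elim_none, Option.elim_some, one_smul, hN, neg_smul,
        Finset.sum_neg_distrib, sub_div, Finset.sum_div, smul_div_assoc, ← sub_eq_add_neg]
    have hv' : ENNReal.ofReal (∫ ω, (U t x ω - ∑ k, a k * U (s k) (y k) ω) ^ 2 ∂P)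
        = ENNReal.ofReal (noiseConst d H) * ∫⁻ ξ, (∫⁻ τ : ℝ, ENNReal.ofReal
          (|τ| ^ (1 - 2 * H) * ‖N τ ξ / (Ψ ξ - Complex.I * τ)‖ ^ 2)) ∂μ := by
      rw [hL] at hfin hv
      rw [← ENNReal.ofReal_toReal hfin, ← ENNReal.ofReal_mul hκ.le, ← hv]
      congr 2 with ω
      simp [Fintype.sum_option, ht', hx', sub_eq_add_neg]
    obtain ⟨h1, h2⟩ := hE N
    rw [hv', ENNReal.ofReal_mul hκ.le, ENNReal.ofReal_mul hκ.le, mul_assoc, mul_assoc]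
    exact ⟨mul_le_mul_right h1 _, mul_le_mul_right h2 _⟩

end PinnedField

/-! ### Energies of increments -/

section EnergyUpperBounds

variable {d : ℕ} {H α β : ℝ}

theorem norm_exp_sub_exp_sq_le (A B : ℝ) :
    ‖Complex.exp (-Complex.I * A) - Complex.exp (-Complex.I * B)‖ ^ 2 ≤ min 4 ((A - B) ^ 2) := by
  refine le_min ?_ ?_
  · have h := norm_sub_le (Complex.exp (-Complex.I * A)) (Complex.exp (-Complex.I * B))
    rw [norm_exp_neg_I_mul, norm_exp_neg_I_mul] at h
    nlinarith [norm_nonneg (Complex.exp (-Complex.I * A) - Complex.exp (-Complex.I * B))]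
  · have e : Complex.exp (-Complex.I * A) - Complex.exp (-Complex.I * B)
        = Complex.exp (-Complex.I * B) * (Complex.exp (Complex.I * ((B - A : ℝ) : ℂ)) - 1) := by
      rw [mul_sub, ← Complex.exp_add, mul_one]
      congr 2; push_cast; ring
    rw [e, norm_mul, norm_exp_neg_I_mul, one_mul, ← sq_abs (A - B), abs_sub_comm]
    gcongr
    exact Real.norm_exp_I_mul_ofReal_sub_one_le

theorem norm_spaceTimeChar_sub_time_sq_le (t s : ℝ) (x : Space d) (τ : ℝ) (ξ : Space d) :
    ‖spaceTimeChar t x τ ξ - spaceTimeChar s x τ ξ‖ ^ 2 ≤ min 4 (τ ^ 2 * |t - s| ^ 2) := by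
  refine (norm_exp_sub_exp_sq_le _ _).trans (le_of_eq ?_)
  rw [sq_abs]; congr 1; ring

theorem norm_spaceTimeChar_sub_space_sq_le (t : ℝ) (x y : Space d) (τ : ℝ) (ξ : Space d) :
    ‖spaceTimeChar t x τ ξ - spaceTimeChar t y τ ξ‖ ^ 2 ≤ min 4 (‖ξ‖ ^ 2 * ‖x - y‖ ^ 2) := by
  refine (norm_exp_sub_exp_sq_le _ _).trans (min_le_min_left _ ?_)
  rw [add_sub_add_left_eq_sub, ← inner_sub_right, ← sq_abs, ← mul_pow]
  gcongr
  exact abs_real_inner_le_norm _ _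

/-- A rectangular increment of an exponential is a product of a spatial and a temporal increment, so
both small factors are available at once. -/
theorem norm_spaceTimeChar_rectangle_sq_le {s T : ℝ} (hs : s ∈ Set.Icc 0 T) (x y : Space d) (τ : ℝ)
    (ξ : Space d) :
    ‖(spaceTimeChar s x τ ξ - spaceTimeChar 0 x τ ξ) -
      (spaceTimeChar s y τ ξ - spaceTimeChar 0 y τ ξ)‖ ^ 2
      ≤ min 4 (‖ξ‖ ^ 2 * ‖x - y‖ ^ 2) * min 4 (τ ^ 2 * T ^ 2) := by
  have e : ∀ z : Space d, spaceTimeChar s z τ ξ = spaceTimeChar 0 z τ ξ * spaceTimeChar s 0 τ ξ := by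
    intro z
    simp only [spaceTimeChar]
    rw [← Complex.exp_add]
    congr 1; simp; ring
  have e' : (spaceTimeChar s x τ ξ - spaceTimeChar 0 x τ ξ) -
      (spaceTimeChar s y τ ξ - spaceTimeChar 0 y τ ξ)
      = (spaceTimeChar 0 x τ ξ - spaceTimeChar 0 y τ ξ) *
        (spaceTimeChar s 0 τ ξ - spaceTimeChar 0 (0 : Space d) τ ξ) := by
    have h0 : spaceTimeChar 0 (0 : Space d) τ ξ = 1 := by simp [spaceTimeChar]
    rw [e x, e y, h0]; ring
  rw [e', norm_mul, mul_pow]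
  refine mul_le_mul (norm_spaceTimeChar_sub_space_sq_le _ _ _ _ _)
    ((norm_spaceTimeChar_sub_time_sq_le _ _ _ _ _).trans (min_le_min_left _ ?_))
    (by positivity) (by positivity)
  rw [sub_zero, abs_of_nonneg hs.1]
  have := hs.1
  gcongr
  exact hs.2

theorem spectralEnergy_le_of_norm_sq_le {N : ℝ → Space d → ℂ} {h k₁ k₂ : ℝ} {f : ℝ → Space d → ℝ}
    (hk₁ : 0 ≤ k₁) (hk₂ : 0 ≤ k₂) (hf : ∀ τ ξ, 0 ≤ f τ ξ)
    (hN : ∀ τ ξ, ‖N τ ξ‖ ^ 2 ≤ 2 * (min 4 (τ ^ 2 * h ^ 2) + f τ ξ))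
    (h₁ : ∫⁻ ξ : Space d, ∫⁻ τ : ℝ, ENNReal.ofReal (spectralWeight H α β τ ξ *
      min 4 (τ ^ 2 * h ^ 2)) ≤ ENNReal.ofReal k₁)
    (h₂ : ∫⁻ ξ : Space d, ∫⁻ τ : ℝ, ENNReal.ofReal (spectralWeight H α β τ ξ * f τ ξ)
      ≤ ENNReal.ofReal k₂) :
    spectralEnergy H α β N ≤ ENNReal.ofReal (2 * (k₁ + k₂)) := by
  have hw : Measurable fun p : Space d × ℝ => ENNReal.ofReal (spectralWeight H α β p.2 p.1 *
      min 4 (p.2 ^ 2 * h ^ 2)) :=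
    (measurable_spectralWeight.mul (by fun_prop)).ennreal_ofReal
  calc spectralEnergy H α β N ≤ ∫⁻ ξ : Space d, ∫⁻ τ : ℝ, ENNReal.ofReal 2 *
        (ENNReal.ofReal (spectralWeight H α β τ ξ * min 4 (τ ^ 2 * h ^ 2)) +
          ENNReal.ofReal (spectralWeight H α β τ ξ * f τ ξ)) := by
        refine lintegral_mono fun ξ => lintegral_mono fun τ => ?_
        simp only
        have hw0 := spectralWeight_nonneg (H := H) (α := α) (β := β) τ ξ
        have hm : 0 ≤ min 4 (τ ^ 2 * h ^ 2) := by positivity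
        rw [← ENNReal.ofReal_add (mul_nonneg hw0 hm) (mul_nonneg hw0 (hf τ ξ)),
          ← ENNReal.ofReal_mul (by norm_num)]
        refine ENNReal.ofReal_le_ofReal ?_
        calc _ ≤ spectralWeight H α β τ ξ * (2 * (min 4 (τ ^ 2 * h ^ 2) + f τ ξ)) :=
              mul_le_mul_of_nonneg_left (hN τ ξ) hw0
          _ = _ := by ring
    _ = ENNReal.ofReal 2 * ((∫⁻ ξ : Space d, ∫⁻ τ : ℝ, ENNReal.ofReal
          (spectralWeight H α β τ ξ * min 4 (τ ^ 2 * h ^ 2))) +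
          ∫⁻ ξ : Space d, ∫⁻ τ : ℝ, ENNReal.ofReal (spectralWeight H α β τ ξ * f τ ξ)) := by
        -- Additivity needs measurability of the first summand only, so nothing is asked of f.
        rw [← lintegral_add_left hw.lintegral_prod_right',
          ← lintegral_const_mul' _ _ ENNReal.ofReal_ne_top]
        refine lintegral_congr fun ξ => ?_
        rw [lintegral_const_mul' _ _ ENNReal.ofReal_ne_top]
        congr 1
        exact lintegral_add_left (hw.comp (measurable_prodMk_left (x := ξ))) _
    _ ≤ _ := by
        rw [ENNReal.ofReal_mul (by norm_num), ENNReal.ofReal_add hk₁ hk₂]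
        gcongr

theorem spatialModulus_nonneg (h : ℝ) {r : ℝ} (hr : 0 ≤ r) : 0 ≤ spatialModulus h r := by
  unfold spatialModulus
  split_ifs <;> positivity

theorem norm_sq_le_of_eq_add {z v w : ℂ} {p q : ℝ} (h : z = v + w) (hv : ‖v‖ ^ 2 ≤ p)
    (hw : ‖w‖ ^ 2 ≤ q) : ‖z‖ ^ 2 ≤ 2 * (p + q) := by
  have h1 : ‖z‖ ≤ ‖v‖ + ‖w‖ := h ▸ norm_add_le v w
  nlinarith [norm_nonneg z, norm_nonneg v, norm_nonneg w, sq_nonneg (‖v‖ - ‖w‖)]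

variable (hd : 1 ≤ d) (hH : 1 / 2 < H) (hH' : H < 1) (hα : 0 < α) (hβ' : β < d)
  (hβ'' : d - 2 * α * H < β)
include hd hH hH' hα hβ' hβ''

/-- Increments of a field pinned at one fixed point. -/
theorem exists_spectralEnergy_pinnedChar_sub_le
    (hlt : α * (H - (d - β) / (2 * α)) < 1) :
    ∃ K : ℝ, 0 < K ∧ ∀ (b : Space d) (t s : ℝ) (x y : Space d),
      spectralEnergy H α β (fun τ ξ => pinnedChar b t x τ ξ - pinnedChar b s y τ ξ)
        ≤ ENNReal.ofReal (K * (|t - s| ^ (2 * (H - (d - β) / (2 * α))) +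
          spatialModulus (α * (H - (d - β) / (2 * α))) ‖x - y‖)) := by
  obtain ⟨K₁, hK₁, h₁⟩ := lintegral_spectralWeight_time hd hH' hα hβ' hβ''
  obtain ⟨K₂, hK₂, h₂⟩ := lintegral_spectralWeight_space hd hH hH' hα hβ'' hlt
  refine ⟨2 * (K₁ + K₂) + 1, by positivity, fun b t s x y => ?_⟩
  refine (spectralEnergy_le_of_norm_sq_le (by positivity) (by positivity)
    (fun τ ξ => by positivity) (fun τ ξ => ?_) (h₁ _ (abs_nonneg (t - s)))
    (h₂ _ (norm_nonneg (x - y)))).trans (ENNReal.ofReal_le_ofReal ?_)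
  · refine norm_sq_le_of_eq_add ?_ (norm_spaceTimeChar_sub_time_sq_le t s x τ ξ)
      (norm_spaceTimeChar_sub_space_sq_le s x y τ ξ)
    simp only [pinnedChar]; ring
  · rw [spatialModulus, if_pos hlt]
    set p := |t - s| ^ (2 * (H - (d - β) / (2 * α)))
    set q := ‖x - y‖ ^ (2 * (α * (H - (d - β) / (2 * α))))
    have hp : 0 ≤ p := by positivity
    have hq : 0 ≤ q := by positivity
    nlinarith [mul_nonneg hK₁ hq, mul_nonneg hK₂ hp]

/-- Increments of a field pinned at time `0` at every point. -/
theorem exists_spectralEnergy_pinnedChar_self_sub_le :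
    ∃ K : ℝ → ℝ, (∀ T, 0 < K T) ∧
      (α * (H - (d - β) / (2 * α)) < 1 → ∀ T T', K T = K T') ∧
      ∀ (T t s : ℝ) (x y : Space d), s ∈ Set.Icc 0 T →
      spectralEnergy H α β (fun τ ξ => pinnedChar x t x τ ξ - pinnedChar y s y τ ξ)
        ≤ ENNReal.ofReal (K T * (|t - s| ^ (2 * (H - (d - β) / (2 * α))) +
          spatialModulus (α * (H - (d - β) / (2 * α))) ‖x - y‖)) := by
  obtain ⟨K₁, hK₁, h₁⟩ := lintegral_spectralWeight_time hd hH' hα hβ' hβ''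
  have key : ∃ K₂ : ℝ → ℝ, (∀ T, 0 ≤ K₂ T) ∧
      (α * (H - (d - β) / (2 * α)) < 1 → ∀ T T', K₂ T = K₂ T') ∧ ∀ T r, 0 ≤ r →
      ∫⁻ ξ : Space d, ∫⁻ τ : ℝ, ENNReal.ofReal (spectralWeight H α β τ ξ *
        (min 4 (‖ξ‖ ^ 2 * r ^ 2) * min 4 (τ ^ 2 * T ^ 2)))
        ≤ ENNReal.ofReal (K₂ T * spatialModulus (α * (H - (d - β) / (2 * α))) r) := by
    -- Below the threshold the temporal factor is simply bounded by 4, so the constant does not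
    -- depend on T. Otherwise it is needed for convergence at low frequencies.
    rcases lt_or_ge (α * (H - (d - β) / (2 * α))) 1 with hlt | hge
    · obtain ⟨K₂, hK₂, h₂⟩ := lintegral_spectralWeight_space hd hH hH' hα hβ'' hlt
      refine ⟨fun _ => 4 * K₂, fun _ => by positivity, fun _ _ _ => rfl, fun T r hr => ?_⟩
      rw [spatialModulus, if_pos hlt, mul_assoc, ENNReal.ofReal_mul (by norm_num)]
      refine le_trans ?_ (mul_le_mul_right (h₂ r hr) _)
      rw [← lintegral_const_mul' _ _ ENNReal.ofReal_ne_top]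
      refine lintegral_mono fun ξ => ?_
      simp only
      rw [← lintegral_const_mul' _ _ ENNReal.ofReal_ne_top]
      refine lintegral_mono fun τ => ?_
      simp only
      rw [← ENNReal.ofReal_mul (by norm_num)]
      refine ENNReal.ofReal_le_ofReal ?_
      rw [mul_left_comm 4]
      refine mul_le_mul_of_nonneg_left ?_ (spectralWeight_nonneg _ _)
      rw [mul_comm]
      gcongr
      exact min_le_left _ _
    · choose K₂ hK₂ h₂ using fun T =>
        lintegral_spectralWeight_space_of_one_le hd hH hH' hα hβ' hge T
      exact ⟨K₂, hK₂, fun h => absurd h (not_lt.2 hge), h₂⟩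
  obtain ⟨K₂, hK₂, hc, h₂⟩ := key
  refine ⟨fun T => 2 * (K₁ + K₂ T) + 1, fun T => by have := hK₂ T; positivity,
    fun h T T' => by simp only [hc h T T'], fun T t s x y hs => ?_⟩
  have hK := hK₂ T
  have hq := spatialModulus_nonneg (α * (H - (d - β) / (2 * α))) (norm_nonneg (x - y))
  refine (spectralEnergy_le_of_norm_sq_le (by positivity) (by positivity)
    (fun τ ξ => by positivity) (fun τ ξ => ?_) (h₁ _ (abs_nonneg (t - s)))
    (h₂ T _ (norm_nonneg (x - y)))).trans (ENNReal.ofReal_le_ofReal ?_)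
  -- Move from t to s at the point x, where the pin cancels; then change x to y at time s, which is
  -- a rectangular increment. Hence only s has to lie in [0, T].
  · refine norm_sq_le_of_eq_add ?_ (norm_spaceTimeChar_sub_time_sq_le t s x τ ξ)
      (norm_spaceTimeChar_rectangle_sq_le hs x y τ ξ)
    simp only [pinnedChar]; ring
  · set p := |t - s| ^ (2 * (H - (d - β) / (2 * α)))
    set q := spatialModulus (α * (H - (d - β) / (2 * α))) ‖x - y‖
    have hp : 0 ≤ p := by positivity
    nlinarith [mul_nonneg hK₁ hq, mul_nonneg hK hp]

end EnergyUpperBounds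

/-! ### Energy lower bound for pinned combinations -/

section EnergyLowerBound

variable {d : ℕ} {H α β : ℝ}

/-- Pins enter as additional frequencies, so they too must stay away from (t,x). The hypothesis on ρ
expresses this: whatever scale separates (t,x) from the reference point must separate it from every
pin. -/
theorem exists_le_spectralEnergy (hd : 1 ≤ d) (hH : 1 / 2 < H) (hα : 0 < α) (hβ : 0 < β)
    (hβ'' : d - 2 * α * H < β) :
    ∃ c : ℝ, 0 < c ∧ ∀ (b : Space d → Space d) (n : ℕ) (t : ℝ) (x : Space d)
      (s : Fin (n + 1) → ℝ) (y : Fin (n + 1) → Space d) (a : Fin n → ℝ),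
      (∀ ρ : ℝ, 0 < ρ → ρ ≤ |t - s 0| ∨ ρ ≤ ‖x - y 0‖ ^ α →
        ∀ z, ρ ≤ |t| ∨ ρ ≤ ‖x - b z‖ ^ α) →
      ENNReal.ofReal (c * (⨅ k, (|t - s k| ^ (H - (d - β) / (2 * α)) +
        ‖x - y k‖ ^ (α * (H - (d - β) / (2 * α))))) ^ 2) ≤
      spectralEnergy H α β (fun τ ξ => pinnedChar (b x) t x τ ξ -
        ∑ k : Fin n, a k • pinnedChar (b (y k.succ)) (s k.succ) (y k.succ) τ ξ) := by
  obtain ⟨c, hc, hlow⟩ := exists_spectral_lower_bound (d := d) (β := β) hd hH hα hβ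
  set h := H - (d - β) / (2 * α) with hh
  have hh0 : 0 < h := by
    rw [hh, sub_pos, div_lt_iff₀ (by positivity)]; linarith
  refine ⟨c / 4, by positivity, fun b n t x s y a href => ?_⟩
  obtain ⟨k₀, hk₀⟩ := Finite.exists_min fun k => max |t - s k| (‖x - y k‖ ^ α)
  -- The distance to the nearest point in the anisotropic gauge, measured in units of time. The
  -- infimum in the claim is at most 2ρ^h, which accounts for c/4.
  set ρ := max |t - s k₀| (‖x - y k₀‖ ^ α) with hρ
  have hρ0 : 0 ≤ ρ := (abs_nonneg _).trans (le_max_left _ _)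
  have hinf0 : 0 ≤ ⨅ k, (|t - s k| ^ h + ‖x - y k‖ ^ (α * h)) :=
    Real.iInf_nonneg fun k => by positivity
  have hinf : ⨅ k, (|t - s k| ^ h + ‖x - y k‖ ^ (α * h)) ≤ 2 * ρ ^ h := by
    refine (ciInf_le (Set.finite_range _).bddBelow k₀).trans ?_
    rw [Real.rpow_mul (norm_nonneg _), two_mul]
    gcongr
    · exact le_max_left _ _
    · exact le_max_right _ _
  have hsq : (⨅ k, (|t - s k| ^ h + ‖x - y k‖ ^ (α * h))) ^ 2 ≤ 4 * ρ ^ (2 * h) := by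
    calc _ ≤ (2 * ρ ^ h) ^ 2 := by gcongr
      _ = 4 * ρ ^ (2 * h) := by
        rw [mul_pow, ← Real.rpow_natCast (ρ ^ h), ← Real.rpow_mul hρ0]
        norm_num [mul_comm]
  have hle : ENNReal.ofReal (c / 4 * (⨅ k, (|t - s k| ^ h + ‖x - y k‖ ^ (α * h))) ^ 2)
      ≤ ENNReal.ofReal (c * ρ ^ (2 * h)) := by
    refine ENNReal.ofReal_le_ofReal ?_
    calc _ ≤ c / 4 * (4 * ρ ^ (2 * h)) := by gcongr
      _ = _ := by ring
  refine hle.trans ?_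
  rcases hρ0.eq_or_lt with h0 | hpos
  · rw [← h0, Real.zero_rpow (by positivity), mul_zero, ENNReal.ofReal_zero]
    exact bot_le
  have hpt : ∀ k, ρ ≤ |t - s k| ∨ ρ ≤ ‖x - y k‖ ^ α := fun k => le_max_iff.1 (hk₀ k)
  have hb := href ρ hpos (hpt 0)
  -- The characters opposed to (t,x): the points with coefficients a k, the pin of x with
  -- coefficient 1, and the pins of the other points with -a k.
  refine (hlow (Fin n ⊕ Option (Fin n)) (Sum.elim a fun o => o.elim 1 fun k => -a k)
    (Sum.elim (fun k => s k.succ) fun _ => 0)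
    (Sum.elim (fun k => y k.succ) fun o => o.elim (b x) fun k => b (y k.succ)) t x ρ hpos
    ?_).trans (le_of_eq ?_)
  · rintro (k | o)
    · exact hpt k.succ
    · rw [Sum.elim_inr, sub_zero]
      cases o <;> exact hb _
  · rw [spectralEnergy]
    congr! 8 with ξ τ
    simp only [Fintype.sum_sum_type, Fintype.sum_option, Sum.elim_inl, Sum.elim_inr,
      Option.elim_none, Option.elim_some, one_smul, neg_smul, Finset.sum_neg_distrib, pinnedChar,
      smul_sub, Finset.sum_sub_distrib]
    ring

end EnergyLowerBound

/-! ### From energies to conditional variances -/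

section ConditionalVariance

variable {d : ℕ} {H α β : ℝ} {Ω' : Type*} [MeasurableSpace Ω'] {P' : Measure Ω'}
  [IsProbabilityMeasure P'] {X : ℝ≥0 → Ω' → Space d} {Ψ : Space d → ℝ}
  {μ : Measure (Space d)} {Ω : Type*} [MeasurableSpace Ω] {P : Measure Ω}
  [IsProbabilityMeasure P] {B : SpaceTimeTest d → Ω → ℝ}

/-- Common to both fields, for a general pin map b. The lower bound holds for the optimal
coefficients because the energy bound is uniform in them; the upper bound tests the minimum with one
convenient choice. -/
theorem condVarAt_bounds_of_energy (hd : 1 ≤ d) (hH : 1 / 2 < H) (hH' : H < 1)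
    (hα : 0 < α) (hβ : 0 < β) (hβ' : β < d) (hβ'' : d - 2 * α * H < β)
    (hX : IsSymmetricLevyWithExponent P' X Ψ) (hΨ : ExponentComparable Ψ α)
    (hμ : MeasureComparable μ β) (hB : IsFractionalColoredNoise H μ P B) :
    ∃ K C : ℝ, 0 < K ∧ 0 < C ∧ ∀ (b : Space d → Space d) (U : ℝ → Space d → Ω → ℝ),
      IsPinnedField H μ Ψ P B b U →
      (∀ (n : ℕ) (t : ℝ) (x : Space d) (s : Fin (n + 1) → ℝ) (y : Fin (n + 1) → Space d),
        0 ≤ t → (∀ k, 0 ≤ s k) →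
        (∀ ρ : ℝ, 0 < ρ → ρ ≤ |t - s 0| ∨ ρ ≤ ‖x - y 0‖ ^ α →
          ∀ z, ρ ≤ |t| ∨ ρ ≤ ‖x - b z‖ ^ α) →
        ∀ᵐ ω ∂P, K * (⨅ k, (|t - s k| ^ (H - (d - β) / (2 * α)) +
          ‖x - y k‖ ^ (α * (H - (d - β) / (2 * α))))) ^ 2 ≤ condVarAt P U t x s y ω) ∧
      ∀ (I : Set ℝ) (v : ℝ → ℝ → Space d → Space d → ℝ), I ⊆ Set.Ici 0 →
        (∀ t s x y, 0 ≤ v t s x y) →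
        (∀ t ∈ I, ∀ s ∈ I, ∀ x y, spectralEnergy H α β
          (fun τ ξ => pinnedChar (b x) t x τ ξ - pinnedChar (b y) s y τ ξ)
            ≤ ENNReal.ofReal (v t s x y)) →
        (∀ t ∈ I, ∀ s ∈ I, ∀ x y, Integrable (fun ω => (U t x ω - U s y ω) ^ 2) P ∧
          ∫ ω, (U t x ω - U s y ω) ^ 2 ∂P ≤ C * v t s x y) ∧
        ∀ (n : ℕ) (t : ℝ) (x : Space d) (s : Fin (n + 1) → ℝ) (y : Fin (n + 1) → Space d),
          t ∈ I → (∀ k, s k ∈ I) → s 0 = 0 → b (y 0) = y 0 →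
          ∀ᵐ ω ∂P, condVarAt P U t x s y ω ≤ C * ⨅ k, v t (s k) x (y k) := by
  obtain ⟨c, C, hc, hC, hvar⟩ :=
    exists_pinnedField_variance_bounds hd hH hH' hα hβ hβ' hX hΨ hμ hB
  obtain ⟨c', hc', hlow⟩ := exists_le_spectralEnergy (d := d) hd hH hα hβ hβ''
  refine ⟨c * c', C, by positivity, hC, fun b U hU => ⟨?_, fun I v hI hv hE => ⟨?_, ?_⟩⟩⟩
  · intro n t x s y ht hs href
    obtain ⟨hG, ⟨h0, h0'⟩, hb⟩ := hvar b U hU n t x (fun k => s k.succ) (fun k => y k.succ) ht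
      fun k => hs _
    obtain ⟨a, ha, -⟩ := exists_condVar_eq_of_hasGaussianLaw (hU t ht x).1
      (fun k : Fin n => (hU _ (hs k.succ) (y k.succ)).1) hG h0 h0'
    filter_upwards [ha] with ω hω
    rw [condVarAt, hω, ← ENNReal.ofReal_le_ofReal_iff (integral_nonneg fun ω => sq_nonneg _),
      mul_assoc, ENNReal.ofReal_mul hc.le]
    exact (mul_le_mul_right (hlow b n t x s y a href) _).trans (hb a).1
  · intro t ht s hs x y
    obtain ⟨hG, -, hb⟩ := hvar b U hU 1 t x (fun _ => s) (fun _ => y) (hI ht) fun _ => hI hs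
    refine ⟨(hG.fst.memLp_two.sub (hG.snd.eval 0).memLp_two).integrable_sq, ?_⟩
    have h := (hb fun _ => 1).2
    simp only [Fin.sum_univ_one, one_mul, one_smul] at h
    rw [← ENNReal.ofReal_le_ofReal_iff (mul_nonneg hC.le (hv _ _ _ _)), ENNReal.ofReal_mul hC.le]
    exact h.trans (mul_le_mul_right (hE t ht s hs x y) _)
  · intro n t x s y ht hs hs0 hb0
    obtain ⟨hG, ⟨h0, h0'⟩, hb⟩ := hvar b U hU n t x (fun k => s k.succ) (fun k => y k.succ) (hI ht)
      fun k => hI (hs _)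
    obtain ⟨a, ha, hmin⟩ := exists_condVar_eq_of_hasGaussianLaw (hU t (hI ht) x).1
      (fun k : Fin n => (hU _ (hI (hs k.succ)) (y k.succ)).1) hG h0 h0'
    filter_upwards [ha] with ω hω
    rw [condVarAt, hω]
    obtain ⟨k, hk⟩ := exists_eq_ciInf_of_finite (f := fun k => v t (s k) x (y k))
    rw [← hk]
    have hkE := hE t ht (s k) (hs k) x (y k)
    -- It suffices to approximate by the minimizing point alone: coefficient 1 on it if it is a
    -- conditioning point, and all coefficients 0 if it is the reference point, whose pinned
    -- numerator vanishes identically.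
    suffices hcoef : ∃ e : Fin n → ℝ, ∀ τ ξ, ∑ j, e j • pinnedChar (b (y j.succ)) (s j.succ)
        (y j.succ) τ ξ = pinnedChar (b (y k)) (s k) (y k) τ ξ by
      obtain ⟨e, he⟩ := hcoef
      refine (hmin e).trans ?_
      rw [← ENNReal.ofReal_le_ofReal_iff (mul_nonneg hC.le (hv _ _ _ _)),
        ENNReal.ofReal_mul hC.le]
      refine (hb e).2.trans ?_
      simp only [he]
      exact mul_le_mul_right hkE _
    induction k using Fin.cases with
    | zero => exact ⟨0, fun τ ξ => by rw [hb0, hs0, pinnedChar_self]; simp⟩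
    | succ k => exact ⟨Pi.single k 1, fun τ ξ => by
        rw [Finset.sum_eq_single k (fun j _ hj => by simp [hj]) (by simp)]; simp⟩

end ConditionalVariance

/-! ### The two pinned fields -/

theorem mainTheorem3 {d : ℕ} (H α β H₁ H₂ : ℝ)
    (hH : 1 / 2 < H) (hH' : H < 1) (hα : 0 < α) (hα' : α ≤ 2)
    (hβ : 0 < β) (hβ' : β < d) (hβ'' : d - 2 * α * H < β)
    (hH₁ : H₁ = H - (d - β) / (2 * α)) (hH₂ : H₂ = α * H₁)
    -- the symmetric Lévy process, with exponent comparable to `|ξ|^α`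
    {Ω' : Type*} [MeasurableSpace Ω'] (P' : Measure Ω') [IsProbabilityMeasure P']
    (X : ℝ≥0 → Ω' → Space d) (Ψ : Space d → ℝ)
    (hX : IsSymmetricLevyWithExponent P' X Ψ) (hΨ : ExponentComparable Ψ α)
    -- the noise, with spatial spectral measure comparable to `|ξ|^{-β} dξ`
    (μ : Measure (Space d)) (hμ : MeasureComparable μ β)
    {Ω : Type*} [MeasurableSpace Ω] (P : Measure Ω) [IsProbabilityMeasure P]
    (B : SpaceTimeTest d → Ω → ℝ) (hB : IsFractionalColoredNoise H μ P B) :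
    -- the field with stationary increments in `(t, x)`, pinned at `(0, 0)`
    (H₂ < 1 → ∀ U : ℝ → Space d → Ω → ℝ, IsPinnedField H μ Ψ P B (fun _ => 0) U →
      (∃ K : ℝ, 0 < K ∧ ∀ (n : ℕ) (t : ℝ) (x : Space d)
          (s : Fin (n + 1) → ℝ) (y : Fin (n + 1) → Space d),
          0 < t → (∀ k, 0 ≤ s k) → s 0 = 0 → y 0 = 0 →
          ∀ᵐ ω ∂P, K * (⨅ k, (|t - s k| ^ H₁ + ‖x - y k‖ ^ H₂)) ^ 2
            ≤ condVarAt P U t x s y ω) ∧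
      (∃ K₁ : ℝ, 0 < K₁ ∧
        (∀ (t s : ℝ) (x y : Space d), 0 ≤ t → 0 ≤ s →
          Integrable (fun ω => (U t x ω - U s y ω) ^ 2) P ∧
          ∫ ω, (U t x ω - U s y ω) ^ 2 ∂P
            ≤ K₁ * (|t - s| ^ (2 * H₁) + spatialModulus H₂ ‖x - y‖)) ∧
        (∀ (n : ℕ) (t : ℝ) (x : Space d)
          (s : Fin (n + 1) → ℝ) (y : Fin (n + 1) → Space d),
          0 < t → (∀ k, 0 ≤ s k) → s 0 = 0 → y 0 = 0 →
          ∀ᵐ ω ∂P, condVarAt P U t x s y ω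
            ≤ K₁ * ⨅ k, (|t - s k| ^ (2 * H₁) + spatialModulus H₂ ‖x - y k‖)))) ∧
    -- the field `∫∫ (p_{(t-u)₊}(x-y) - p_{(-u)₊}(x-y)) B(du,dy)`, pinned at every `(0, x)`
    (∀ U : ℝ → Space d → Ω → ℝ, IsPinnedField H μ Ψ P B (fun x => x) U →
      (∃ K : ℝ, 0 < K ∧ ∀ (n : ℕ) (t : ℝ) (x : Space d)
          (s : Fin (n + 1) → ℝ) (y : Fin (n + 1) → Space d),
          0 < t → (∀ k, 0 ≤ s k) → s 0 = 0 → y 0 = x →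
          ∀ᵐ ω ∂P, K * (⨅ k, (|t - s k| ^ H₁ + ‖x - y k‖ ^ H₂)) ^ 2
            ≤ condVarAt P U t x s y ω) ∧
      (∃ K₁ : ℝ → ℝ, (∀ T, 0 < K₁ T) ∧ (H₂ < 1 → ∀ T T', K₁ T = K₁ T') ∧
        ∀ T : ℝ, 0 < T →
        (∀ (t s : ℝ) (x y : Space d), t ∈ Set.Icc 0 T → s ∈ Set.Icc 0 T →
          Integrable (fun ω => (U t x ω - U s y ω) ^ 2) P ∧
          ∫ ω, (U t x ω - U s y ω) ^ 2 ∂P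
            ≤ K₁ T * (|t - s| ^ (2 * H₁) + spatialModulus H₂ ‖x - y‖)) ∧
        (∀ (n : ℕ) (t : ℝ) (x : Space d)
          (s : Fin (n + 1) → ℝ) (y : Fin (n + 1) → Space d),
          0 < t → t ≤ T → (∀ k, s k ∈ Set.Icc 0 T) → s 0 = 0 → y 0 = x →
          ∀ᵐ ω ∂P, condVarAt P U t x s y ω
            ≤ K₁ T * ⨅ k, (|t - s k| ^ (2 * H₁) + spatialModulus H₂ ‖x - y k‖)))) := by
  have hd : 1 ≤ d := by
    have : (0 : ℝ) < d := hβ.trans hβ'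
    exact_mod_cast this
  obtain ⟨K, C, hK, hC, hfield⟩ :=
    condVarAt_bounds_of_energy hd hH hH' hα hβ hβ' hβ'' hX hΨ hμ hB
  subst hH₂ hH₁
  have hv : ∀ (k h h' : ℝ), 0 ≤ k → ∀ (t s : ℝ) (x y : Space d),
      0 ≤ k * (|t - s| ^ h + spatialModulus h' ‖x - y‖) := fun k h h' hk t s x y =>
    mul_nonneg hk (add_nonneg (by positivity) (spatialModulus_nonneg _ (norm_nonneg _)))
  constructor
  · intro hlt U hU
    obtain ⟨hlow, hup⟩ := hfield _ U hU
    obtain ⟨K₁, hK₁, hE⟩ :=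
      exists_spectralEnergy_pinnedChar_sub_le hd hH hH' hα hβ' hβ'' hlt
    obtain ⟨hinc, hcond⟩ := hup (Set.Ici 0) _ le_rfl (hv K₁ _ _ hK₁.le)
      fun t _ s _ x y => hE 0 t s x y
    refine ⟨⟨K, hK, fun n t x s y ht hs hs0 hy0 => hlow n t x s y ht.le hs ?_⟩, C * K₁,
      by positivity, fun t s x y ht hs => ?_, fun n t x s y ht hs hs0 hy0 => ?_⟩
    -- The only pin is (0,0), which is the reference point.
    · intro ρ _ h z
      rwa [hs0, hy0, sub_zero] at h
    · rw [mul_assoc]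
      exact hinc t ht s hs x y
    · simp only [mul_assoc C, Real.mul_iInf_of_nonneg hK₁.le]
      exact hcond n t x s y ht.le hs hs0 hy0.symm
  · intro U hU
    obtain ⟨hlow, hup⟩ := hfield _ U hU
    obtain ⟨K₁, hK₁, hconst, hE⟩ :=
      exists_spectralEnergy_pinnedChar_self_sub_le hd hH hH' hα hβ' hβ''
    refine ⟨⟨K, hK, fun n t x s y ht hs hs0 hy0 => hlow n t x s y ht.le hs ?_⟩,
      fun T => C * K₁ T, fun T => mul_pos hC (hK₁ T),
      fun hlt T T' => by simp only [hconst hlt T T'], fun T hT => ?_⟩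
    -- The reference point (0,x) has spatial distance 0 from (t,x), so separation at scale ρ > 0
    -- forces ρ ≤ |t|. Every pin lies at time 0 and is thus separated in time.
    · intro ρ hρ h z
      rw [hs0, hy0, sub_zero, sub_self, norm_zero, Real.zero_rpow hα.ne'] at h
      exact Or.inl (h.resolve_right (not_le.2 hρ))
    · obtain ⟨hinc, hcond⟩ := hup (Set.Icc 0 T) _ Set.Icc_subset_Ici_self
        (hv (K₁ T) _ _ (hK₁ T).le) fun t _ s hs x y => hE T t s x y hs
      refine ⟨fun t s x y ht hs => ?_, fun n t x s y ht htT hs hs0 hy0 => ?_⟩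
      · rw [mul_assoc]
        exact hinc t ht s hs x y
      · simp only [mul_assoc C, Real.mul_iInf_of_nonneg (hK₁ T).le]
        exact hcond n t x s y ⟨ht.le, htT⟩ hs hs0 rfl
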